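/- Let $N\ge 1$ be an integer, let $\overline{\mathbb Q}\subset\mathbb C$ be the field of algebraic numbers, let $\mathbb H$ be the upper half-plane, and let $\Gamma(N)=\ker(SL_2(\mathbb Z)\to SL_2(\mathbb Z/N\mathbb Z))$. A modular function of level $N$ is a meromorphic function $f$ on $\mathbb H$ with $f(\gamma\tau)=f(\tau)$ for all $\gamma\in\Gamma(N)$ that is meromorphic at all cusps: for every $\gamma\in SL_2(\mathbb Z)$ the function $f(\gamma\tau)$ has, for $\operatorname{Im}\tau$ large, an expansion $\sum_{n\ge m}a_n e^{2\pi i n\tau/N}$ with $m\in\mathbb Z$ and $a_n\in\mathbb C$. For $\gamma=I$ the $a_n$ are the Fourier coefficients of $f$ at $i\infty$. Let $F_{N,\overline{\mathbb Q}}$ be the set of modular functions of level $N$ all of whose Fourier coefficients at $i\infty$ are algebraic. Let $j=E_4^3/\Delta$ with $\Delta=(E_4^3-E_6^2)/1728$, where $E_4,E_6$ are the normalised Eisenstein series of weights $4$ and $6$ for $SL_2(\mathbb Z)$. For $\tau\in\mathbb H$ put $L_\tau=\mathbb Z\tau+\mathbb Z$, $g_2(L_\tau)=60\sum_{0\ne\omega\in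 L_\tau}\omega^{-4}$, $g_3(L_\tau)=140\sum_{0\ne\omega\in L_\tau}\omega^{-6}$, $\Delta_0(L_\tau)=g_2(L_\tau)^3-27g_3(L_\tau)^2$, and let $\wp_{L_\tau}$ be the Weierstrass function of $L_\tau$. Put $S=\{(\frac rN,\frac sN): 0\le r,s\le N-1,\ (r,s)\ne(0,0)\}$ and, for $a=(a_1,a_2)\in S$, $$f_a(\tau)=\frac{g_2(L_\tau)\,g_3(L_\tau)}{\Delta_0(L_\tau)}\;\wp_{L_\tau}(a_1\tau+a_2).$$ Theorem. Inside the field of meromorphic functions on $\mathbb H$, the set $F_{N,\overline{\mathbb Q}}$ is a field containing $\overline{\mathbb Q}(j)$, it is a finite Galois extension of $\overline{\mathbb Q}(j)$, and $$F_{N,\overline{\mathbb Q}}=\overline{\mathbb Q}(j,\ f_a : a\in S).$$ -/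

import Mathlib

open UpperHalfPlane Filter Topology
open scoped MatrixGroups

noncomputable section

/-! ### The field of meromorphic functions on the upper half-plane -/

/-- The algebra of functions on `ℍ` that are meromorphic at every point of `ℍ`. (The value of such
a function at a pole is an arbitrary complex number.) -/
def meromorphicAlgebra : Subalgebra ℂ (ℍ → ℂ) where
  carrier := {f | MeromorphicOn (f ∘ ofComplex) upperHalfPlaneSet}
  mul_mem' hf hg := MeromorphicOn.mul hf hg
  add_mem' hf hg := MeromorphicOn.add hf hg
  algebraMap_mem' c := MeromorphicOn.const c

lemma mem_meromorphicAlgebra {f : ℍ → ℂ} :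
    f ∈ meromorphicAlgebra ↔ MeromorphicOn (f ∘ ofComplex) upperHalfPlaneSet := Iff.rfl

/-- The ideal of functions that vanish outside a closed discrete subset of `ℍ`. -/
def negligibleIdeal : Ideal meromorphicAlgebra where
  carrier := {f | (f : ℍ → ℂ) ∘ ofComplex =ᶠ[codiscreteWithin upperHalfPlaneSet] 0}
  add_mem' {f g} hf hg := by
    change _ =ᶠ[codiscreteWithin upperHalfPlaneSet] _
    filter_upwards [hf, hg] with z hz hz'
    have h1 : (f : ℍ → ℂ) (ofComplex z) = 0 := hz
    have h2 : (g : ℍ → ℂ) (ofComplex z) = 0 := hz'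
    simp [h1, h2]
  zero_mem' := by
    change _ =ᶠ[codiscreteWithin upperHalfPlaneSet] _
    exact Eventually.of_forall fun _ ↦ rfl
  smul_mem' c f hf := by
    change _ =ᶠ[codiscreteWithin upperHalfPlaneSet] _
    filter_upwards [hf] with z hz
    have h1 : (f : ℍ → ℂ) (ofComplex z) = 0 := hz
    simp [h1]

lemma mem_negligibleIdeal {f : meromorphicAlgebra} : f ∈ negligibleIdeal ↔
    (f : ℍ → ℂ) ∘ ofComplex =ᶠ[codiscreteWithin upperHalfPlaneSet] 0 := Iff.rfl

lemma isPreconnected_upperHalfPlaneSet : IsPreconnected upperHalfPlaneSet :=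
  (convex_halfSpace_im_gt 0).isPreconnected

lemma eventually_ne_zero_of_notMem_negligibleIdeal {f : meromorphicAlgebra}
    (hf : f ∉ negligibleIdeal) :
    ∀ᶠ z in codiscreteWithin upperHalfPlaneSet, (f : ℍ → ℂ) (ofComplex z) ≠ 0 := by
  have hm : MeromorphicOn ((f : ℍ → ℂ) ∘ ofComplex) upperHalfPlaneSet := f.2
  refine hm.eventually_codiscreteWithin_apply_ne_zero fun x hx htop ↦ hf ?_
  rw [mem_negligibleIdeal, EventuallyEq, eventually_iff, mem_codiscreteWithin]
  intro y hy
  have hy' : meromorphicOrderAt ((f : ℍ → ℂ) ∘ ofComplex) y = ⊤ := by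
    by_contra hne
    exact hm.meromorphicOrderAt_ne_top_of_isPreconnected isPreconnected_upperHalfPlaneSet
      hy hx hne htop
  rw [meromorphicOrderAt_eq_top_iff] at hy'
  rw [disjoint_principal_right]
  filter_upwards [hy'] with z hz
  simpa using fun _ ↦ hz

instance negligibleIdeal_isMaximal : negligibleIdeal.IsMaximal := by
  rw [Ideal.isMaximal_iff]
  constructor
  · intro h
    have h0 : {z : ℂ | z ∉ upperHalfPlaneSet} ∈ codiscreteWithin upperHalfPlaneSet := by
      filter_upwards [mem_negligibleIdeal.1 h] with z hz
      simp at hz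
    rw [mem_codiscreteWithin] at h0
    have h1 := h0 Complex.I (by simp [upperHalfPlaneSet])
    rw [disjoint_principal_right] at h1
    have h2 : upperHalfPlaneSet ∈ 𝓝[≠] Complex.I :=
      mem_nhdsWithin_of_mem_nhds (isOpen_upperHalfPlaneSet.mem_nhds (by simp [upperHalfPlaneSet]))
    have h3 : (∅ : Set ℂ) ∈ 𝓝[≠] Complex.I := by
      filter_upwards [h1, h2] with z hz hz'
      exact hz ⟨hz', fun h ↦ h hz'⟩
    exact (NeBot.ne inferInstance) (empty_mem_iff_bot.1 h3)
  · intro J f hJ hf hfJ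
    have hinv : (fun τ ↦ ((f : ℍ → ℂ) τ)⁻¹) ∈ meromorphicAlgebra := MeromorphicOn.inv f.2
    let g : meromorphicAlgebra := ⟨_, hinv⟩
    have h1 : 1 - g * f ∈ negligibleIdeal := by
      rw [mem_negligibleIdeal]
      filter_upwards [eventually_ne_zero_of_notMem_negligibleIdeal hf] with z hz
      simp [g, hz]
    have := J.add_mem (hJ h1) (J.mul_mem_left g hfJ)
    simpa using this

/-- The field of meromorphic functions on `ℍ`: two functions are identified when they agree outside
a closed discrete set (so that values at poles play no role). -/
def MeromorphicField : Type := meromorphicAlgebra ⧸ negligibleIdeal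

instance : Field MeromorphicField := Ideal.Quotient.field negligibleIdeal

instance : Algebra ℂ MeromorphicField :=
  inferInstanceAs (Algebra ℂ (meromorphicAlgebra ⧸ negligibleIdeal))

/-- The element of the field of meromorphic functions that is represented by a given function. -/
def toMeromorphicField : meromorphicAlgebra →ₐ[ℂ] MeromorphicField :=
  Ideal.Quotient.mkₐ ℂ negligibleIdeal

/-- The field of algebraic numbers in `ℂ`. -/
abbrev Qbar : IntermediateField ℚ ℂ := algebraicClosure ℚ ℂ


/-! ### Lattice functions -/

/-- The basis `(τ, 1)` of the lattice `L_τ = ℤ τ ⊕ ℤ`. -/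
def latticePair (τ : ℍ) : PeriodPair where
  ω₁ := τ
  ω₂ := 1
  indep := by
    rw [LinearIndependent.pair_iff]
    intro s t h
    have him := congrArg Complex.im h
    have hre := congrArg Complex.re h
    simp at him hre
    have hs : s = 0 := him.resolve_right τ.im_ne_zero
    subst hs
    simpa using hre

/-- `Δ₀(L_τ) = g₂(L_τ)³ - 27 g₃(L_τ)²`. -/
def latticeDisc (τ : ℍ) : ℂ := (latticePair τ).g₂ ^ 3 - 27 * (latticePair τ).g₃ ^ 2

/-- The normalised value `f_a(τ) = (g₂ g₃ / Δ₀)(L_τ) · ℘(a₁ τ + a₂; L_τ)` of the Weierstrass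
function. -/
def frickeFun (a : ℚ × ℚ) (τ : ℍ) : ℂ :=
  (latticePair τ).g₂ * (latticePair τ).g₃ / latticeDisc τ *
    (latticePair τ).weierstrassP (a.1 * τ + a.2)

/-- `j(τ) = E₄(τ)³ / Δ(τ)` with `Δ = (E₄³ - E₆²) / 1728`. -/
def jFun (τ : ℍ) : ℂ :=
  ModularForm.E₄ τ ^ 3 / ((ModularForm.E₄ τ ^ 3 - ModularForm.E₆ τ ^ 2) / 1728)

/-- The pairs `(r/N, s/N)` with `0 ≤ r, s ≤ N - 1` and `(r, s) ≠ (0, 0)`. -/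
def torsionIndex (N : ℕ) : Set (ℚ × ℚ) :=
  {a | ∃ r s : ℕ, r < N ∧ s < N ∧ (r, s) ≠ (0, 0) ∧ a = ((r : ℚ) / N, (s : ℚ) / N)}

lemma tsum_lattice (τ : ℍ) (F : ℂ → ℂ) :
    ∑' l : (latticePair τ).lattice, F l = ∑' x : Fin 2 → ℤ, F (x 0 * τ + x 1) := by
  rw [← ((finTwoArrowEquiv ℤ).trans (latticePair τ).latticeEquivProd.symm.toEquiv).tsum_eq]
  refine tsum_congr fun x ↦ ?_
  congr 1
  have := (latticePair τ).latticeEquiv_symm_apply (x 0, x 1)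
  simpa [latticePair] using! this

lemma r_mul_max_abs_le (τ : ℍ) (c d : ℝ) :
    EisensteinSeries.r τ * max |c| |d| ≤ ‖(c : ℂ) * τ + d‖ := by
  rcases (le_max_of_le_left (abs_nonneg c) : 0 ≤ max |c| |d|).eq_or_lt with h0 | hpos
  · rw [← h0]; simp
  set M := max |c| |d| with hM
  have key : EisensteinSeries.r τ ≤ ‖((c / M : ℝ) : ℂ) * τ + ((d / M : ℝ) : ℂ)‖ := by
    rcases max_choice |c| |d| with h | h
    · refine EisensteinSeries.auxbound1 τ _ ?_
      rw [div_pow, ← sq_abs c, ← h, ← hM, div_self (by positivity)]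
    · refine EisensteinSeries.auxbound2 τ _ ?_
      rw [div_pow, ← sq_abs d, ← h, ← hM, div_self (by positivity)]
  have h1 : (c : ℂ) * τ + d = (((c / M : ℝ) : ℂ) * τ + ((d / M : ℝ) : ℂ)) * M := by
    have : (M : ℂ) ≠ 0 := by exact_mod_cast hpos.ne'
    push_cast
    field_simp
  rw [h1, norm_mul, Complex.norm_real, Real.norm_of_nonneg hpos.le]
  gcongr

lemma norm_intVec (x : Fin 2 → ℤ) : ‖x‖ = max |(x 0 : ℝ)| |(x 1 : ℝ)| := by
  rw [EisensteinSeries.norm_eq_max_natAbs]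
  simp [Nat.cast_max]

/-- An open box around a point of `ℍ`, on which lattice sums converge uniformly. -/
lemma exists_box {z : ℂ} (hz : z ∈ upperHalfPlaneSet) : ∃ (U : Set ℂ) (ρ T : ℝ), IsOpen U ∧ z ∈ U ∧
    0 < ρ ∧ 0 ≤ T ∧ U ⊆ upperHalfPlaneSet ∧ (∀ w ∈ U, ‖w‖ ≤ T) ∧
    ∀ w ∈ U, ∀ c d : ℝ, ρ * max |c| |d| ≤ ‖(c : ℂ) * w + d‖ := by
  have hz' : 0 < z.im := hz
  have hB : 0 < z.im / 2 := by positivity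
  refine ⟨{w | |w.re| < |z.re| + 1} ∩ {w | z.im / 2 < w.im} ∩ {w | ‖w‖ < ‖z‖ + 1},
    EisensteinSeries.r ⟨⟨|z.re| + 1, z.im / 2⟩, hB⟩, ‖z‖ + 1, ?_, ?_, EisensteinSeries.r_pos _,
    by positivity, ?_, ?_, ?_⟩
  · refine ((isOpen_lt (by fun_prop) (by fun_prop)).inter
      (isOpen_lt (by fun_prop) (by fun_prop))).inter (isOpen_lt (by fun_prop) (by fun_prop))
  · refine ⟨⟨?_, ?_⟩, ?_⟩ <;> simp [hz']
  · intro w hw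
    exact hB.trans hw.1.2
  · intro w hw
    exact le_of_lt hw.2
  · intro w hw c d
    have hw0 : 0 < w.im := hB.trans hw.1.2
    refine le_trans ?_ (r_mul_max_abs_le ⟨w, hw0⟩ c d)
    gcongr
    exact EisensteinSeries.r_lower_bound_on_verticalStrip _ hB ⟨le_of_lt hw.1.1, le_of_lt hw.1.2⟩

lemma differentiableOn_latticeSum {F : (Fin 2 → ℤ) → ℂ → ℂ}
    (h : ∀ z ∈ upperHalfPlaneSet, ∃ (U : Set ℂ) (u : (Fin 2 → ℤ) → ℝ), IsOpen U ∧ z ∈ U ∧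
      Summable u ∧ (∀ x, DifferentiableOn ℂ (F x) U) ∧ ∀ x, ∀ w ∈ U, ‖F x w‖ ≤ u x) :
    DifferentiableOn ℂ (fun w ↦ ∑' x, F x w) upperHalfPlaneSet := by
  intro z hz
  obtain ⟨U, u, hU, hzU, hu, hd, hb⟩ := h z hz
  exact ((Complex.differentiableOn_tsum_of_summable_norm hu hd hU hb).differentiableAt
    (hU.mem_nhds hzU)).differentiableWithinAt

lemma summable_norm_inv_pow {k : ℕ} (hk : 3 ≤ k) :
    Summable fun x : Fin 2 → ℤ ↦ (‖x‖ ^ k)⁻¹ := by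
  have := EisensteinSeries.summable_one_div_norm_rpow (k := k)
    (by exact_mod_cast (by omega : 2 < k))
  refine this.congr fun x ↦ ?_
  rw [Real.rpow_neg (norm_nonneg _), Real.rpow_natCast]

lemma intVec_ne {U : Set ℂ} {ρ : ℝ} (hρ : 0 < ρ)
    (hb : ∀ w ∈ U, ∀ c d : ℝ, ρ * max |c| |d| ≤ ‖(c : ℂ) * w + d‖) {x : Fin 2 → ℤ} (hx : x ≠ 0)
    {w : ℂ} (hw : w ∈ U) : ρ * ‖x‖ ≤ ‖(x 0 : ℂ) * w + x 1‖ ∧ (x 0 : ℂ) * w + x 1 ≠ 0 := by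
  have h1 := hb w hw (x 0) (x 1)
  rw [← norm_intVec] at h1
  push_cast at h1
  refine ⟨h1, ?_⟩
  rw [← norm_pos_iff]
  exact lt_of_lt_of_le (mul_pos hρ (norm_pos_iff.2 hx)) h1

lemma differentiableOn_latticeG {k : ℕ} (hk : 3 ≤ k) :
    DifferentiableOn ℂ (fun w ↦ ∑' x : Fin 2 → ℤ, (((x 0 : ℂ) * w + x 1) ^ k)⁻¹)
      upperHalfPlaneSet := by
  refine differentiableOn_latticeSum fun z hz ↦ ?_
  obtain ⟨U, ρ, T, hU, hzU, hρ, -, -, -, hb⟩ := exists_box hz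
  refine ⟨U, fun x ↦ (ρ ^ k)⁻¹ * (‖x‖ ^ k)⁻¹, hU, hzU, (summable_norm_inv_pow hk).mul_left _,
    fun x ↦ ?_, fun x w hw ↦ ?_⟩
  · by_cases hx : x = 0
    · subst hx; simp
    · have : ∀ w ∈ U, ((x 0 : ℂ) * w + x 1) ^ k ≠ 0 := fun w hw ↦
        pow_ne_zero _ (intVec_ne hρ hb hx hw).2
      exact DifferentiableOn.inv (by fun_prop) this
  · by_cases hx : x = 0
    · subst hx
      have : k ≠ 0 := by omega
      simp [this]
    · dsimp only
      rw [norm_inv, norm_pow, ← mul_inv, ← mul_pow]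
      have := norm_pos_iff.2 hx
      gcongr
      exact (intVec_ne hρ hb hx hw).1

lemma exists_dist_bound {a₁ a₂ : ℝ} (ha : ¬ ∃ m n : ℤ, a₁ = m ∧ a₂ = n) :
    ∃ c : ℝ, 0 < c ∧ ∀ x : Fin 2 → ℤ,
      c ≤ max |a₁ - x 0| |a₂ - x 1| ∧ c * ‖x‖ ≤ max |a₁ - x 0| |a₂ - x 1| := by
  set δ := max |a₁ - round a₁| |a₂ - round a₂| with hδ
  set A := max |a₁| |a₂| with hA
  have hA0 : 0 ≤ A := le_max_of_le_left (abs_nonneg _)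
  have hδ0 : 0 < δ := by
    by_contra! h
    refine ha ⟨round a₁, round a₂, ?_, ?_⟩
    · have := (le_max_left |a₁ - round a₁| |a₂ - round a₂|).trans h
      linarith [abs_nonpos_iff.1 this]
    · have := (le_max_right |a₁ - round a₁| |a₂ - round a₂|).trans h
      linarith [abs_nonpos_iff.1 this]
  have h1 : ∀ x : Fin 2 → ℤ, δ ≤ max |a₁ - x 0| |a₂ - x 1| := fun x ↦
    max_le_max (round_le _ _) (round_le _ _)
  have h2 : ∀ x : Fin 2 → ℤ, ‖x‖ ≤ max |a₁ - x 0| |a₂ - x 1| + A := by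
    intro x
    rw [norm_intVec]
    refine max_le ?_ ?_
    · have e : (x 0 : ℝ) = a₁ - (a₁ - x 0) := by ring
      have := abs_sub a₁ (a₁ - x 0)
      rw [← e] at this
      have := le_max_left |a₁ - x 0| |a₂ - x 1|
      have := le_max_left |a₁| |a₂|
      linarith
    · have e : (x 1 : ℝ) = a₂ - (a₂ - x 1) := by ring
      have := abs_sub a₂ (a₂ - x 1)
      rw [← e] at this
      have := le_max_right |a₁ - x 0| |a₂ - x 1|
      have := le_max_right |a₁| |a₂|
      linarith
  refine ⟨min δ (δ / (δ + A)), by positivity, fun x ↦ ⟨(min_le_left _ _).trans (h1 x), ?_⟩⟩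
  refine (mul_le_mul_of_nonneg_right (min_le_right _ _) (norm_nonneg x)).trans ?_
  rw [div_mul_eq_mul_div, div_le_iff₀ (by positivity)]
  nlinarith [h1 x, h2 x]

lemma differentiableOn_latticeWP {a₁ a₂ : ℝ} (ha : ¬ ∃ m n : ℤ, a₁ = m ∧ a₂ = n) :
    DifferentiableOn ℂ (fun w ↦ ∑' x : Fin 2 → ℤ,
      (1 / ((a₁ : ℂ) * w + a₂ - ((x 0 : ℂ) * w + x 1)) ^ 2 - 1 / ((x 0 : ℂ) * w + x 1) ^ 2))
      upperHalfPlaneSet := by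
  obtain ⟨c, hc, hcx⟩ := exists_dist_bound ha
  refine differentiableOn_latticeSum fun z hz ↦ ?_
  obtain ⟨U, ρ, T, hU, hzU, hρ, hT, -, hUT, hb⟩ := exists_box hz
  set W := |a₁| * T + |a₂| with hW
  have hW0 : 0 ≤ W := by positivity
  have hlow : ∀ x : Fin 2 → ℤ, ∀ w ∈ U, ρ * max |a₁ - x 0| |a₂ - x 1| ≤
      ‖(a₁ : ℂ) * w + a₂ - ((x 0 : ℂ) * w + x 1)‖ := by
    intro x w hw
    convert hb w hw (a₁ - x 0) (a₂ - x 1) using 2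
    push_cast
    ring
  have hne : ∀ x : Fin 2 → ℤ, ∀ w ∈ U, (a₁ : ℂ) * w + a₂ - ((x 0 : ℂ) * w + x 1) ≠ 0 := by
    intro x w hw
    rw [← norm_pos_iff]
    exact lt_of_lt_of_le (mul_pos hρ (hc.trans_le (hcx x).1)) (hlow x w hw)
  refine ⟨U, Function.update (fun x ↦ (W * (2 * (T + 1) + W) / (ρ ^ 4 * c ^ 2)) * (‖x‖ ^ 3)⁻¹) 0
    (1 / (ρ * c) ^ 2), hU, hzU, ?_, fun x ↦ ?_, fun x w hw ↦ ?_⟩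
  · exact ((summable_norm_inv_pow le_rfl).mul_left _).update _ _
  · have e1 : DifferentiableOn ℂ
        (fun w ↦ 1 / ((a₁ : ℂ) * w + a₂ - ((x 0 : ℂ) * w + x 1)) ^ 2) U :=
      DifferentiableOn.div (by fun_prop) (by fun_prop) fun w hw ↦ pow_ne_zero _ (hne x w hw)
    refine e1.sub ?_
    by_cases hx : x = 0
    · subst hx; simp
    · exact DifferentiableOn.div (by fun_prop) (by fun_prop)
        fun w hw ↦ pow_ne_zero _ (intVec_ne hρ hb hx hw).2
  · by_cases hx : x = 0
    · subst hx
      have h1 := hlow 0 w hw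
      have h2 := (hcx 0).1
      rw [Function.update_self]
      simp only [Pi.zero_apply, Int.cast_zero, zero_mul, add_zero, sub_zero] at h1 h2 ⊢
      have h3 : ρ * c ≤ ‖(a₁ : ℂ) * w + a₂‖ := le_trans (by gcongr) h1
      simp only [ne_eq, OfNat.ofNat_ne_zero, not_false_eq_true, zero_pow, div_zero, sub_zero,
        norm_div, norm_one, norm_pow]
      gcongr
    · rw [Function.update_of_ne hx]
      have hxn : 1 ≤ ‖x‖ := by
        rw [EisensteinSeries.norm_eq_max_natAbs]
        have : max (x 0).natAbs (x 1).natAbs ≠ 0 := by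
          intro h
          apply hx
          ext i
          fin_cases i <;> simp <;> omega
        exact_mod_cast Nat.one_le_iff_ne_zero.2 this
      obtain ⟨hl, hl0⟩ := intVec_ne hρ hb hx hw
      have hd := hlow x w hw
      have hd0 := hne x w hw
      have hd' : ρ * (c * ‖x‖) ≤ ‖(a₁ : ℂ) * w + a₂ - ((x 0 : ℂ) * w + x 1)‖ :=
        le_trans (by gcongr; exact (hcx x).2) hd
      have hwT := hUT w hw
      have hv : ‖(a₁ : ℂ) * w + a₂‖ ≤ W := by
        refine (norm_add_le _ _).trans ?_
        rw [norm_mul, Complex.norm_real, Complex.norm_real]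
        simp only [Real.norm_eq_abs, hW]
        gcongr
      have hlu : ‖(x 0 : ℂ) * w + x 1‖ ≤ (T + 1) * ‖x‖ := by
        refine (norm_add_le _ _).trans ?_
        rw [norm_mul, Complex.norm_intCast, Complex.norm_intCast, norm_intVec]
        have := le_max_left |(x 0 : ℝ)| |(x 1 : ℝ)|
        have := le_max_right |(x 0 : ℝ)| |(x 1 : ℝ)|
        have : |(x 0 : ℝ)| * ‖w‖ ≤ max |(x 0 : ℝ)| |(x 1 : ℝ)| * T := by gcongr
        linarith
      set v := (a₁ : ℂ) * w + a₂ with hvdef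
      set l := (x 0 : ℂ) * w + x 1 with hldef
      have e : 1 / (v - l) ^ 2 - 1 / l ^ 2 = v * (2 * l - v) / ((v - l) ^ 2 * l ^ 2) := by
        field_simp
        ring
      have hnum : ‖2 * l - v‖ ≤ (2 * (T + 1) + W) * ‖x‖ := by
        refine (norm_sub_le _ _).trans ?_
        rw [norm_mul, Complex.norm_ofNat]
        nlinarith
      rw [e, norm_div, norm_mul, norm_mul, norm_pow, norm_pow]
      have hxpos : 0 < ‖x‖ := by linarith
      calc ‖v‖ * ‖2 * l - v‖ / (‖v - l‖ ^ 2 * ‖l‖ ^ 2)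
          ≤ W * ((2 * (T + 1) + W) * ‖x‖) / ((ρ * (c * ‖x‖)) ^ 2 * (ρ * ‖x‖) ^ 2) := by gcongr
        _ = _ := by field_simp

lemma comp_ofComplex_mem {f : ℍ → ℂ} {g : ℂ → ℂ} (hg : DifferentiableOn ℂ g upperHalfPlaneSet)
    (h : ∀ τ : ℍ, f τ = g τ) : f ∈ meromorphicAlgebra := by
  rw [mem_meromorphicAlgebra]
  refine MeromorphicOn.congr (hg.analyticOnNhd isOpen_upperHalfPlaneSet).meromorphicOn ?_
    isOpen_upperHalfPlaneSet
  intro z hz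
  have hz' : 0 < z.im := hz
  simp [ofComplex_apply_of_im_pos hz', h]

lemma div_mem_meromorphicAlgebra {f g : ℍ → ℂ} (hf : f ∈ meromorphicAlgebra)
    (hg : g ∈ meromorphicAlgebra) : (fun τ ↦ f τ / g τ) ∈ meromorphicAlgebra :=
  MeromorphicOn.div hf hg

lemma latticeG_mem {k : ℕ} (hk : 3 ≤ k) :
    (fun τ ↦ (latticePair τ).G k) ∈ meromorphicAlgebra :=
  comp_ofComplex_mem (differentiableOn_latticeG hk) fun τ ↦
    tsum_lattice τ fun l ↦ (l ^ k)⁻¹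

lemma g₂_mem : (fun τ ↦ (latticePair τ).g₂) ∈ meromorphicAlgebra :=
  meromorphicAlgebra.smul_mem (latticeG_mem (k := 4) (by norm_num)) 60

lemma g₃_mem : (fun τ ↦ (latticePair τ).g₃) ∈ meromorphicAlgebra :=
  meromorphicAlgebra.smul_mem (latticeG_mem (k := 6) (by norm_num)) 140

lemma latticeDisc_mem : latticeDisc ∈ meromorphicAlgebra :=
  meromorphicAlgebra.sub_mem (meromorphicAlgebra.pow_mem g₂_mem 3)
    (meromorphicAlgebra.smul_mem (meromorphicAlgebra.pow_mem g₃_mem 2) 27)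

lemma not_int_of_mem_torsionIndex {N : ℕ} {a : ℚ × ℚ} (ha : a ∈ torsionIndex N) :
    ¬ ∃ m n : ℤ, ((a.1 : ℚ) : ℝ) = m ∧ ((a.2 : ℚ) : ℝ) = n := by
  obtain ⟨r, s, hr, hs, h0, rfl⟩ := ha
  rintro ⟨m, n, hm, hn⟩
  have hN : (N : ℝ) ≠ 0 := by
    have : N ≠ 0 := by omega
    exact_mod_cast this
  have aux : ∀ (t : ℕ) (k : ℤ), t < N → (((t : ℚ) / N : ℚ) : ℝ) = k → t = 0 := by
    intro t k ht h
    push_cast at h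
    rw [div_eq_iff hN] at h
    have h' : (t : ℤ) = k * N := by exact_mod_cast h
    have : (N : ℤ) ∣ t := ⟨k, by rw [h']; ring⟩
    exact Nat.eq_zero_of_dvd_of_lt (by exact_mod_cast this) ht
  exact h0 (by rw [aux r m hr hm, aux s n hs hn])

lemma frickeFun_mem {N : ℕ} {a : ℚ × ℚ} (ha : a ∈ torsionIndex N) :
    frickeFun a ∈ meromorphicAlgebra := by
  refine meromorphicAlgebra.mul_mem
    (div_mem_meromorphicAlgebra (meromorphicAlgebra.mul_mem g₂_mem g₃_mem) latticeDisc_mem)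
    (comp_ofComplex_mem (differentiableOn_latticeWP (not_int_of_mem_torsionIndex ha)) fun τ ↦ ?_)
  rw [PeriodPair.weierstrassP,
    tsum_lattice τ fun l ↦ 1 / ((a.1 : ℂ) * τ + a.2 - l) ^ 2 - 1 / l ^ 2]
  simp

lemma modularForm_mem {k : ℤ} (f : ModularForm 𝒮ℒ k) : (f : ℍ → ℂ) ∈ meromorphicAlgebra := by
  rw [mem_meromorphicAlgebra]
  exact ((UpperHalfPlane.mdifferentiable_iff.1 f.holo').analyticOnNhd
    isOpen_upperHalfPlaneSet).meromorphicOn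

lemma jFun_mem : jFun ∈ meromorphicAlgebra := by
  have h4 := meromorphicAlgebra.pow_mem (modularForm_mem ModularForm.E₄) 3
  have h6 := meromorphicAlgebra.pow_mem (modularForm_mem ModularForm.E₆) 2
  exact div_mem_meromorphicAlgebra h4 (div_mem_meromorphicAlgebra
    (meromorphicAlgebra.sub_mem h4 h6) (meromorphicAlgebra.algebraMap_mem 1728))

/-- The function `j` as an element of the field of meromorphic functions. -/
def jElt : MeromorphicField := toMeromorphicField ⟨jFun, jFun_mem⟩

/-- The functions `f_a`, for `a` in the index set of level `N`, as elements of the field of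
meromorphic functions. -/
def frickeElt (N : ℕ) (a : torsionIndex N) : MeromorphicField :=
  toMeromorphicField ⟨frickeFun a, frickeFun_mem a.2⟩

/-! ### Modular functions -/

/-- `f(τ) = ∑ₙ aₙ exp(2πi n τ / N)`, with only finitely many non-zero `aₙ` for `n < 0`, whenever
the imaginary part of `τ` is large enough: `f` is meromorphic at `i∞` (in the local parameter
`exp(2πi τ / N)`) with Fourier coefficients `aₙ`. -/
def HasFourierExpansion (N : ℕ) (f : ℍ → ℂ) (a : ℤ → ℂ) : Prop :=
  (∃ m : ℤ, ∀ n < m, a n = 0) ∧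
    ∀ᶠ τ : ℍ in atImInfty, HasSum (fun n : ℤ ↦ a n * Function.Periodic.qParam N τ ^ n) (f τ)

/-- Modular functions of level `N`: meromorphic on `ℍ`, invariant under `Γ(N)`, and meromorphic at
all cusps `γ(i∞)`, `γ ∈ SL₂(ℤ)`. -/
structure IsModularFunction (N : ℕ) (f : ℍ → ℂ) : Prop where
  meromorphic : f ∈ meromorphicAlgebra
  invariant : ∀ γ ∈ CongruenceSubgroup.Gamma N, ∀ τ : ℍ, f (γ • τ) = f τ
  cusps : ∀ γ : SL(2, ℤ), ∃ a : ℤ → ℂ, HasFourierExpansion N (fun τ ↦ f (γ • τ)) a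

/-- The set `F_{N, ℚ̄}` of modular functions of level `N` whose Fourier coefficients at `i∞` are
algebraic, inside the field of meromorphic functions on `ℍ`. -/
def algModularFunctions (N : ℕ) : Set MeromorphicField :=
  {φ | ∃ f : meromorphicAlgebra, toMeromorphicField f = φ ∧ IsModularFunction N f ∧
    ∃ a : ℤ → ℂ, HasFourierExpansion N f a ∧ ∀ n, IsAlgebraic ℚ (a n)}

/-- The field `ℚ̄(j)`. -/
def QbarJ : IntermediateField Qbar MeromorphicField := IntermediateField.adjoin Qbar {jElt}

end

/-! The argument first works over ℂ and then descends to `Qbar`. Over ℂ, let K be the field of all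
modular functions of level N (`modularSubfield`). The group SL₂(ℤ) acts on K, and Γ(N), of finite
index, acts trivially, so the image of SL₂(ℤ) in Aut K is finite. An invariant element of K becomes
holomorphic on ℍ after multiplication by a suitable polynomial in j, and is then itself a polynomial
in j. Hence the invariants lie in ℂ(j) (`mem_adjoin_jElt`). The f_a are permuted by SL₂(ℤ) through a
↦ aγ, because the weight −2 of g₂g₃/Δ₀ cancels the weight 2 of ℘. The constant terms of the
q-expansions of ℘ at torsion points show that a matrix fixing every f_a lies in ±Γ(N), so it acts
trivially on K (`mem_Gamma_or_neg_mem`). By Artin's theorem and the Galois correspondence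
(`Subfield.eq_top_of_fixing`), K is contained in ℂ(j, f_a). For the descent, j and the f_a have
algebraic Fourier coefficients: the powers of π cancel, and ℘/(2πi)² is a combination of Lambert
series twisted by roots of unity. Let E be a field of functions with algebraic expansions, and let φ
∈ ℂ(E) also have one. Write φs = r with r and s in the ℂ-span of E. Applying a `Qbar`-linear form ℂ
→ `Qbar` to all coefficients preserves this relation and moves r and s into E, so φ ∈ E
(`mem_of_mem_adjoin_complex`). Finally, the product of X − t over t = 0 and all distinct f_a has
SL₂(ℤ)-invariant coefficients. By the level one result and the descent they lie in `QbarJ`. Thus the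
extension is a splitting field in characteristic zero, hence finite Galois. -/

noncomputable section

/-! ### Convergent Laurent expansions at `i∞` -/

/-- `f` is given by the Laurent series `p` in `exp(2πi τ / N)` when `Im τ` is large. -/
def HasQExp (N : ℕ) (f : ℍ → ℂ) (p : LaurentSeries ℂ) : Prop :=
  ∀ᶠ τ : ℍ in atImInfty,
    HasSum (fun n : ℤ ↦ p.coeff n * Function.Periodic.qParam N τ ^ n) (f τ)

lemma LaurentSeries.exists_forall_lt_coeff_eq_zero (p : LaurentSeries ℂ) :
    ∃ m : ℤ, ∀ n < m, p.coeff n = 0 :=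
  ⟨p.order, fun _ h ↦ HahnSeries.coeff_eq_zero_of_lt_order h⟩

lemma bddBelow_support_of_forall_lt {a : ℤ → ℂ} {m : ℤ} (h : ∀ n < m, a n = 0) :
    BddBelow (Function.support a) :=
  ⟨m, fun n hn ↦ not_lt.1 fun hlt ↦ hn (h n hlt)⟩

lemma hasFourierExpansion_iff {N : ℕ} {f : ℍ → ℂ} {a : ℤ → ℂ} :
    HasFourierExpansion N f a ↔ ∃ p : LaurentSeries ℂ, p.coeff = a ∧ HasQExp N f p := by
  constructor
  · rintro ⟨⟨m, hm⟩, h⟩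
    exact ⟨HahnSeries.ofSuppBddBelow a (bddBelow_support_of_forall_lt hm), by simp,
      by simpa [HasQExp] using h⟩
  · rintro ⟨p, rfl, h⟩
    exact ⟨p.exists_forall_lt_coeff_eq_zero, h⟩

/-- Factoring out q^m turns a Laurent sum with finite principal part into a power series, to which
analytic function theory applies. -/
lemma hasSum_zpow_iff {a : ℤ → ℂ} {m : ℤ} (hm : ∀ n < m, a n = 0) {q : ℂ} (hq : q ≠ 0) {s : ℂ} :
    HasSum (fun n : ℤ ↦ a n * q ^ n) s ↔ HasSum (fun k : ℕ ↦ a (m + k) * q ^ k) (q ^ (-m) * s) := by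
  have hinj : Function.Injective fun k : ℕ ↦ m + (k : ℤ) := fun a b h ↦ by simpa using h
  rw [← hinj.hasSum_iff (f := fun n : ℤ ↦ a n * q ^ n)]
  · rw [← hasSum_mul_left_iff (a₂ := q ^ (-m)) (zpow_ne_zero _ hq)]
    refine iff_of_eq (congrArg (HasSum · _) ?_)
    funext k
    simp only [Function.comp]
    rw [zpow_add₀ hq, zpow_neg, zpow_natCast]
    field_simp
  · intro n hn
    rw [hm n, zero_mul]
    by_contra! h
    exact hn ⟨(n - m).toNat, by simp [Int.toNat_of_nonneg (sub_nonneg.2 h)]⟩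

/-- Convergence at a single q ≠ 0 makes the terms tend to zero there, so the radius of convergence
is at least |q| > 0. -/
lemma hasFPowerSeriesAt_of_summable {c : ℕ → ℂ} {q : ℂ} (hq : q ≠ 0)
    (h : Summable fun k ↦ c k * q ^ k) :
    HasFPowerSeriesAt (FormalMultilinearSeries.ofScalars ℂ c).sum
      (FormalMultilinearSeries.ofScalars ℂ c) 0 := by
  set P := FormalMultilinearSeries.ofScalars ℂ c
  have h1 : ((‖q‖₊ : NNReal) : ENNReal) ≤ P.radius := by
    refine P.le_radius_of_tendsto (l := 0) ?_
    simpa [P, FormalMultilinearSeries.ofScalars_norm] using h.tendsto_atTop_zero.norm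
  have h2 : 0 < P.radius := lt_of_lt_of_le (by simpa using hq) h1
  exact (P.hasFPowerSeriesOnBall h2).hasFPowerSeriesAt

lemma tendsto_qParam_atImInfty {N : ℕ} (hN : 0 < N) :
    Tendsto (fun τ : ℍ ↦ Function.Periodic.qParam N τ) atImInfty (𝓝[≠] 0) := by
  rw [tendsto_nhdsWithin_iff]
  refine ⟨?_, Eventually.of_forall fun τ ↦ Function.Periodic.qParam_ne_zero _⟩
  exact (UpperHalfPlane.qParam_tendsto_atImInfty (by exact_mod_cast hN)).mono_right
    (by first | exact nhdsWithin_le_nhds | exact le_rfl)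

/-- With the leading power of q split off, the value at 0 is the leading coefficient, non-zero as
soon as p ≠ 0. Non-vanishing, inversion and uniqueness of expansions all rest on this factorisation.
-/
lemma HasQExp.exists_analytic {N : ℕ} (hN : 0 < N) {f : ℍ → ℂ} {p : LaurentSeries ℂ}
    (h : HasQExp N f p) : ∃ F : ℂ → ℂ, AnalyticAt ℂ F 0 ∧ F 0 = p.coeff p.order ∧
      ∀ᶠ τ in atImInfty, f τ = Function.Periodic.qParam N τ ^ p.order *
        F (Function.Periodic.qParam N τ) := by
  have hm : ∀ n < p.order, p.coeff n = 0 := fun _ h ↦ HahnSeries.coeff_eq_zero_of_lt_order h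
  have h' : ∀ᶠ τ : ℍ in atImInfty, HasSum (fun k : ℕ ↦ p.coeff (p.order + k) *
      Function.Periodic.qParam N τ ^ k) (Function.Periodic.qParam N τ ^ (-p.order) * f τ) :=
    h.mono fun τ ↦ (hasSum_zpow_iff hm (Function.Periodic.qParam_ne_zero _)).1
  obtain ⟨τ₀, hτ₀⟩ := h'.exists
  have hF := hasFPowerSeriesAt_of_summable (Function.Periodic.qParam_ne_zero _) hτ₀.summable
  refine ⟨_, hF.analyticAt, ?_, ?_⟩
  · have := hF.coeff_zero Fin.elim0
    rw [← this]
    simp [FormalMultilinearSeries.ofScalars]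
  · have h1 := (tendsto_qParam_atImInfty hN).eventually
      ((hasFPowerSeriesAt_iff.1 hF).filter_mono nhdsWithin_le_nhds)
    filter_upwards [h', h1] with τ hs hs'
    simp only [FormalMultilinearSeries.coeff_ofScalars, smul_eq_mul, zero_add] at hs'
    have h2 := hs.unique (by simpa only [mul_comm] using hs')
    rw [← h2, ← mul_assoc, ← zpow_add₀ (Function.Periodic.qParam_ne_zero _)]
    simp

lemma hasQExp_of_analytic {N : ℕ} (hN : 0 < N) {f : ℍ → ℂ} {F : ℂ → ℂ} (hF : AnalyticAt ℂ F 0)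
    {m : ℤ} (h : ∀ᶠ τ : ℍ in atImInfty, f τ = Function.Periodic.qParam N τ ^ m *
      F (Function.Periodic.qParam N τ)) : ∃ p, HasQExp N f p := by
  obtain ⟨P, hP⟩ := hF
  let a : ℤ → ℂ := fun n ↦ if n < m then 0 else P.coeff (n - m).toNat
  have ha : ∀ n < m, a n = 0 := fun n hn ↦ if_pos hn
  refine ⟨HahnSeries.ofSuppBddBelow a (bddBelow_support_of_forall_lt ha), ?_⟩
  have h1 := (tendsto_qParam_atImInfty hN).eventually
      ((hasFPowerSeriesAt_iff.1 hP).filter_mono nhdsWithin_le_nhds)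
  filter_upwards [h, h1] with τ hs hs'
  rw [HahnSeries.coeff_ofSuppBddBelow, hasSum_zpow_iff ha (Function.Periodic.qParam_ne_zero _), hs,
    ← mul_assoc, ← zpow_add₀ (Function.Periodic.qParam_ne_zero _)]
  have h2 (k : ℕ) : ¬ (m + k < m) := by omega
  simpa [a, mul_comm, h2] using hs'

/-! ### Ring operations on expansions -/

lemma hasSum_regroup {ι κ : Type*} {t : ι → ℂ} {s : ℂ} (h : HasSum t s) (e : ι → κ) {c : κ → ℂ}
    (hc : ∀ n, HasSum (fun i : {i // e i = n} ↦ t i) (c n)) : HasSum c s :=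
  HasSum.sigma ((Equiv.sigmaFiberEquiv e).hasSum_iff.2 h) hc

lemma hasSum_fiber {ι κ : Type*} {t : ι → ℂ} {e : ι → κ} {n : κ} (A : Finset ι)
    (hA : ∀ i ∈ A, e i = n) (h0 : ∀ i ∉ A, e i = n → t i = 0) {s : ℂ} (hs : s = ∑ i ∈ A, t i) :
    HasSum (fun i : {i // e i = n} ↦ t i) s := by
  rw [hs]
  refine (hasSum_subtype_iff_indicator (s := {i | e i = n}) (f := t)).2 ?_
  rw [← Finset.sum_congr rfl fun i hi ↦ Set.indicator_of_mem (s := {i | e i = n}) (hA i hi) t]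
  refine hasSum_sum_of_ne_finset_zero fun i hi ↦ ?_
  by_cases h : e i = n
  · rw [Set.indicator_of_mem (s := {i | e i = n}) h, h0 i hi h]
  · exact Set.indicator_of_notMem (s := {i | e i = n}) h t

lemma HasQExp.const (N : ℕ) (c : ℂ) : HasQExp N (fun _ ↦ c) (HahnSeries.C c) := by
  refine Eventually.of_forall fun τ ↦ ?_
  convert hasSum_single (0 : ℤ) _ using 1
  · simp
  · intro n hn
    simp [HahnSeries.coeff_single_of_ne hn, HahnSeries.C_apply]

lemma HasQExp.add {N : ℕ} {f g : ℍ → ℂ} {p r : LaurentSeries ℂ} (hf : HasQExp N f p)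
    (hg : HasQExp N g r) : HasQExp N (fun τ ↦ f τ + g τ) (p + r) := by
  filter_upwards [hf, hg] with τ h1 h2
  simpa [add_mul] using h1.add h2

/-- Summability in ℂ is absolute, so the double series may be summed along the lines i₁ + i₂ = n; `A
n` is a finite set carrying all the non-zero terms on such a line. -/
lemma hasSum_zpow_mul {a b c : ℤ → ℂ} {q s t : ℂ} (hq : q ≠ 0)
    (ha : HasSum (fun n ↦ a n * q ^ n) s) (hb : HasSum (fun n ↦ b n * q ^ n) t)
    (A : ℤ → Finset (ℤ × ℤ)) (hA : ∀ n, ∀ i ∈ A n, i.1 + i.2 = n)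
    (h0 : ∀ n, ∀ i ∉ A n, i.1 + i.2 = n → a i.1 * b i.2 = 0)
    (hc : ∀ n, c n = ∑ i ∈ A n, a i.1 * b i.2) : HasSum (fun n ↦ c n * q ^ n) (s * t) := by
  have h3 := HasSum.mul (f := fun n ↦ a n * q ^ n) (g := fun n ↦ b n * q ^ n) ha hb
    (summable_mul_of_summable_norm (f := fun n ↦ a n * q ^ n) (g := fun n ↦ b n * q ^ n)
      ha.summable.norm hb.summable.norm)
  refine hasSum_regroup h3 (fun x : ℤ × ℤ ↦ x.1 + x.2) fun n ↦ ?_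
  refine hasSum_fiber (t := fun i : ℤ × ℤ ↦ a i.1 * q ^ i.1 * (b i.2 * q ^ i.2)) (A n) (hA n)
    (fun i hi hin ↦ ?_) ?_
  · rw [show a i.1 * q ^ i.1 * (b i.2 * q ^ i.2) = a i.1 * b i.2 * (q ^ i.1 * q ^ i.2) by ring,
      h0 n i hi hin, zero_mul]
  · rw [hc, Finset.sum_mul]
    refine Finset.sum_congr rfl fun i hi ↦ ?_
    rw [← hA n i hi, zpow_add₀ hq]
    ring

lemma HasQExp.mul {N : ℕ} {f g : ℍ → ℂ} {p r : LaurentSeries ℂ} (hf : HasQExp N f p)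
    (hg : HasQExp N g r) : HasQExp N (fun τ ↦ f τ * g τ) (p * r) := by
  filter_upwards [hf, hg] with τ h1 h2
  refine hasSum_zpow_mul (Function.Periodic.qParam_ne_zero _) h1 h2
    (fun n ↦ Finset.antidiagonal p.isPWO_support r.isPWO_support n)
    (fun n i hi ↦ (Finset.mem_antidiagonal.1 hi).2.2) (fun n i hi hin ↦ ?_)
    fun n ↦ HahnSeries.coeff_mul
  by_contra h0
  refine hi (Finset.mem_antidiagonal.2 ⟨?_, ?_, hin⟩) <;> intro h <;> simp [h] at h0

lemma HasQExp.congr {N : ℕ} {f g : ℍ → ℂ} {p : LaurentSeries ℂ} (hf : HasQExp N f p)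
    (h : ∀ᶠ τ in atImInfty, f τ = g τ) : HasQExp N g p := by
  filter_upwards [hf, h] with τ h1 h2
  rwa [← h2]

lemma HasQExp.neg {N : ℕ} {f : ℍ → ℂ} {p : LaurentSeries ℂ} (hf : HasQExp N f p) :
    HasQExp N (fun τ ↦ -f τ) (-p) := by
  filter_upwards [hf] with τ h1
  simpa using h1.neg

lemma HasQExp.eventually_ne_zero {N : ℕ} (hN : 0 < N) {f : ℍ → ℂ} {p : LaurentSeries ℂ}
    (h : HasQExp N f p) (hp : p ≠ 0) : ∀ᶠ τ in atImInfty, f τ ≠ 0 := by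
  obtain ⟨F, hF, hF0, hf⟩ := h.exists_analytic hN
  have hne : F 0 ≠ 0 := by
    rw [hF0]
    exact HahnSeries.coeff_order_eq_zero.not.2 hp
  have h1 := (tendsto_qParam_atImInfty hN).eventually
      ((hF.continuousAt.eventually_ne hne).filter_mono nhdsWithin_le_nhds)
  filter_upwards [hf, h1] with τ h2 h3
  rw [h2]
  exact mul_ne_zero (zpow_ne_zero _ (Function.Periodic.qParam_ne_zero _)) h3

lemma HasQExp.eq_zero {N : ℕ} (hN : 0 < N) {f : ℍ → ℂ} {p : LaurentSeries ℂ}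
    (h : HasQExp N f p) (hf : ∃ᶠ τ in atImInfty, f τ = 0) : p = 0 := by
  by_contra hp
  exact hf (h.eventually_ne_zero hN hp)

lemma HasQExp.unique {N : ℕ} (hN : 0 < N) {f : ℍ → ℂ} {p r : LaurentSeries ℂ}
    (hp : HasQExp N f p) (hr : HasQExp N f r) : p = r := by
  have := hp.add hr.neg
  have h0 := this.eq_zero hN (Eventually.frequently (Eventually.of_forall fun τ ↦ by simp))
  rwa [← sub_eq_add_neg, sub_eq_zero] at h0

lemma HasQExp.eventually_eq_zero {N : ℕ} {f : ℍ → ℂ} (h : HasQExp N f 0) :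
    ∀ᶠ τ in atImInfty, f τ = 0 :=
  h.mono fun τ hτ ↦ hτ.unique (by simp)

/-- The inverse of the analytic factor is analytic at 0, so 1/f has some expansion r; uniqueness
applied to f · (1/f) = 1 identifies r with p⁻¹. For p = 0 both inverses are 0 by convention. -/
lemma HasQExp.inv {N : ℕ} (hN : 0 < N) {f : ℍ → ℂ} {p : LaurentSeries ℂ} (h : HasQExp N f p) :
    HasQExp N (fun τ ↦ (f τ)⁻¹) p⁻¹ := by
  rcases eq_or_ne p 0 with rfl | hp
  · have h0 := h.eventually_eq_zero
    rw [inv_zero, ← map_zero HahnSeries.C]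
    exact (HasQExp.const N 0).congr (h0.mono fun τ hτ ↦ by simp [hτ])
  obtain ⟨F, hF, hF0, hf⟩ := h.exists_analytic hN
  have hne : F 0 ≠ 0 := by
    rw [hF0]
    exact HahnSeries.coeff_order_eq_zero.not.2 hp
  obtain ⟨r, hr⟩ := hasQExp_of_analytic (f := fun τ ↦ (f τ)⁻¹) (m := -p.order) hN (hF.inv hne)
    (hf.mono fun τ hτ ↦ by simp [hτ, mul_comm])
  have h1 : p * r = HahnSeries.C 1 := by
    refine (h.mul hr).unique hN ((HasQExp.const N 1).congr ?_)
    filter_upwards [h.eventually_ne_zero hN hp] with τ hτ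
    simp [hτ]
  have : p⁻¹ = r := inv_eq_of_mul_eq_one_right (by simpa using h1)
  rwa [this]

lemma HasQExp.pow {N : ℕ} {f : ℍ → ℂ} {p : LaurentSeries ℂ} (h : HasQExp N f p) (k : ℕ) :
    HasQExp N (fun τ ↦ f τ ^ k) (p ^ k) := by
  induction k with
  | zero => simpa using HasQExp.const N 1
  | succ k ih => simpa [pow_succ] using ih.mul h

/-! ### Algebraic coefficients -/

/-- The inclusion of Laurent series with algebraic coefficients. -/
def algLaurentHom : LaurentSeries Qbar →+* LaurentSeries ℂ where
  toFun p := p.map (algebraMap Qbar ℂ)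
  map_zero' := by ext; simp
  map_one' := by ext n; simp [HahnSeries.coeff_one, apply_ite]
  map_add' p r := by ext; simp
  map_mul' p r := by
    ext n
    have hs (x : LaurentSeries Qbar) :
        (x.map (algebraMap Qbar ℂ)).support = x.support := by ext; simp
    rw [HahnSeries.map_coeff, HahnSeries.coeff_mul, HahnSeries.coeff_mul, map_sum]
    simp only [hs, HahnSeries.map_coeff, map_mul]

/-- The field of Laurent series with algebraic coefficients. -/
def algLaurent : Subfield (LaurentSeries ℂ) := algLaurentHom.fieldRange

lemma mem_algLaurent {p : LaurentSeries ℂ} : p ∈ algLaurent ↔ ∀ n, p.coeff n ∈ Qbar := by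
  constructor
  · rintro ⟨r, rfl⟩ n
    exact (r.coeff n).2
  · intro h
    have hs : (Function.support fun n ↦ (⟨p.coeff n, h n⟩ : Qbar)) = p.support := by
      ext n
      simp [Subtype.ext_iff]
    refine ⟨⟨fun n ↦ ⟨p.coeff n, h n⟩, hs ▸ p.isPWO_support⟩, ?_⟩
    ext n
    rfl

/-- Collects the terms with equal exponent. It serves both the change of parameter q ↦ q^N, where ι
= ℕ, and the Lambert double series. -/
lemma exists_hasQExp_of_hasSum {N : ℕ} {ι : Type*} {f : ℍ → ℂ} {b : ι → ℂ} {e : ι → ℕ}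
    (hfin : ∀ n, {i | e i = n}.Finite)
    (h : ∀ᶠ τ : ℍ in atImInfty, HasSum (fun i ↦ b i * Function.Periodic.qParam N τ ^ e i) (f τ)) :
    ∃ p : LaurentSeries ℂ, HasQExp N f p ∧ (∀ n < 0, p.coeff n = 0) ∧
      ∀ n : ℕ, p.coeff n = ∑ i ∈ (hfin n).toFinset, b i := by
  let a : ℤ → ℂ := fun n ↦ if n < 0 then 0 else ∑ i ∈ (hfin n.toNat).toFinset, b i
  have ha : ∀ n < 0, a n = 0 := fun n hn ↦ if_pos hn
  refine ⟨HahnSeries.ofSuppBddBelow a (bddBelow_support_of_forall_lt ha), ?_, by simpa using ha,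
    by simp [a]⟩
  filter_upwards [h] with τ hτ
  rw [HahnSeries.coeff_ofSuppBddBelow, hasSum_zpow_iff ha (Function.Periodic.qParam_ne_zero _)]
  refine hasSum_regroup (by simpa using hτ) e fun n ↦ ?_
  refine hasSum_fiber (t := fun i ↦ b i * Function.Periodic.qParam N τ ^ e i) (hfin n).toFinset
    (by simp) (fun i hi hin ↦ absurd (by simpa using hin) hi) ?_
  simp only [a, zero_add, Int.toNat_natCast]
  rw [if_neg (by omega), Finset.sum_mul]
  refine Finset.sum_congr rfl fun i hi ↦ ?_
  have : e i = n := by simpa using hi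
  rw [this]

/-! ### The field of meromorphic functions -/

lemma toMeromorphicField_surjective : Function.Surjective toMeromorphicField :=
  Ideal.Quotient.mk_surjective

lemma toMeromorphicField_eq_zero_iff {f : meromorphicAlgebra} :
    toMeromorphicField f = 0 ↔ f ∈ negligibleIdeal :=
  Ideal.Quotient.eq_zero_iff_mem

lemma mem_negligibleIdeal_iff_forall {f : meromorphicAlgebra} :
    f ∈ negligibleIdeal ↔ ∀ z ∈ upperHalfPlaneSet,
      ∀ᶠ w in 𝓝[≠] z, (f : ℍ → ℂ) (ofComplex w) = 0 := by
  rw [mem_negligibleIdeal, EventuallyEq, eventually_iff, mem_codiscreteWithin]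
  refine forall₂_congr fun z hz ↦ ?_
  rw [disjoint_principal_right]
  have hU : upperHalfPlaneSet ∈ 𝓝[≠] z :=
    mem_nhdsWithin_of_mem_nhds (isOpen_upperHalfPlaneSet.mem_nhds hz)
  constructor
  · intro h
    filter_upwards [h, hU] with w hw hwU
    by_contra h0
    exact hw ⟨hwU, h0⟩
  · intro h
    filter_upwards [h] with w hw hw'
    exact hw'.2 hw

/-- The identity theorem: on the connected set ℍ, infinite order at one point forces infinite order
everywhere. -/
lemma mem_negligibleIdeal_of_eventually {f : meromorphicAlgebra} {z : ℂ}
    (hz : z ∈ upperHalfPlaneSet) (h : ∀ᶠ w in 𝓝[≠] z, (f : ℍ → ℂ) (ofComplex w) = 0) :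
    f ∈ negligibleIdeal := by
  rw [mem_negligibleIdeal_iff_forall]
  intro y hy
  have hm : MeromorphicOn ((f : ℍ → ℂ) ∘ ofComplex) upperHalfPlaneSet := f.2
  have htop : meromorphicOrderAt ((f : ℍ → ℂ) ∘ ofComplex) z = ⊤ :=
    meromorphicOrderAt_eq_top_iff.2 h
  have hy' : meromorphicOrderAt ((f : ℍ → ℂ) ∘ ofComplex) y = ⊤ := by
    by_contra hne
    exact hm.meromorphicOrderAt_ne_top_of_isPreconnected isPreconnected_upperHalfPlaneSet
      hy hz hne htop
  exact meromorphicOrderAt_eq_top_iff.1 hy'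

lemma mem_negligibleIdeal_of_atImInfty {f : meromorphicAlgebra}
    (h : ∀ᶠ τ in atImInfty, (f : ℍ → ℂ) τ = 0) : f ∈ negligibleIdeal := by
  obtain ⟨A, hA⟩ := (atImInfty_mem _).1 h
  let z : ℂ := (|A| + 1) * Complex.I
  have hzi : z.im = |A| + 1 := by simp [z]
  have hz : z ∈ upperHalfPlaneSet := by
    change 0 < z.im
    rw [hzi]; positivity
  refine mem_negligibleIdeal_of_eventually hz (Eventually.filter_mono nhdsWithin_le_nhds ?_)
  have hU : {w : ℂ | |A| < w.im} ∈ 𝓝 z :=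
    (isOpen_lt continuous_const Complex.continuous_im).mem_nhds (by simp [hzi])
  filter_upwards [hU] with w hw
  have hw0 : 0 < w.im := (abs_nonneg A).trans_lt hw
  refine hA _ ?_
  rw [ofComplex_apply_of_im_pos hw0]
  exact (le_abs_self A).trans hw.le

lemma frequently_eq_zero_of_mem_negligibleIdeal {f : meromorphicAlgebra}
    (h : f ∈ negligibleIdeal) : ∃ᶠ τ in atImInfty, (f : ℍ → ℂ) τ = 0 := by
  intro h'
  obtain ⟨A, hA⟩ := (atImInfty_mem _).1 h'
  let z : ℂ := (|A| + 1) * Complex.I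
  have hzi : z.im = |A| + 1 := by simp [z]
  have hz : z ∈ upperHalfPlaneSet := by
    change 0 < z.im
    rw [hzi]; positivity
  have hU : {w : ℂ | |A| < w.im} ∈ 𝓝[≠] z := mem_nhdsWithin_of_mem_nhds <|
    (isOpen_lt continuous_const Complex.continuous_im).mem_nhds (by simp [hzi])
  obtain ⟨w, hw, hw'⟩ := ((mem_negligibleIdeal_iff_forall.1 h z hz).and hU).exists
  have hw0 : 0 < w.im := (abs_nonneg A).trans_lt hw'
  refine hA (ofComplex w) ?_ hw
  rw [ofComplex_apply_of_im_pos hw0]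
  exact (le_abs_self A).trans (le_of_lt hw')

/-- The pointwise inverse of a meromorphic function. -/
def meromorphicInv (f : meromorphicAlgebra) : meromorphicAlgebra :=
  ⟨fun τ ↦ ((f : ℍ → ℂ) τ)⁻¹, MeromorphicOn.inv f.2⟩

lemma toMeromorphicField_inv (f : meromorphicAlgebra) :
    toMeromorphicField (meromorphicInv f) = (toMeromorphicField f)⁻¹ := by
  by_cases hf : f ∈ negligibleIdeal
  · rw [toMeromorphicField_eq_zero_iff.2 hf, inv_zero, toMeromorphicField_eq_zero_iff,
      mem_negligibleIdeal]
    filter_upwards [mem_negligibleIdeal.1 hf] with z hz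
    have hz' : (f : ℍ → ℂ) (ofComplex z) = 0 := hz
    simp [meromorphicInv, hz']
  · refine eq_inv_of_mul_eq_one_left ?_
    rw [← map_mul, ← sub_eq_zero, ← map_one toMeromorphicField, ← map_sub,
      toMeromorphicField_eq_zero_iff, mem_negligibleIdeal]
    filter_upwards [eventually_ne_zero_of_notMem_negligibleIdeal hf] with z hz
    simp [meromorphicInv, hz]

/-- `φ` is represented by a function with expansion `p` at `i∞`. -/
def FieldQExp (N : ℕ) (φ : MeromorphicField) (p : LaurentSeries ℂ) : Prop :=
  ∃ f : meromorphicAlgebra, toMeromorphicField f = φ ∧ HasQExp N f p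

namespace FieldQExp

variable {N : ℕ} {φ ψ : MeromorphicField} {p r : LaurentSeries ℂ}

lemma const (N : ℕ) (c : ℂ) : FieldQExp N (algebraMap ℂ MeromorphicField c) (HahnSeries.C c) :=
  ⟨algebraMap ℂ _ c, toMeromorphicField.commutes c, HasQExp.const N c⟩

lemma add (h : FieldQExp N φ p) (h' : FieldQExp N ψ r) : FieldQExp N (φ + ψ) (p + r) := by
  obtain ⟨f, rfl, hf⟩ := h
  obtain ⟨g, rfl, hg⟩ := h'
  exact ⟨f + g, map_add _ _ _, hf.add hg⟩

lemma mul (h : FieldQExp N φ p) (h' : FieldQExp N ψ r) : FieldQExp N (φ * ψ) (p * r) := by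
  obtain ⟨f, rfl, hf⟩ := h
  obtain ⟨g, rfl, hg⟩ := h'
  exact ⟨f * g, map_mul _ _ _, hf.mul hg⟩

lemma neg (h : FieldQExp N φ p) : FieldQExp N (-φ) (-p) := by
  obtain ⟨f, rfl, hf⟩ := h
  exact ⟨-f, map_neg _ _, hf.neg⟩

lemma inv (hN : 0 < N) (h : FieldQExp N φ p) : FieldQExp N φ⁻¹ p⁻¹ := by
  obtain ⟨f, rfl, hf⟩ := h
  exact ⟨meromorphicInv f, toMeromorphicField_inv f, hf.inv hN⟩

lemma eq_zero (hN : 0 < N) (h : FieldQExp N 0 p) : p = 0 := by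
  obtain ⟨f, hf0, hf⟩ := h
  exact hf.eq_zero hN
    (frequently_eq_zero_of_mem_negligibleIdeal (toMeromorphicField_eq_zero_iff.1 hf0))

lemma eq_zero_of_zero (h : FieldQExp N φ 0) : φ = 0 := by
  obtain ⟨f, rfl, hf⟩ := h
  exact toMeromorphicField_eq_zero_iff.2 (mem_negligibleIdeal_of_atImInfty hf.eventually_eq_zero)

lemma unique (hN : 0 < N) (h : FieldQExp N φ p) (h' : FieldQExp N φ r) : p = r := by
  have := h.add h'.neg
  rw [add_neg_cancel] at this
  have := this.eq_zero hN
  rwa [← sub_eq_add_neg, sub_eq_zero] at this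

lemma eq_of_eq (h : FieldQExp N φ p) (h' : FieldQExp N ψ p) : φ = ψ := by
  have := h.add h'.neg
  rw [add_neg_cancel] at this
  have := this.eq_zero_of_zero
  rwa [← sub_eq_add_neg, sub_eq_zero] at this

end FieldQExp

/-- The field of meromorphic functions that have an expansion at `i∞` which lies in a given field of
Laurent series. -/
def qExpField {N : ℕ} (hN : 0 < N) (A : Subfield (LaurentSeries ℂ)) : Subfield MeromorphicField where
  carrier := {φ | ∃ p ∈ A, FieldQExp N φ p}
  mul_mem' := fun ⟨p, hp, h⟩ ⟨r, hr, h'⟩ ↦ ⟨p * r, mul_mem hp hr, h.mul h'⟩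
  add_mem' := fun ⟨p, hp, h⟩ ⟨r, hr, h'⟩ ↦ ⟨p + r, add_mem hp hr, h.add h'⟩
  neg_mem' := fun ⟨p, hp, h⟩ ↦ ⟨-p, neg_mem hp, h.neg⟩
  one_mem' := ⟨1, one_mem A, by simpa using FieldQExp.const N 1⟩
  zero_mem' := ⟨0, zero_mem A, by simpa using FieldQExp.const N 0⟩
  inv_mem' := fun _ ⟨p, hp, h⟩ ↦ ⟨p⁻¹, inv_mem hp, h.inv hN⟩

/-! ### Descent from `ℂ` to the algebraic numbers -/

/-- The coefficientwise application of a `ℚ̄`-linear form on `ℂ`. -/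
def mapCoeff (l : ℂ →ₗ[Qbar] Qbar) (p : LaurentSeries ℂ) : LaurentSeries ℂ :=
  HahnSeries.map p ((Algebra.linearMap Qbar ℂ).comp l)

lemma coeff_mapCoeff (l : ℂ →ₗ[Qbar] Qbar) (p : LaurentSeries ℂ) (n : ℤ) :
    (mapCoeff l p).coeff n = (l (p.coeff n) : ℂ) := rfl

lemma mapCoeff_add (l : ℂ →ₗ[Qbar] Qbar) (p r : LaurentSeries ℂ) :
    mapCoeff l (p + r) = mapCoeff l p + mapCoeff l r := by
  ext n
  simp [coeff_mapCoeff]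

lemma mapCoeff_C_mul (l : ℂ →ₗ[Qbar] Qbar) (c : ℂ) (p : LaurentSeries ℂ) :
    mapCoeff l (HahnSeries.C c * p) = mapCoeff (l.comp (LinearMap.mulLeft Qbar c)) p := by
  ext n
  simp [coeff_mapCoeff]

/-- Each coefficient of the product is a finite sum of products with one algebraic factor, and `l`
is linear over the algebraic numbers. -/
lemma mapCoeff_mul (l : ℂ →ₗ[Qbar] Qbar) {p : LaurentSeries ℂ} (hp : p ∈ algLaurent)
    (r : LaurentSeries ℂ) : mapCoeff l (p * r) = p * mapCoeff l r := by
  ext n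
  have hs : (mapCoeff l r).support ⊆ r.support := fun m hm h0 ↦ hm (by simp [coeff_mapCoeff, h0])
  rw [coeff_mapCoeff, HahnSeries.coeff_mul, HahnSeries.coeff_mul_right' r.isPWO_support hs,
    map_sum]
  push_cast
  refine Finset.sum_congr rfl fun i _ ↦ ?_
  have : p.coeff i.1 * r.coeff i.2 = (⟨p.coeff i.1, mem_algLaurent.1 hp _⟩ : Qbar) • r.coeff i.2 :=
    rfl
  rw [this, map_smul, coeff_mapCoeff]
  rfl

lemma mapCoeff_of_mem (l : ℂ →ₗ[Qbar] Qbar) {p : LaurentSeries ℂ} (hp : p ∈ algLaurent) :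
    mapCoeff l p = HahnSeries.C (l 1 : ℂ) * p := by
  have := mapCoeff_mul l hp 1
  rw [mul_one, mul_comm] at this
  rw [this]
  congr 1
  ext n
  rw [coeff_mapCoeff]
  by_cases hn : n = 0
  · simp [hn]
  · simp [HahnSeries.coeff_one, hn, HahnSeries.C_apply]

lemma exists_linearForm_ne_zero {c : ℂ} (hc : c ≠ 0) : ∃ l : ℂ →ₗ[Qbar] Qbar, l c ≠ 0 := by
  by_contra! h
  exact hc ((Module.forall_dual_apply_eq_zero_iff Qbar c).1 h)

/-- Write φ = r / s with r, s in the ℂ-algebra generated by E. A coefficientwise linear form turns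
the expansions of r and s into expansions of elements u, v of E and commutes with multiplication by
that of φ, so φ = u / v once v ≠ 0. -/
lemma mem_of_mem_adjoin_complex {N : ℕ} (hN : 0 < N) {E : IntermediateField Qbar MeromorphicField}
    (hE : (E : Set MeromorphicField) ⊆ qExpField hN algLaurent) {φ : MeromorphicField}
    (hφ : φ ∈ IntermediateField.adjoin ℂ (E : Set MeromorphicField))
    (hφ' : φ ∈ qExpField hN algLaurent) : φ ∈ E := by
  have key : ∀ x ∈ Algebra.adjoin ℂ (E : Set MeromorphicField), ∃ p, FieldQExp N x p ∧
      ∀ l : ℂ →ₗ[Qbar] Qbar, ∃ y ∈ E, FieldQExp N y (mapCoeff l p) := by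
    intro x hx
    -- E is closed under multiplication, so the ℂ-algebra that it generates is only its ℂ-span;
    -- linear forms can then be applied termwise.
    have hx' : x ∈ Submodule.span ℂ (E : Set MeromorphicField) := by
      have : x ∈ Subalgebra.toSubmodule (Algebra.adjoin ℂ (E : Set MeromorphicField)) := hx
      rw [Algebra.adjoin_eq_span] at this
      have hcl : Submonoid.closure (E : Set MeromorphicField) = E.toSubfield.toSubmonoid :=
        Submonoid.closure_eq E.toSubfield.toSubmonoid
      rwa [hcl] at this
    clear hx
    induction hx' using Submodule.span_induction with
    | mem x hx =>
      obtain ⟨p, hp, h⟩ := hE hx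
      refine ⟨p, h, fun l ↦ ⟨algebraMap Qbar _ (l 1) * x, mul_mem (E.algebraMap_mem _) hx, ?_⟩⟩
      rw [mapCoeff_of_mem l hp]
      exact (FieldQExp.const N (l 1 : ℂ)).mul h
    | zero =>
      refine ⟨0, by simpa using FieldQExp.const N 0, fun l ↦ ⟨0, zero_mem E, ?_⟩⟩
      have : mapCoeff l 0 = 0 := by ext n; simp [coeff_mapCoeff]
      rw [this]
      simpa using FieldQExp.const N 0
    | add x y _ _ ihx ihy =>
      obtain ⟨p, hp, hlp⟩ := ihx
      obtain ⟨r, hr, hlr⟩ := ihy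
      refine ⟨p + r, hp.add hr, fun l ↦ ?_⟩
      obtain ⟨u, hu, hu'⟩ := hlp l
      obtain ⟨v, hv, hv'⟩ := hlr l
      exact ⟨u + v, add_mem hu hv, mapCoeff_add l p r ▸ hu'.add hv'⟩
    | smul c x _ ih =>
      obtain ⟨p, hp, hlp⟩ := ih
      refine ⟨HahnSeries.C c * p, by simpa [Algebra.smul_def] using (FieldQExp.const N c).mul hp,
        fun l ↦ ?_⟩
      rw [mapCoeff_C_mul]
      exact hlp _
  obtain ⟨r, hr, s, hs, hφrs⟩ := (IntermediateField.mem_adjoin_iff_div).1 hφ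
  rcases eq_or_ne s 0 with rfl | hs0
  · rw [hφrs, div_zero]
    exact zero_mem E
  obtain ⟨pφ, hpφ, hqφ⟩ := hφ'
  obtain ⟨pr, hpr, hlr⟩ := key r hr
  obtain ⟨ps, hps, hls⟩ := key s hs
  have hrel : pφ * ps = pr := by
    refine (hqφ.mul hps).unique hN ?_
    rwa [hφrs, div_mul_cancel₀ _ hs0]
  have hps0 : ps ≠ 0 := by
    rintro rfl
    exact hs0 hps.eq_zero_of_zero
  -- A form that does not kill the leading coefficient of s keeps the transformed denominator v
  -- non-zero.
  obtain ⟨l, hl⟩ := exists_linearForm_ne_zero (HahnSeries.coeff_order_eq_zero.not.2 hps0)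
  obtain ⟨u, hu, hu'⟩ := hlr l
  obtain ⟨v, hv, hv'⟩ := hls l
  have hv0 : v ≠ 0 := by
    rintro rfl
    have h0 := congrArg (HahnSeries.coeff · ps.order) (hv'.eq_zero hN)
    rw [coeff_mapCoeff] at h0
    exact hl (Subtype.ext (by simpa using h0))
  have huv : φ * v = u := by
    refine (hqφ.mul hv').eq_of_eq ?_
    rwa [← mapCoeff_mul l hpφ, hrel]
  rw [eq_div_of_mul_eq hv0 huv]
  exact div_mem hu hv

/-! ### The action of `SL₂(ℤ)` on meromorphic functions -/

lemma differentiableOn_moebius (γ : SL(2, ℤ)) :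
    DifferentiableOn ℂ (fun z ↦ ((γ • ofComplex z : ℍ) : ℂ)) upperHalfPlaneSet := by
  have h := UpperHalfPlane.mdifferentiable_coe.comp
    (UpperHalfPlane.mdifferentiable_smul (g := (γ : GL (Fin 2) ℝ)) (by simp))
  exact UpperHalfPlane.mdifferentiable_iff.1 h

lemma analyticAt_moebius (γ : SL(2, ℤ)) {z : ℂ} (hz : z ∈ upperHalfPlaneSet) :
    AnalyticAt ℂ (fun z ↦ ((γ • ofComplex z : ℍ) : ℂ)) z :=
  (differentiableOn_moebius γ).analyticAt (isOpen_upperHalfPlaneSet.mem_nhds hz)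

/-- Injectivity of the Möbius map keeps punctured neighbourhoods punctured, so identities that hold
off a discrete set can be transported by γ. -/
lemma tendsto_moebius_nhdsNE (γ : SL(2, ℤ)) {z : ℂ} (hz : z ∈ upperHalfPlaneSet) :
    Tendsto (fun w ↦ ((γ • ofComplex w : ℍ) : ℂ)) (𝓝[≠] z) (𝓝[≠] (γ • ofComplex z : ℍ)) := by
  refine tendsto_nhdsWithin_iff.2
    ⟨(analyticAt_moebius γ hz).continuousAt.tendsto.mono_left nhdsWithin_le_nhds, ?_⟩
  filter_upwards [self_mem_nhdsWithin,
    mem_nhdsWithin_of_mem_nhds (isOpen_upperHalfPlaneSet.mem_nhds hz)] with w hw hw' h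
  have h1 : ofComplex w = ofComplex z := smul_left_cancel γ (UpperHalfPlane.ext h)
  rw [ofComplex_apply_of_im_pos hw', ofComplex_apply_of_im_pos hz] at h1
  exact hw (congrArg UpperHalfPlane.coe h1)

lemma comp_smul_mem {f : ℍ → ℂ} (hf : f ∈ meromorphicAlgebra) (γ : SL(2, ℤ)) :
    (fun τ ↦ f (γ • τ)) ∈ meromorphicAlgebra := by
  intro z hz
  have h := MeromorphicAt.comp_analyticAt (g := fun w : ℂ ↦ ((γ • ofComplex w : ℍ) : ℂ))
    (mem_meromorphicAlgebra.1 hf _ (γ • ofComplex z : ℍ).im_pos) (analyticAt_moebius γ hz)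
  refine h.congr (Eventually.of_forall fun w ↦ ?_)
  simp

/-- Composition with a Möbius transformation. -/
def smulComp (γ : SL(2, ℤ)) : meromorphicAlgebra →ₐ[ℂ] meromorphicAlgebra where
  toFun f := ⟨fun τ ↦ (f : ℍ → ℂ) (γ • τ), comp_smul_mem f.2 γ⟩
  map_one' := rfl
  map_mul' _ _ := rfl
  map_zero' := rfl
  map_add' _ _ := rfl
  commutes' _ := rfl

@[simp]
lemma smulComp_apply (γ : SL(2, ℤ)) (f : meromorphicAlgebra) (τ : ℍ) :
    (smulComp γ f : ℍ → ℂ) τ = (f : ℍ → ℂ) (γ • τ) := rfl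

lemma negligibleIdeal_le_comap (γ : SL(2, ℤ)) :
    negligibleIdeal ≤ negligibleIdeal.comap (smulComp γ) := by
  intro f hf
  rw [Ideal.mem_comap, mem_negligibleIdeal_iff_forall]
  intro z hz
  have h := (tendsto_moebius_nhdsNE γ hz).eventually
    (mem_negligibleIdeal_iff_forall.1 hf _ (γ • ofComplex z : ℍ).im_pos)
  filter_upwards [h] with w hw
  simpa using hw

/-- Composition with a Möbius transformation, on the field of meromorphic functions. -/
def fieldComp (γ : SL(2, ℤ)) : MeromorphicField →ₐ[ℂ] MeromorphicField :=
  Ideal.quotientMapₐ negligibleIdeal (smulComp γ) (negligibleIdeal_le_comap γ)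

lemma fieldComp_toMeromorphicField (γ : SL(2, ℤ)) (f : meromorphicAlgebra) :
    fieldComp γ (toMeromorphicField f) = toMeromorphicField (smulComp γ f) := rfl

/-- Composition is a right action; the inverse makes it a left one. -/
instance : MulSemiringAction SL(2, ℤ) MeromorphicField where
  smul γ φ := fieldComp γ⁻¹ φ
  one_smul φ := by
    obtain ⟨f, rfl⟩ := toMeromorphicField_surjective φ
    change fieldComp 1⁻¹ _ = _
    rw [fieldComp_toMeromorphicField]
    congr 1
    ext τ
    simp
  mul_smul γ δ φ := by
    obtain ⟨f, rfl⟩ := toMeromorphicField_surjective φ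
    change fieldComp _ _ = fieldComp _ (fieldComp _ _)
    simp only [fieldComp_toMeromorphicField]
    congr 1
    ext τ
    simp [mul_smul]
  smul_zero γ := map_zero (fieldComp γ⁻¹)
  smul_add γ := map_add (fieldComp γ⁻¹)
  smul_one γ := map_one (fieldComp γ⁻¹)
  smul_mul γ := map_mul (fieldComp γ⁻¹)

lemma smul_toMeromorphicField (γ : SL(2, ℤ)) (f : meromorphicAlgebra) :
    γ • toMeromorphicField f = toMeromorphicField (smulComp γ⁻¹ f) := rfl

lemma smul_algebraMap_complex (γ : SL(2, ℤ)) (c : ℂ) :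
    γ • algebraMap ℂ MeromorphicField c = algebraMap ℂ MeromorphicField c :=
  (fieldComp γ⁻¹).commutes c

/-! ### The field of modular functions with algebraic coefficients -/

lemma IsModularFunction.exists_hasQExp {N : ℕ} {f : ℍ → ℂ} (h : IsModularFunction N f)
    (γ : SL(2, ℤ)) : ∃ p, HasQExp N (fun τ ↦ f (γ • τ)) p := by
  obtain ⟨a, ha⟩ := h.cusps γ
  obtain ⟨p, -, hp⟩ := hasFourierExpansion_iff.1 ha
  exact ⟨p, hp⟩

lemma isModularFunction_of_hasQExp {N : ℕ} {f : ℍ → ℂ} (hf : f ∈ meromorphicAlgebra)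
    (hinv : ∀ γ ∈ CongruenceSubgroup.Gamma N, ∀ τ : ℍ, f (γ • τ) = f τ)
    (h : ∀ γ : SL(2, ℤ), ∃ p, HasQExp N (fun τ ↦ f (γ • τ)) p) : IsModularFunction N f :=
  ⟨hf, hinv, fun γ ↦ (h γ).imp' HahnSeries.coeff fun p hp ↦
    hasFourierExpansion_iff.2 ⟨p, rfl, hp⟩⟩

lemma mem_algModularFunctions {N : ℕ} {φ : MeromorphicField} : φ ∈ algModularFunctions N ↔
    ∃ f : meromorphicAlgebra, toMeromorphicField f = φ ∧ IsModularFunction N f ∧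
      ∃ p ∈ algLaurent, HasQExp N f p := by
  refine exists_congr fun f ↦ and_congr_right fun _ ↦ and_congr_right fun _ ↦ ?_
  constructor
  · rintro ⟨a, ha, halg⟩
    obtain ⟨p, rfl, hp⟩ := hasFourierExpansion_iff.1 ha
    exact ⟨p, mem_algLaurent.2 fun n ↦ mem_algebraicClosure_iff.2 (halg n), hp⟩
  · rintro ⟨p, hp, h⟩
    exact ⟨p.coeff, hasFourierExpansion_iff.2 ⟨p, rfl, h⟩,
      fun n ↦ mem_algebraicClosure_iff.1 (mem_algLaurent.1 hp n)⟩

lemma IsModularFunction.add {N : ℕ} {f g : ℍ → ℂ} (hf : IsModularFunction N f)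
    (hg : IsModularFunction N g) : IsModularFunction N (f + g) := by
  refine isModularFunction_of_hasQExp (add_mem hf.meromorphic hg.meromorphic)
    (fun γ hγ τ ↦ congrArg₂ (· + ·) (hf.invariant γ hγ τ) (hg.invariant γ hγ τ)) fun γ ↦ ?_
  obtain ⟨p, hp⟩ := hf.exists_hasQExp γ
  obtain ⟨r, hr⟩ := hg.exists_hasQExp γ
  exact ⟨_, hp.add hr⟩

lemma IsModularFunction.mul {N : ℕ} {f g : ℍ → ℂ} (hf : IsModularFunction N f)
    (hg : IsModularFunction N g) : IsModularFunction N (f * g) := by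
  refine isModularFunction_of_hasQExp (mul_mem hf.meromorphic hg.meromorphic)
    (fun γ hγ τ ↦ congrArg₂ (· * ·) (hf.invariant γ hγ τ) (hg.invariant γ hγ τ)) fun γ ↦ ?_
  obtain ⟨p, hp⟩ := hf.exists_hasQExp γ
  obtain ⟨r, hr⟩ := hg.exists_hasQExp γ
  exact ⟨_, hp.mul hr⟩

lemma IsModularFunction.inv {N : ℕ} (hN : 0 < N) {f : meromorphicAlgebra}
    (hf : IsModularFunction N f) : IsModularFunction N (meromorphicInv f) := by
  refine isModularFunction_of_hasQExp (meromorphicInv f).2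
    (fun γ hγ τ ↦ congrArg (·⁻¹) (hf.invariant γ hγ τ)) fun γ ↦ ?_
  obtain ⟨p, hp⟩ := hf.exists_hasQExp γ
  exact ⟨_, hp.inv hN⟩

lemma isModularFunction_const (N : ℕ) (c : ℂ) : IsModularFunction N fun _ ↦ c :=
  isModularFunction_of_hasQExp (meromorphicAlgebra.algebraMap_mem c) (fun _ _ _ ↦ rfl)
    fun _ ↦ ⟨_, HasQExp.const N c⟩

lemma C_mem_algLaurent (c : Qbar) : (HahnSeries.C (c : ℂ) : LaurentSeries ℂ) ∈ algLaurent :=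
  ⟨HahnSeries.C c, HahnSeries.map_C _ _⟩

/-- The field of modular functions of level `N` with algebraic Fourier coefficients. -/
def algModularField {N : ℕ} (hN : 0 < N) : IntermediateField Qbar MeromorphicField where
  carrier := algModularFunctions N
  mul_mem' {φ ψ} hφ hψ := by
    obtain ⟨f, rfl, hf, p, hp, hfp⟩ := mem_algModularFunctions.1 hφ
    obtain ⟨g, rfl, hg, r, hr, hgr⟩ := mem_algModularFunctions.1 hψ
    exact mem_algModularFunctions.2
      ⟨f * g, map_mul _ _ _, hf.mul hg, p * r, mul_mem hp hr, hfp.mul hgr⟩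
  add_mem' {φ ψ} hφ hψ := by
    obtain ⟨f, rfl, hf, p, hp, hfp⟩ := mem_algModularFunctions.1 hφ
    obtain ⟨g, rfl, hg, r, hr, hgr⟩ := mem_algModularFunctions.1 hψ
    exact mem_algModularFunctions.2
      ⟨f + g, map_add _ _ _, hf.add hg, p + r, add_mem hp hr, hfp.add hgr⟩
  algebraMap_mem' c := mem_algModularFunctions.2 ⟨algebraMap ℂ _ (c : ℂ),
    toMeromorphicField.commutes (c : ℂ), isModularFunction_const N c, _, C_mem_algLaurent c,
    HasQExp.const N c⟩
  inv_mem' φ hφ := by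
    obtain ⟨f, rfl, hf, p, hp, hfp⟩ := mem_algModularFunctions.1 hφ
    exact mem_algModularFunctions.2
      ⟨meromorphicInv f, toMeromorphicField_inv f, hf.inv hN, p⁻¹, inv_mem hp, hfp.inv hN⟩

lemma algModularField_subset_qExpField {N : ℕ} (hN : 0 < N) :
    (algModularField hN : Set MeromorphicField) ⊆ qExpField hN algLaurent := by
  intro φ hφ
  obtain ⟨f, rfl, -, p, hp, hfp⟩ := mem_algModularFunctions.1 hφ
  exact ⟨p, hp, f, rfl, hfp⟩

/-! ### Expansions of level one forms -/

lemma qParam_one_eq_pow {N : ℕ} (hN : 0 < N) (z : ℂ) :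
    Function.Periodic.qParam (1 : ℕ) z = Function.Periodic.qParam N z ^ N := by
  have : (N : ℂ) ≠ 0 := by exact_mod_cast hN.ne'
  rw [Function.Periodic.qParam, Function.Periodic.qParam, ← Complex.exp_nat_mul]
  congr 1
  push_cast
  field_simp

lemma exists_hasQExp_algLaurent {N : ℕ} (hN : 0 < N) {f : ℍ → ℂ} {c : ℕ → ℂ}
    (hc : ∀ n, c n ∈ Qbar)
    (h : ∀ τ : ℍ, HasSum (fun n ↦ c n * Function.Periodic.qParam (1 : ℕ) τ ^ n) (f τ)) :
    ∃ p ∈ algLaurent, HasQExp N f p := by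
  have hfin (n : ℕ) : {i | N * i = n}.Finite := by
    refine Set.Finite.subset (Set.finite_singleton (n / N)) fun i hi ↦ ?_
    rw [Set.mem_ofPred_eq] at hi
    simp [← hi, Nat.mul_div_cancel_left _ hN]
  obtain ⟨p, hp, hneg, hpos⟩ := exists_hasQExp_of_hasSum (N := N) (f := f) (b := c) hfin
    (Eventually.of_forall fun τ ↦ by simpa only [qParam_one_eq_pow hN, ← pow_mul] using h τ)
  refine ⟨p, mem_algLaurent.2 fun n ↦ ?_, hp⟩
  obtain ⟨n, rfl⟩ | hn := (lt_or_ge n 0).symm.imp_left Int.eq_ofNat_of_zero_le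
  · rw [hpos]
    exact sum_mem fun i _ ↦ hc i
  · rw [hneg n hn]
    exact zero_mem _

lemma hasSum_qExpansion_levelOne {F : Type*} [FunLike F ℍ ℂ] {k : ℤ} [ModularFormClass F 𝒮ℒ k]
    (f : F) (τ : ℍ) : HasSum (fun n ↦ (qExpansion 1 f).coeff n *
      Function.Periodic.qParam (1 : ℕ) τ ^ n) (f τ) := by
  simpa using ModularForm.hasSum_qExpansion (f := f) one_pos one_mem_strictPeriods_SL τ

lemma hasQExp_levelOne {F : Type*} [FunLike F ℍ ℂ] {k : ℤ} [ModularFormClass F 𝒮ℒ k]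
    (f : F) : HasQExp 1 f (HahnSeries.ofPowerSeries ℤ ℂ (qExpansion 1 f)) := by
  refine Eventually.of_forall fun τ ↦ ?_
  rw [hasSum_zpow_iff (m := 0) (fun n hn ↦ ?_) (Function.Periodic.qParam_ne_zero _)]
  · simpa [LaurentSeries.coeff_coe_powerSeries] using hasSum_qExpansion_levelOne f τ
  · rw [PowerSeries.coeff_coe, if_pos hn]

lemma exists_hasQExp_E {N : ℕ} (hN : 0 < N) {k : ℕ} (hk : 3 ≤ k) (hk2 : Even k) :
    ∃ p ∈ algLaurent, HasQExp N (ModularForm.E hk) p := by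
  refine exists_hasQExp_algLaurent hN (fun n ↦ ?_) (hasSum_qExpansion_levelOne (ModularForm.E hk))
  rw [EisensteinSeries.E_qExpansion_coeff hk hk2]
  split_ifs
  · exact one_mem _
  · refine mul_mem (neg_mem (div_mem (mul_mem ?_ ?_) ?_)) ?_
    · exact ofNat_mem Qbar 2
    · exact natCast_mem Qbar k
    · exact (algebraMap ℚ Qbar (bernoulli k)).2
    · exact natCast_mem Qbar _

lemma discriminant_eq (τ : ℍ) : ModularForm.discriminant τ =
    (ModularForm.E₄ τ ^ 3 - ModularForm.E₆ τ ^ 2) / 1728 :=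
  ModularForm.discriminant_eq_E₄_cube_sub_E₆_sq τ

lemma jFun_eq (τ : ℍ) : jFun τ = ModularForm.E₄ τ ^ 3 * (ModularForm.discriminant τ)⁻¹ := by
  rw [jFun, discriminant_eq, div_eq_mul_inv]

lemma exists_hasQExp_discriminant {N : ℕ} (hN : 0 < N) :
    ∃ p ∈ algLaurent, HasQExp N ModularForm.discriminant p := by
  obtain ⟨p, hp, h4⟩ := exists_hasQExp_E hN (k := 4) (by norm_num) ⟨2, rfl⟩
  obtain ⟨r, hr, h6⟩ := exists_hasQExp_E hN (k := 6) (by norm_num) ⟨3, rfl⟩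
  refine ⟨HahnSeries.C ((1728 : ℂ)⁻¹) * (p ^ 3 + -(r ^ 2)), mul_mem ?_ (add_mem (pow_mem hp 3)
    (neg_mem (pow_mem hr 2))), ?_⟩
  · exact C_mem_algLaurent ⟨_, inv_mem (ofNat_mem Qbar 1728)⟩
  · refine ((HasQExp.const N _).mul ((h4.pow 3).add (h6.pow 2).neg)).congr
      (Eventually.of_forall fun τ ↦ ?_)
    rw [discriminant_eq]
    ring

lemma exists_hasQExp_jFun {N : ℕ} (hN : 0 < N) : ∃ p ∈ algLaurent, HasQExp N jFun p := by
  obtain ⟨p, hp, h4⟩ := exists_hasQExp_E hN (k := 4) (by norm_num) ⟨2, rfl⟩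
  obtain ⟨r, hr, hΔ⟩ := exists_hasQExp_discriminant hN
  exact ⟨p ^ 3 * r⁻¹, mul_mem (pow_mem hp 3) (inv_mem hr),
    ((h4.pow 3).mul (hΔ.inv hN)).congr (Eventually.of_forall fun τ ↦ (jFun_eq τ).symm)⟩

lemma levelOne_smul {F : Type*} [FunLike F ℍ ℂ] {k : ℤ} [ModularFormClass F 𝒮ℒ k]
    (f : F) (γ : SL(2, ℤ)) (τ : ℍ) : f (γ • τ) = denom γ τ ^ k * f τ := by
  have hγ : (γ : GL (Fin 2) ℝ) ∈ 𝒮ℒ := ⟨γ, rfl⟩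
  exact SlashInvariantForm.slash_action_eqn'' f hγ τ

lemma jFun_smul (γ : SL(2, ℤ)) (τ : ℍ) : jFun (γ • τ) = jFun τ := by
  have h4 := levelOne_smul ModularForm.E₄ γ τ
  have h6 := levelOne_smul ModularForm.E₆ γ τ
  have hd : denom γ τ ≠ 0 := denom_ne_zero _ _
  have hΔ := ModularForm.discriminant_ne_zero τ
  rw [discriminant_eq] at hΔ
  rw [jFun, jFun, h4, h6]
  have e : (denom γ τ ^ (4 : ℤ) * ModularForm.E₄ τ) ^ 3 -
      (denom γ τ ^ (6 : ℤ) * ModularForm.E₆ τ) ^ 2 =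
      denom γ τ ^ 12 * (ModularForm.E₄ τ ^ 3 - ModularForm.E₆ τ ^ 2) := by
    norm_cast
    ring
  rw [e, mul_pow, div_div_eq_mul_div, div_div_eq_mul_div,
    show (denom γ τ ^ (4 : ℤ)) ^ 3 = denom γ τ ^ 12 by norm_cast; ring, mul_assoc,
    mul_div_mul_left _ _ (pow_ne_zero _ hd)]

lemma jElt_mem {N : ℕ} (hN : 0 < N) : jElt ∈ algModularField hN := by
  obtain ⟨p, hp, h⟩ := exists_hasQExp_jFun hN
  exact mem_algModularFunctions.2 ⟨⟨jFun, jFun_mem⟩, rfl, isModularFunction_of_hasQExp jFun_mem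
    (fun γ _ τ ↦ jFun_smul γ τ) (fun γ ↦ ⟨p, h.congr (Eventually.of_forall fun τ ↦
      (jFun_smul γ τ).symm)⟩), p, hp, h⟩

lemma smul_jElt (γ : SL(2, ℤ)) : γ • jElt = jElt := by
  exact congrArg toMeromorphicField (Subtype.ext (funext fun τ ↦ jFun_smul _ τ))

/-- E₄ starts with 1 and Δ with q, so j starts with q⁻¹. The leading coefficient 1 makes the powers
of j fit for removing poles at the cusp. -/
lemma exists_hasQExp_one_jFun :
    ∃ p : LaurentSeries ℂ, HasQExp 1 jFun p ∧ p.order = -1 ∧ p.coeff (-1) = 1 := by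
  have h4 := hasQExp_levelOne ModularForm.E₄
  have hΔ := hasQExp_levelOne CuspForm.discriminant
  set r := HahnSeries.ofPowerSeries ℤ ℂ (qExpansion 1 ModularForm.E₄) with hr
  set s := HahnSeries.ofPowerSeries ℤ ℂ (qExpansion 1 CuspForm.discriminant) with hs
  have hr0 : r.coeff 0 = 1 := by
    have := LaurentSeries.coeff_coe_powerSeries (qExpansion 1 ModularForm.E₄) 0
    rw [EisensteinSeries.E_qExpansion_coeff_zero _ ⟨2, rfl⟩] at this
    exact this
  have hs1 : s.coeff 1 = 1 := by
    have := LaurentSeries.coeff_coe_powerSeries (qExpansion 1 CuspForm.discriminant) 1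
    rw [CuspForm.coe_discriminant, ModularForm.discriminant_qExpansion_coeff_one] at this
    exact this
  have hs0 : s.coeff 0 = 0 := by
    have h1 := LaurentSeries.coeff_coe_powerSeries (qExpansion 1 CuspForm.discriminant) 0
    have h2 : (qExpansion 1 ModularForm.discriminant).coeff 0 = 0 :=
      PowerSeries.coeff_of_lt_order 0 (by rw [ModularForm.discriminant_qExpansion_order]; simp)
    rw [CuspForm.coe_discriminant, h2] at h1
    exact h1
  have hneg : ∀ (P : PowerSeries ℂ) (n : ℤ), n < 0 →
      (HahnSeries.ofPowerSeries ℤ ℂ P).coeff n = 0 := fun P n hn ↦ by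
    rw [PowerSeries.coeff_coe, if_pos hn]
  have hrne : r ≠ 0 := fun h ↦ by simp [h] at hr0
  have hsne : s ≠ 0 := fun h ↦ by simp [h] at hs1
  have hro : r.order = 0 := le_antisymm
    (HahnSeries.order_le_of_coeff_ne_zero (by rw [hr0]; exact one_ne_zero))
    ((HahnSeries.le_order_iff_forall hrne).2 fun n hn ↦ hneg _ n hn)
  have hso : s.order = 1 := le_antisymm
    (HahnSeries.order_le_of_coeff_ne_zero (by rw [hs1]; exact one_ne_zero))
    ((HahnSeries.le_order_iff_forall hsne).2 fun n hn ↦ by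
      rcases (Int.lt_add_one_iff.1 (show n < 0 + 1 by simpa using hn)).lt_or_eq with h | rfl
      · exact hneg _ n h
      · exact hs0)
  have hp : (r ^ 3 * s⁻¹) * s = r ^ 3 := by
    rw [mul_assoc, inv_mul_cancel₀ hsne, mul_one]
  have hpne : r ^ 3 * s⁻¹ ≠ 0 := mul_ne_zero (pow_ne_zero _ hrne) (inv_ne_zero hsne)
  have ho : (r ^ 3 * s⁻¹).order = -1 := by
    have := congrArg HahnSeries.order hp
    rw [HahnSeries.order_mul hpne hsne, HahnSeries.order_pow, hso, hro] at this
    simp at this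
    omega
  refine ⟨r ^ 3 * s⁻¹, ((h4.pow 3).mul (hΔ.inv one_pos)).congr
    (Eventually.of_forall fun τ ↦ (jFun_eq τ).symm), ho, ?_⟩
  generalize r ^ 3 * s⁻¹ = u at *
  have := congrArg HahnSeries.leadingCoeff hp
  rw [show r ^ 3 = r * r * r by ring, HahnSeries.leadingCoeff_mul, HahnSeries.leadingCoeff_mul,
    HahnSeries.leadingCoeff_mul, HahnSeries.leadingCoeff_eq, HahnSeries.leadingCoeff_eq,
    HahnSeries.leadingCoeff_eq, ho, hso, hro, hr0, hs1] at this
  simpa using this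

/-! ### Modular functions of level one -/

lemma tendsto_T_smul_atImInfty :
    Tendsto (fun τ : ℍ ↦ ModularGroup.T • τ) atImInfty atImInfty := by
  rw [atImInfty, tendsto_comap_iff]
  refine tendsto_comap.congr fun τ ↦ ?_
  simp only [Function.comp, UpperHalfPlane.modular_T_smul, UpperHalfPlane.vadd_im]

/-- The translation T multiplies the n-th coefficient by ζⁿ, with ζ a primitive N-th root of unity.
By uniqueness the coefficients with N ∤ n vanish, and the rest form a series in q^N. -/
lemma HasQExp.level_one_of_periodic {N : ℕ} (hN : 0 < N) {f : ℍ → ℂ} {p : LaurentSeries ℂ}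
    (h : HasQExp N f p) (hf : ∀ τ : ℍ, f (ModularGroup.T • τ) = f τ) :
    ∃ r : LaurentSeries ℂ, HasQExp 1 f r := by
  obtain ⟨m, hm⟩ := p.exists_forall_lt_coeff_eq_zero
  have hζ : IsPrimitiveRoot (Function.Periodic.qParam N 1) N := by
    have := Complex.isPrimitiveRoot_exp N hN.ne'
    simpa [Function.Periodic.qParam] using this
  have hq (τ : ℍ) : Function.Periodic.qParam N (ModularGroup.T • τ : ℍ) =
      Function.Periodic.qParam N 1 * Function.Periodic.qParam N τ := by
    rw [UpperHalfPlane.modular_T_smul, UpperHalfPlane.coe_vadd]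
    simp only [Function.Periodic.qParam]
    rw [← Complex.exp_add]
    congr 1
    push_cast
    ring
  set ζ := Function.Periodic.qParam N 1
  have ha : ∀ n < m, p.coeff n * ζ ^ n = 0 := fun n hn ↦ by rw [hm n hn, zero_mul]
  have h1 : HasQExp N f
      (HahnSeries.ofSuppBddBelow (fun n ↦ p.coeff n * ζ ^ n) (bddBelow_support_of_forall_lt ha)) := by
    filter_upwards [tendsto_T_smul_atImInfty.eventually h] with τ hτ
    rw [hf, hq] at hτ
    simpa [mul_zpow, mul_assoc] using hτ
  have h0 : ∀ n : ℤ, ¬ (N : ℤ) ∣ n → p.coeff n = 0 := by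
    intro n hn
    have := congrArg (HahnSeries.coeff · n) (h1.unique hN h)
    simp only [HahnSeries.coeff_ofSuppBddBelow] at this
    by_contra hne
    exact hn ((hζ.zpow_eq_one_iff_dvd n).1 (mul_left_cancel₀ hne (by rw [this, mul_one])))
  have hN' : (0 : ℤ) < N := by exact_mod_cast hN
  have hb : ∀ n < -|m|, p.coeff (N * n) = 0 := fun n hn ↦ hm _ <| by
    have := neg_abs_le m
    have := abs_nonneg m
    nlinarith
  refine ⟨HahnSeries.ofSuppBddBelow (fun n ↦ p.coeff (N * n)) (bddBelow_support_of_forall_lt hb),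
    ?_⟩
  filter_upwards [h] with τ hτ
  rw [HahnSeries.coeff_ofSuppBddBelow]
  have hinj : Function.Injective fun n : ℤ ↦ (N : ℤ) * n := mul_right_injective₀ hN'.ne'
  rw [← hinj.hasSum_iff] at hτ
  · refine hτ.congr_fun fun n ↦ ?_
    simp only [Function.comp]
    rw [qParam_one_eq_pow hN, zpow_mul, zpow_natCast]
  · intro n hn
    rw [h0 n fun ⟨k, hk⟩ ↦ hn ⟨k, hk.symm⟩, zero_mul]

/-! ### Holomorphic invariant functions are polynomials in j -/

lemma HasQExp.isBoundedAtImInfty {N : ℕ} (hN : 0 < N) {f : ℍ → ℂ} {p : LaurentSeries ℂ}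
    (h : HasQExp N f p) (hp : ∀ n < 0, p.coeff n = 0) : IsBoundedAtImInfty f := by
  rcases eq_or_ne p 0 with rfl | hp0
  · have h0 := h.eventually_eq_zero
    exact (Asymptotics.isBigO_zero _ _).congr' (h0.mono fun τ hτ ↦ hτ.symm) EventuallyEq.rfl
  obtain ⟨F, hF, -, hf⟩ := h.exists_analytic hN
  have hord : 0 ≤ p.order := (HahnSeries.le_order_iff_forall hp0).2 hp
  obtain ⟨k, hk⟩ := Int.eq_ofNat_of_zero_le hord
  have hG : ContinuousAt (fun q ↦ q ^ k * F q) 0 := (continuousAt_id.pow k).mul hF.continuousAt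
  have := (hG.tendsto.mono_left nhdsWithin_le_nhds).comp (tendsto_qParam_atImInfty hN)
  refine (this.isBigO_one ℝ).congr' ?_ EventuallyEq.rfl
  filter_upwards [hf] with τ hτ
  simp [hτ, hk]

-- Such a function is a modular form of weight 0 and level one; invariance reduces boundedness at
-- every cusp to boundedness at i∞.
open scoped ModularForm in
lemma eq_const_of_bounded {f : ℍ → ℂ} (hd : DifferentiableOn ℂ (f ∘ ofComplex) upperHalfPlaneSet)
    (hinv : ∀ (γ : SL(2, ℤ)) (τ : ℍ), f (γ • τ) = f τ) (hb : IsBoundedAtImInfty f) :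
    ∃ c, ∀ τ, f τ = c := by
  have hsl (γ : SL(2, ℤ)) : f ∣[(0 : ℤ)] γ = f := by
    ext τ
    rw [ModularForm.SL_slash_apply, hinv]
    simp
  let g : ModularForm 𝒮ℒ 0 :=
    { toFun := f
      slash_action_eq' := fun _ ⟨γ, hγ⟩ ↦ hγ ▸ hsl γ
      holo' := UpperHalfPlane.mdifferentiable_iff.2 hd
      bdd_at_cusps' := fun {c} hc ↦ by
        rw [Subgroup.IsArithmetic.isCusp_iff_isCusp_SL2Z] at hc
        rw [OnePoint.isBoundedAt_iff_forall_SL2Z hc]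
        intro γ _
        rw [hsl γ]
        exact hb }
  obtain ⟨c, hc⟩ := ModularFormClass.levelOne_weight_zero_const g
  exact ⟨c, fun τ ↦ congrFun hc τ⟩

lemma differentiableOn_jFun : DifferentiableOn ℂ (jFun ∘ ofComplex) upperHalfPlaneSet := by
  have h4 := UpperHalfPlane.mdifferentiable_iff.1 ModularForm.E₄.holo'
  have hΔ := UpperHalfPlane.mdifferentiable_iff.1 CuspForm.discriminant.holo'
  refine ((h4.pow 3).mul (hΔ.inv fun z _ ↦ ModularForm.discriminant_ne_zero _)).congr fun z _ ↦ ?_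
  exact jFun_eq _

/-- Induction on the bound k for the pole order at i∞: subtracting c·j^(k+1), with c the coefficient
of q^(−k−1), lowers it by one. -/
lemma eq_polynomial_jFun (k : ℕ) {f : ℍ → ℂ} {p : LaurentSeries ℂ}
    (hd : DifferentiableOn ℂ (f ∘ ofComplex) upperHalfPlaneSet)
    (hinv : ∀ (γ : SL(2, ℤ)) (τ : ℍ), f (γ • τ) = f τ) (h : HasQExp 1 f p)
    (hp : ∀ n < -(k : ℤ), p.coeff n = 0) : ∃ P : Polynomial ℂ, ∀ τ, f τ = P.eval (jFun τ) := by
  induction k generalizing f p with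
  | zero =>
    obtain ⟨c, hc⟩ := eq_const_of_bounded hd hinv (h.isBoundedAtImInfty one_pos (by simpa using hp))
    exact ⟨Polynomial.C c, by simpa using hc⟩
  | succ k ih =>
    obtain ⟨r, hr, hro, hr1⟩ := exists_hasQExp_one_jFun
    set c := p.coeff (-((k + 1 : ℕ) : ℤ))
    have hq : HasQExp 1 (fun τ ↦ f τ + -(c * jFun τ ^ (k + 1)))
        (p + -(HahnSeries.C c * r ^ (k + 1))) :=
      h.add ((HasQExp.const 1 c).mul (hr.pow (k + 1))).neg
    have hrne : r ≠ 0 := fun h0 ↦ by simp [h0] at hr1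
    have hord : (r ^ (k + 1)).order = -((k + 1 : ℕ) : ℤ) := by
      rw [HahnSeries.order_pow, hro]
      simp
    have hlead : (r ^ (k + 1)).coeff (-((k + 1 : ℕ) : ℤ)) = 1 := by
      rw [← hord, ← HahnSeries.leadingCoeff_eq]
      have : r.leadingCoeff = 1 := by rw [HahnSeries.leadingCoeff_eq, hro, hr1]
      clear ih hord hq
      clear c hp
      induction k with
      | zero => simpa using this
      | succ k ih => rw [pow_succ, HahnSeries.leadingCoeff_mul, ih, this, one_mul]
    have hd' : DifferentiableOn ℂ ((fun τ ↦ f τ + -(c * jFun τ ^ (k + 1))) ∘ ofComplex)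
        upperHalfPlaneSet := hd.add ((differentiableOn_jFun.pow (k + 1)).const_mul c).neg
    have hc : ∀ n < -(k : ℤ), (p + -(HahnSeries.C c * r ^ (k + 1))).coeff n = 0 := by
      intro n hn
      rw [HahnSeries.coeff_add, HahnSeries.coeff_neg, HahnSeries.C_mul_eq_smul,
        HahnSeries.coeff_smul, smul_eq_mul]
      rcases (show n ≤ -((k + 1 : ℕ) : ℤ) by push_cast; omega).lt_or_eq with hlt | rfl
      · rw [hp n hlt, HahnSeries.coeff_eq_zero_of_lt_order (by rwa [hord])]
        simp
      · rw [hlead]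
        simp [c]
    obtain ⟨P, hP⟩ := ih hd' (fun γ τ ↦ by rw [hinv, jFun_smul]) hq hc
    refine ⟨P + Polynomial.C c * Polynomial.X ^ (k + 1), fun τ ↦ ?_⟩
    simp [← hP]

/-! ### Invariant meromorphic functions are rational functions of `j` -/

/-- An expansion prescribes the value at every τ of large imaginary part, so no poles and no
arbitrary values occur there. This confines the poles modulo SL₂(ℤ) to a compact set. -/
lemma HasQExp.eventually_continuousAt {N : ℕ} (hN : 0 < N) {f : ℍ → ℂ} {p : LaurentSeries ℂ}
    (h : HasQExp N f p) : ∀ᶠ τ : ℍ in atImInfty, ContinuousAt (f ∘ ofComplex) (τ : ℂ) := by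
  obtain ⟨F, hF, -, hf⟩ := h.exists_analytic hN
  have hF' := (tendsto_qParam_atImInfty hN).eventually
    (hF.eventually_analyticAt.filter_mono nhdsWithin_le_nhds)
  obtain ⟨A, hA⟩ := (atImInfty_mem _).1 (hf.and hF')
  refine (atImInfty_mem _).2 ⟨A + 1, fun τ hτ ↦ ?_⟩
  have hAτ : A < (τ : ℂ).im := by
    have : A + 1 ≤ τ.im := hτ
    rw [UpperHalfPlane.coe_im]
    linarith
  have hc : ContinuousAt (fun w ↦ Function.Periodic.qParam N w ^ p.order *
      F (Function.Periodic.qParam N w)) (τ : ℂ) := by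
    have hq := (Function.Periodic.continuous_qParam (h := N)).continuousAt (x := (τ : ℂ))
    refine (hq.zpow₀ _ (Or.inl (Function.Periodic.qParam_ne_zero _))).mul ?_
    exact ContinuousAt.comp (f := Function.Periodic.qParam N) (g := F)
      (hA τ (by rw [← UpperHalfPlane.coe_im]; exact hAτ.le)).2.continuousAt hq
  refine hc.congr ?_
  have h1 : {w : ℂ | A < w.im} ∈ 𝓝 (τ : ℂ) :=
    (isOpen_lt continuous_const Complex.continuous_im).mem_nhds hAτ
  have h2 : upperHalfPlaneSet ∈ 𝓝 (τ : ℂ) := isOpen_upperHalfPlaneSet.mem_nhds τ.im_pos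
  filter_upwards [h1, h2] with w hw hw'
  have := (hA ⟨w, hw'⟩ (le_of_lt hw)).1
  simp only [Function.comp, ofComplex_apply_of_im_pos hw']
  exact this.symm

lemma order_nonneg_of_continuousAt {f : ℂ → ℂ} {z : ℂ} (hf : MeromorphicAt f z)
    (h : ContinuousAt f z) : 0 ≤ meromorphicOrderAt f z :=
  (tendsto_nhds_iff_meromorphicOrderAt_nonneg hf).1
    ⟨_, h.tendsto.mono_left nhdsWithin_le_nhds⟩

lemma eventually_smul_eq {f : meromorphicAlgebra} {γ : SL(2, ℤ)}
    (h : γ⁻¹ • toMeromorphicField f = toMeromorphicField f) {z : ℂ} (hz : z ∈ upperHalfPlaneSet) :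
    ∀ᶠ w in 𝓝[≠] z, (f : ℍ → ℂ) (γ • ofComplex w) = (f : ℍ → ℂ) (ofComplex w) := by
  rw [smul_toMeromorphicField, inv_inv, ← sub_eq_zero, ← map_sub,
    toMeromorphicField_eq_zero_iff, mem_negligibleIdeal_iff_forall] at h
  filter_upwards [h z hz] with w hw
  simpa [sub_eq_zero] using hw

/-- Non-negative order means having a finite limit, and limits along punctured neighbourhoods are
carried over by γ; the exact order need not be compared. -/
lemma order_nonneg_of_smul {f : meromorphicAlgebra} {γ : SL(2, ℤ)}
    (h : γ⁻¹ • toMeromorphicField f = toMeromorphicField f) (τ : ℍ)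
    (ho : 0 ≤ meromorphicOrderAt ((f : ℍ → ℂ) ∘ ofComplex) (γ • τ : ℍ)) :
    0 ≤ meromorphicOrderAt ((f : ℍ → ℂ) ∘ ofComplex) τ := by
  rw [← tendsto_nhds_iff_meromorphicOrderAt_nonneg (f.2 _ (im_pos _))] at ho ⊢
  obtain ⟨c, hc⟩ := ho
  have ht := tendsto_moebius_nhdsNE γ τ.im_pos
  rw [UpperHalfPlane.ofComplex_apply] at ht
  refine ⟨c, (hc.comp ht).congr' ?_⟩
  filter_upwards [eventually_smul_eq h τ.im_pos] with w hw
  simpa using hw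

/-- Bookkeeping for cancelling a pole: a is the order of f, b the positive order of j − j(s), and c
the order of the other factors. The value ⊤ stands for a function vanishing identically nearby. -/
lemma WithTop.nonneg_add_toNat_mul_add {a b c : WithTop ℤ} (hb : 0 < b) (hc : 0 ≤ c) :
    0 ≤ a + (((-(a.untopD 0)).toNat : ℕ) * b + c) := by
  induction a with
  | top => simp
  | coe a =>
    induction b with
    | top =>
      by_cases ha : (-a).toNat = 0
      · have : 0 ≤ a := by omega
        have h2 : (0 : WithTop ℤ) ≤ (a : WithTop ℤ) := by exact_mod_cast this
        simpa [ha] using add_nonneg h2 hc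
      · simp [WithTop.mul_top, ha]
    | coe b =>
      induction c with
      | top => simp
      | coe c =>
        norm_cast at *
        simp only [WithTop.untopD_coe]
        have := Int.self_le_toNat (-a)
        nlinarith [Int.natCast_nonneg (-a).toNat]

/-- The representative `j - c` as a meromorphic function. -/
def jSub (c : ℂ) : meromorphicAlgebra := ⟨jFun, jFun_mem⟩ - algebraMap ℂ _ c

lemma jSub_apply (c : ℂ) (τ : ℍ) : (jSub c : ℍ → ℂ) τ = jFun τ - c := rfl

lemma analyticAt_jSub (c : ℂ) {z : ℂ} (hz : z ∈ upperHalfPlaneSet) :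
    AnalyticAt ℂ ((jSub c : ℍ → ℂ) ∘ ofComplex) z :=
  (differentiableOn_jFun.sub_const c).analyticAt (isOpen_upperHalfPlaneSet.mem_nhds hz)

lemma jElt_ne_algebraMap (c : ℂ) : jElt ≠ algebraMap ℂ MeromorphicField c := by
  intro h
  obtain ⟨r, hr, -, hr1⟩ := exists_hasQExp_one_jFun
  have h1 : FieldQExp 1 jElt r := ⟨_, rfl, hr⟩
  rw [h1.unique one_pos (h ▸ FieldQExp.const 1 c)] at hr1
  simp [HahnSeries.C_apply] at hr1

lemma toMeromorphicField_jSub (c : ℂ) :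
    toMeromorphicField (jSub c) = jElt - algebraMap ℂ MeromorphicField c := by
  rw [jSub, map_sub, AlgHom.commutes]
  rfl

/-- Below the height where f is continuous, the fundamental domain lies in a compact box, which
contains finitely many poles s. The factor d = ∏ (j − j(s))^m(s), with m(s) the pole order, cancels
them, and invariance extends this to all of ℍ. -/
lemma exists_mul_order_nonneg {N : ℕ} (hN : 0 < N) {f : meromorphicAlgebra}
    (hinv : ∀ γ : SL(2, ℤ), γ • toMeromorphicField f = toMeromorphicField f)
    {p : LaurentSeries ℂ} (hp : HasQExp N f p) :
    ∃ d : meromorphicAlgebra,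
      toMeromorphicField d ∈ IntermediateField.adjoin ℂ {jElt} ∧ toMeromorphicField d ≠ 0 ∧
      (∃ r, HasQExp N d r) ∧ (∀ γ : SL(2, ℤ), γ • toMeromorphicField d = toMeromorphicField d) ∧
      ∀ z ∈ upperHalfPlaneSet, 0 ≤ meromorphicOrderAt (((f * d : meromorphicAlgebra) : ℍ → ℂ) ∘
        ofComplex) z := by
  set g : ℂ → ℂ := (f : ℍ → ℂ) ∘ ofComplex with hg
  have hgm : MeromorphicOn g upperHalfPlaneSet := f.2
  obtain ⟨A, hA⟩ := (atImInfty_mem _).1 (hp.eventually_continuousAt hN)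
  -- The points of the fundamental domain satisfy |Re| ≤ 1/2 and 4·Im² ≥ 3, hence Im ≥ 1/2.
  let K : Set ℂ := Set.Icc (-(1 / 2) : ℝ) (1 / 2) ×ℂ Set.Icc (1 / 2 : ℝ) A
  have hK : IsCompact K := isCompact_Icc.reProdIm isCompact_Icc
  have hKU : K ⊆ upperHalfPlaneSet := fun z hz ↦
    lt_of_lt_of_le (by norm_num : (0 : ℝ) < 1 / 2) hz.2.1
  have hfin := (MeromorphicOn.divisor g K).finiteSupport hK
  set S : Finset ℂ := hfin.toFinset
  have hSU : ∀ s ∈ S, s ∈ upperHalfPlaneSet := fun s hs ↦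
    hKU ((MeromorphicOn.divisor g K).supportWithinDomain (by simpa [S] using hs))
  have hord : ∀ z ∈ K, z ∉ S → 0 ≤ meromorphicOrderAt g z := by
    intro z hz hzS
    -- The divisor vanishes also where the order is ⊤; both cases give a non-negative order.
    have h0 : MeromorphicOn.divisor g K z = 0 := by simpa [S] using hzS
    rw [MeromorphicOn.divisor_apply (hgm.mono_set hKU) hz] at h0
    rcases WithTop.untop₀_eq_zero.1 h0 with h | h <;> simp [h]
  let m : ℂ → ℕ := fun s ↦ (-((meromorphicOrderAt g s).untopD 0)).toNat
  let c : ℂ → ℂ := fun s ↦ jFun (ofComplex s)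
  let d : meromorphicAlgebra := ∏ s ∈ S, jSub (c s) ^ m s
  have hd : toMeromorphicField d =
      ∏ s ∈ S, (jElt - algebraMap ℂ MeromorphicField (c s)) ^ m s := by
    simp [d, map_prod, toMeromorphicField_jSub]
  have hdinv : ∀ γ : SL(2, ℤ), γ • toMeromorphicField d = toMeromorphicField d := by
    intro γ
    rw [hd, Finset.smul_prod']
    refine Finset.prod_congr rfl fun s _ ↦ ?_
    rw [smul_pow', smul_sub, smul_jElt, smul_algebraMap_complex]
  refine ⟨d, ?_, ?_, ?_, hdinv, ?_⟩
  · rw [hd]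
    exact prod_mem fun s _ ↦ pow_mem (sub_mem (IntermediateField.mem_adjoin_simple_self ℂ jElt)
      (IntermediateField.algebraMap_mem _ _)) _
  · rw [hd]
    exact Finset.prod_ne_zero_iff.2 fun s _ ↦ pow_ne_zero _ (sub_ne_zero.2 (jElt_ne_algebraMap _))
  · obtain ⟨r, -, hr⟩ := exists_hasQExp_jFun hN
    simp only [d]
    induction S using Finset.induction_on with
    | empty => exact ⟨_, HasQExp.const N 1⟩
    | insert s S hs ih =>
      obtain ⟨u, hu⟩ := ih
      rw [Finset.prod_insert hs]
      exact ⟨_, ((hr.add (HasQExp.const N (c s)).neg).pow (m s)).mul hu⟩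
  · have hda : ∀ z ∈ upperHalfPlaneSet, AnalyticAt ℂ ((d : ℍ → ℂ) ∘ ofComplex) z := by
      intro z hz
      have e : (d : ℍ → ℂ) ∘ ofComplex =
          ∏ s ∈ S, ((jSub (c s) : ℍ → ℂ) ∘ ofComplex) ^ m s := by
        funext w
        simp [d, Finset.prod_apply]
      rw [e]
      exact Finset.analyticAt_prod S fun s _ ↦ (analyticAt_jSub (c s) hz).pow _
    have hfinv : ∀ γ : SL(2, ℤ),
        γ⁻¹ • toMeromorphicField (f * d) = toMeromorphicField (f * d) := by
      intro γ
      rw [map_mul, smul_mul', hinv, hdinv]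
    have hmul : ∀ z ∈ upperHalfPlaneSet, meromorphicOrderAt
        (((f * d : meromorphicAlgebra) : ℍ → ℂ) ∘ ofComplex) z =
        meromorphicOrderAt g z + meromorphicOrderAt ((d : ℍ → ℂ) ∘ ofComplex) z :=
      fun z hz ↦ meromorphicOrderAt_mul (hgm z hz) (hda z hz).meromorphicAt
    have hmain : ∀ τ : ℍ, τ ∈ ModularGroup.fd → 0 ≤ meromorphicOrderAt
        (((f * d : meromorphicAlgebra) : ℍ → ℂ) ∘ ofComplex) τ := by
      intro τ hτ
      have hτU : (τ : ℂ) ∈ upperHalfPlaneSet := τ.im_pos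
      rw [hmul _ hτU]
      have hd0 := (hda _ hτU).meromorphicOrderAt_nonneg
      by_cases hτA : A ≤ τ.im
      · exact add_nonneg (order_nonneg_of_continuousAt (hgm _ hτU) (hA τ hτA)) hd0
      have hτK : (τ : ℂ) ∈ K := by
        have h3 := ModularGroup.three_le_four_mul_im_sq_of_mem_fd hτ
        have h4 := abs_le.1 hτ.2
        refine ⟨⟨h4.1, h4.2⟩, ?_, (not_le.1 hτA).le⟩
        change 1 / 2 ≤ τ.im
        nlinarith [τ.im_pos]
      by_cases hτS : (τ : ℂ) ∈ S
      · have e : (d : ℍ → ℂ) ∘ ofComplex = ((jSub (c τ) : ℍ → ℂ) ∘ ofComplex) ^ m τ *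
            ∏ s ∈ S.erase (τ : ℂ), ((jSub (c s) : ℍ → ℂ) ∘ ofComplex) ^ m s := by
          funext w
          rw [Finset.mul_prod_erase S (fun s ↦ ((jSub (c s) : ℍ → ℂ) ∘ ofComplex) ^ m s) hτS]
          simp [d, Finset.prod_apply]
        have hj := analyticAt_jSub (c τ) hτU
        have hr : AnalyticAt ℂ
            (∏ s ∈ S.erase (τ : ℂ), ((jSub (c s) : ℍ → ℂ) ∘ ofComplex) ^ m s) τ :=
          Finset.analyticAt_prod _ fun s _ ↦ (analyticAt_jSub (c s) hτU).pow _
        rw [e, meromorphicOrderAt_mul (hj.pow _).meromorphicAt hr.meromorphicAt,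
          meromorphicOrderAt_pow hj.meromorphicAt]
        refine WithTop.nonneg_add_toNat_mul_add ?_ hr.meromorphicOrderAt_nonneg
        rw [← tendsto_zero_iff_meromorphicOrderAt_pos hj.meromorphicAt]
        have h0 : ((jSub (c τ) : ℍ → ℂ) ∘ ofComplex) (τ : ℂ) = 0 := by
          simp [c, jSub_apply]
        have := hj.continuousAt.tendsto.mono_left (nhdsWithin_le_nhds (s := {(τ : ℂ)}ᶜ))
        rwa [h0] at this
      · exact add_nonneg (hord _ hτK hτS) hd0
    intro z hz
    obtain ⟨γ, hγ⟩ := ModularGroup.exists_smul_mem_fd ⟨z, hz⟩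
    exact order_nonneg_of_smul (hfinv γ) ⟨z, hz⟩ (hmain _ hγ)

/-- Passing to the normal form of a meromorphic function fills in the removable singularities. -/
lemma exists_differentiableOn_rep {f : meromorphicAlgebra}
    (hf : ∀ z ∈ upperHalfPlaneSet, 0 ≤ meromorphicOrderAt ((f : ℍ → ℂ) ∘ ofComplex) z) :
    ∃ G : ℂ → ℂ, DifferentiableOn ℂ G upperHalfPlaneSet ∧
      ∀ z ∈ upperHalfPlaneSet, G =ᶠ[𝓝[≠] z] (f : ℍ → ℂ) ∘ ofComplex := by
  have hm : MeromorphicOn ((f : ℍ → ℂ) ∘ ofComplex) upperHalfPlaneSet := f.2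
  refine ⟨toMeromorphicNFOn ((f : ℍ → ℂ) ∘ ofComplex) upperHalfPlaneSet, fun z hz ↦ ?_,
    fun z hz ↦ hm.toMeromorphicNFOn_eq_self_on_nhdsNE hz⟩
  refine AnalyticAt.differentiableWithinAt ?_
  rw [← (meromorphicNFOn_toMeromorphicNFOn _ _ hz).meromorphicOrderAt_nonneg_iff_analyticAt,
    meromorphicOrderAt_toMeromorphicNFOn hm hz]
  exact hf z hz

/-- After multiplication by d the function has a holomorphic representative G. Continuity upgrades
the invariance of G to all points, and G is then a polynomial in j; dividing by d, which lies in
ℂ(j), gives the claim. -/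
theorem mem_adjoin_jElt {N : ℕ} (hN : 0 < N) {φ : MeromorphicField}
    (hinv : ∀ γ : SL(2, ℤ), γ • φ = φ) {p : LaurentSeries ℂ} (hp : FieldQExp N φ p) :
    φ ∈ IntermediateField.adjoin ℂ {jElt} := by
  obtain ⟨f, rfl, hf⟩ := hp
  obtain ⟨d, hd, hd0, ⟨r, hr⟩, hdinv, hord⟩ := exists_mul_order_nonneg hN hinv hf
  obtain ⟨G, hG, hGf⟩ := exists_differentiableOn_rep hord
  have hGc (τ : ℍ) : ContinuousAt G τ :=
    (hG.differentiableAt (isOpen_upperHalfPlaneSet.mem_nhds τ.im_pos)).continuousAt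
  have hfinv (γ : SL(2, ℤ)) :
      γ⁻¹ • toMeromorphicField (f * d) = toMeromorphicField (f * d) := by
    rw [map_mul, smul_mul', hinv, hdinv]
  have hGinv (γ : SL(2, ℤ)) (τ : ℍ) : G (γ • τ : ℍ) = G τ := by
    have ht := tendsto_moebius_nhdsNE γ τ.im_pos
    rw [UpperHalfPlane.ofComplex_apply] at ht
    refine tendsto_nhds_unique_of_eventuallyEq
      (((hGc (γ • τ)).tendsto.mono_left nhdsWithin_le_nhds).comp ht)
      ((hGc τ).tendsto.mono_left nhdsWithin_le_nhds) ?_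
    filter_upwards [ht.eventually (hGf _ (γ • τ).im_pos), hGf _ τ.im_pos,
      eventually_smul_eq (hfinv γ) τ.im_pos] with w h1 h2 h3
    rw [Function.comp_apply, h1, h2, Function.comp_apply, Function.comp_apply, ← h3,
      UpperHalfPlane.ofComplex_apply]
  have hGd : DifferentiableOn ℂ ((fun τ : ℍ ↦ G τ) ∘ ofComplex) upperHalfPlaneSet :=
    hG.congr fun z hz ↦ by simp [ofComplex_apply_of_im_pos hz]
  -- G agrees with f·d only on punctured neighbourhoods; near i∞ the product is continuous, so there
  -- the values agree as well.
  have hGq : HasQExp N (fun τ : ℍ ↦ G τ) (p * r) := by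
    refine (hf.mul hr).congr ?_
    filter_upwards [(hf.mul hr).eventually_continuousAt hN] with τ hτ
    have h1 := tendsto_nhds_unique_of_eventuallyEq
      ((hGc τ).tendsto.mono_left nhdsWithin_le_nhds)
      (hτ.tendsto.mono_left nhdsWithin_le_nhds) (hGf _ τ.im_pos)
    rw [h1]
    simp
  obtain ⟨s, hs⟩ := hGq.level_one_of_periodic hN (hGinv _)
  obtain ⟨m, hm⟩ := s.exists_forall_lt_coeff_eq_zero
  obtain ⟨P, hP⟩ := eq_polynomial_jFun (-m).toNat hGd hGinv hs fun n hn ↦ hm n (by omega)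
  have hfd : toMeromorphicField (f * d) = Polynomial.aeval jElt P := by
    have e : toMeromorphicField (f * d) =
        toMeromorphicField (Polynomial.aeval ⟨jFun, jFun_mem⟩ P) := by
      rw [← sub_eq_zero, ← map_sub, toMeromorphicField_eq_zero_iff,
        mem_negligibleIdeal_iff_forall]
      intro z hz
      have hU : upperHalfPlaneSet ∈ 𝓝[≠] z :=
        mem_nhdsWithin_of_mem_nhds (isOpen_upperHalfPlaneSet.mem_nhds hz)
      filter_upwards [hGf z hz, hU] with w hw hwU
      have e2 : ((Polynomial.aeval (⟨jFun, jFun_mem⟩ : meromorphicAlgebra) P : _) : ℍ → ℂ)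
          (ofComplex w) = P.eval (jFun (ofComplex w)) := by
        have := Polynomial.aeval_algHom_apply
          ((Pi.evalAlgHom ℂ (fun _ : ℍ ↦ ℂ) (ofComplex w)).comp meromorphicAlgebra.val)
          ⟨jFun, jFun_mem⟩ P
        rw [Polynomial.coe_aeval_eq_eval] at this
        exact this.symm
      have h3 : ((f * d : meromorphicAlgebra) : ℍ → ℂ) (ofComplex w) = G w := hw.symm
      change ((f * d : meromorphicAlgebra) : ℍ → ℂ) (ofComplex w) - _ = 0
      rw [h3, e2, ← hP, ofComplex_apply_of_im_pos hwU, sub_self]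
    rw [e, ← Polynomial.aeval_algHom_apply]
    rfl
  have h1 : toMeromorphicField f = Polynomial.aeval jElt P / toMeromorphicField d := by
    rw [← hfd, map_mul, mul_div_cancel_right₀ _ hd0]
  rw [h1]
  exact div_mem (IntermediateField.algebra_adjoin_le_adjoin ℂ _
    (Polynomial.aeval_mem_adjoin_singleton ℂ jElt)) hd

/-! ### Expansions of lattice functions -/

/-- The function `x / (1 - x)²`. -/
def koebe (x : ℂ) : ℂ := x / (1 - x) ^ 2

lemma koebe_inv (x : ℂ) : koebe x⁻¹ = koebe x := by
  by_cases hx : x = 0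
  · simp [hx]
  by_cases h1 : x = 1
  · simp [h1]
  have : 1 - x ≠ 0 := sub_ne_zero.2 (Ne.symm h1)
  have h2 : x - 1 ≠ 0 := sub_ne_zero.2 h1
  have h3 : 1 - x⁻¹ = (x - 1) / x := by field_simp
  rw [koebe, koebe, h3]
  field_simp
  ring

lemma hasSum_koebe {x : ℂ} (hx : ‖x‖ < 1) :
    HasSum (fun d : ℕ+ ↦ (d : ℂ) * x ^ (d : ℕ)) (koebe x) :=
  (PNat.coe_injective.hasSum_iff (f := fun d : ℕ ↦ (d : ℂ) * x ^ d) fun d hd ↦ by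
    have : d = 0 := by
      by_contra h
      exact hd ⟨⟨d, Nat.pos_of_ne_zero h⟩, rfl⟩
    simp [this]).2 (hasSum_coe_mul_geometric_of_norm_lt_one hx)

/-- The sum `∑ₙ (w + n)⁻²`, where a vanishing denominator is left out. -/
def invSqSum (w : ℂ) : ℂ := ∑' n : ℤ, 1 / (w + n) ^ 2

lemma summable_invSqSum (w : ℂ) : Summable fun n : ℤ ↦ 1 / (w + n) ^ 2 := by
  refine (EisensteinSeries.linear_right_summable w 1 (k := 2) le_rfl).congr fun n ↦ ?_
  rw [one_div, Int.cast_one, one_mul, zpow_ofNat]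

lemma invSqSum_neg (w : ℂ) : invSqSum (-w) = invSqSum w := by
  rw [invSqSum, invSqSum, ← (Equiv.neg ℤ).tsum_eq]
  refine tsum_congr fun n ↦ ?_
  simp only [Equiv.neg_apply, Int.cast_neg]
  rw [← neg_add, neg_sq]

lemma invSqSum_zero : invSqSum 0 = Real.pi ^ 2 / 3 := by
  have h := two_mul_riemannZeta_eq_tsum_int_inv_pow_of_even le_rfl even_two
  have h2 := riemannZeta_two
  rw [Nat.cast_two, h2] at h
  simp only [invSqSum, zero_add, one_div]
  rw [← h]
  ring

/-- Lipschitz's formula for exponent 2, with ∑ d·xᵈ summed in closed form. -/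
lemma invSqSum_of_im_pos {w : ℂ} (hw : 0 < w.im) :
    invSqSum w = (2 * Real.pi * Complex.I) ^ 2 * koebe (Function.Periodic.qParam 1 w) := by
  have h := EisensteinSeries.qExpansion_identity_pnat (k := 1) le_rfl ⟨w, hw⟩
  have hx : ‖Function.Periodic.qParam 1 w‖ < 1 := by
    rw [Function.Periodic.norm_qParam]
    have := Real.pi_pos
    simp only [Real.exp_lt_one_iff, div_one]
    nlinarith [mul_pos this hw]
  rw [← (hasSum_koebe hx).tsum_eq, invSqSum]
  simp only [Nat.reduceAdd, Nat.factorial_one, Nat.cast_one, div_one, pow_one] at h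
  rw [h]
  congr 1
  · ring
  · simp [Function.Periodic.qParam]

lemma qParam_one_eq_one_iff {w : ℂ} : Function.Periodic.qParam 1 w = 1 ↔ ∃ n : ℤ, w = n := by
  rw [Function.Periodic.qParam, Complex.exp_eq_one_iff]
  refine exists_congr fun n ↦ ?_
  simp only [Complex.ofReal_one, div_one]
  rw [mul_comm (n : ℂ)]
  exact mul_right_inj' Complex.two_pi_I_ne_zero

/-- The limit t → 0⁺ of the formula at x + it. Since |x + n| ≤ |x + it + n|, the terms at t = 0
dominate. -/
lemma invSqSum_of_real {x : ℝ} (hx : ∀ n : ℤ, x ≠ n) :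
    invSqSum x = (2 * Real.pi * Complex.I) ^ 2 * koebe (Function.Periodic.qParam 1 x) := by
  have hx0 (n : ℤ) : (x : ℂ) + n ≠ 0 := by
    intro h
    refine hx (-n) ?_
    have : x + n = 0 := by exact_mod_cast h
    push_cast
    linarith
  have ht : Tendsto (fun t : ℝ ↦ (x : ℂ) + t * Complex.I) (𝓝[>] 0) (𝓝 x) := by
    have : Continuous fun t : ℝ ↦ (x : ℂ) + t * Complex.I := by fun_prop
    simpa using (this.tendsto 0).mono_left nhdsWithin_le_nhds
  have h1 : Tendsto (fun t : ℝ ↦ invSqSum (x + t * Complex.I)) (𝓝[>] 0) (𝓝 (invSqSum x)) := by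
    refine tendsto_tsum_of_dominated_convergence (summable_invSqSum x).norm (fun n ↦ ?_)
      (Eventually.of_forall fun t n ↦ ?_)
    · exact Tendsto.div tendsto_const_nhds ((ht.add_const _).pow 2) (pow_ne_zero _ (hx0 n))
    · rw [norm_div, norm_div, norm_pow, norm_pow]
      have h2 : ‖(x : ℂ) + n‖ ≤ ‖(x : ℂ) + t * Complex.I + n‖ := by
        have h3 := Complex.abs_re_le_norm ((x : ℂ) + t * Complex.I + n)
        have h4 : (x : ℂ) + n = ((x + n : ℝ) : ℂ) := by push_cast; rfl
        rw [h4, Complex.norm_real]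
        simpa using h3
      have := norm_pos_iff.2 (hx0 n)
      gcongr
  have h2 : Tendsto (fun t : ℝ ↦ (2 * Real.pi * Complex.I) ^ 2 *
      koebe (Function.Periodic.qParam 1 (x + t * Complex.I))) (𝓝[>] 0)
      (𝓝 ((2 * Real.pi * Complex.I) ^ 2 * koebe (Function.Periodic.qParam 1 x))) := by
    have hq := (Function.Periodic.continuous_qParam (h := 1)).continuousAt.tendsto.comp ht
    refine Tendsto.const_mul _ (hq.div ((tendsto_const_nhds.sub hq).pow 2) (pow_ne_zero _ ?_))
    rw [sub_ne_zero]
    intro h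
    obtain ⟨n, hn⟩ := qParam_one_eq_one_iff.1 h.symm
    exact hx n (by exact_mod_cast hn)
  refine tendsto_nhds_unique_of_eventuallyEq h1 h2 ?_
  filter_upwards [self_mem_nhdsWithin] with t ht
  exact invSqSum_of_im_pos (by simpa using ht)

lemma qParam_neg (h : ℝ) (w : ℂ) :
    Function.Periodic.qParam h (-w) = (Function.Periodic.qParam h w)⁻¹ := by
  rw [Function.Periodic.qParam, Function.Periodic.qParam, ← Complex.exp_neg]
  congr 1
  ring

lemma invSqSum_of_ne_int {w : ℂ} (hw : ∀ n : ℤ, w ≠ n) :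
    invSqSum w = (2 * Real.pi * Complex.I) ^ 2 * koebe (Function.Periodic.qParam 1 w) := by
  rcases lt_trichotomy w.im 0 with h | h | h
  · rw [← invSqSum_neg, invSqSum_of_im_pos (by simpa using h), qParam_neg, koebe_inv]
  · have e : w = (w.re : ℂ) := Complex.ext rfl h
    rw [e]
    refine invSqSum_of_real fun n hn ↦ hw n ?_
    rw [e, hn]
    simp
  · exact invSqSum_of_im_pos h

lemma hasSum_lattice {τ : ℍ} {F : ℂ → ℂ} {a : ℂ}
    (h : HasSum (fun l : (latticePair τ).lattice ↦ F l) a) :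
    HasSum (fun x : ℤ × ℤ ↦ F (x.1 * τ + x.2)) a := by
  rw [← (latticePair τ).latticeEquivProd.symm.toEquiv.hasSum_iff] at h
  convert h using 2 with x
  have := (latticePair τ).latticeEquiv_symm_apply x
  simpa [latticePair] using! congrArg F this.symm

/-- The lattice sum is absolutely convergent, so it may be summed row by row; within a row the two
halves converge separately. The convention 1/0 = 0 takes care of the zero lattice point. -/
lemma hasSum_weierstrassP_invSqSum (τ : ℍ) (z : ℂ) :
    HasSum (fun m : ℤ ↦ invSqSum (z + m * τ) - invSqSum (m * τ))
      ((latticePair τ).weierstrassP z) := by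
  have h1 := (latticePair τ).hasSum_weierstrassP (-z)
  rw [PeriodPair.weierstrassP_neg] at h1
  have h2 := hasSum_lattice (F := fun l ↦ 1 / (-z - l) ^ 2 - 1 / l ^ 2) h1
  refine h2.prod_fiberwise fun m ↦ ?_
  have e (n : ℤ) : (-z - (m * τ + n)) ^ 2 = (z + m * τ + n) ^ 2 := by ring
  simp only [e]
  exact (summable_invSqSum (z + m * τ)).hasSum.sub (summable_invSqSum (m * τ)).hasSum

/-- Rows m and −m are paired by the evenness of `invSqSum`, leaving only arguments ±z + mτ with m >
0. The row m = 0 supplies −π²/3 = −2ζ(2). -/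
lemma weierstrassP_eq_invSqSum (τ : ℍ) (z : ℂ) : (latticePair τ).weierstrassP z =
    invSqSum z - Real.pi ^ 2 / 3 + ∑' m : ℕ+, (invSqSum (z + m * τ) - invSqSum (m * τ)) +
      ∑' m : ℕ+, (invSqSum (-z + m * τ) - invSqSum (m * τ)) := by
  have h := hasSum_weierstrassP_invSqSum τ z
  rw [← h.tsum_eq, tsum_int_eq_zero_add_tsum_pnat h.summable]
  congr 1
  · simp [invSqSum_zero]
  · refine tsum_congr fun m ↦ ?_
    have e1 : z + ((-(m : ℤ) : ℤ) : ℂ) * τ = -(-z + m * τ) := by push_cast; ring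
    have e2 : ((-(m : ℤ) : ℤ) : ℂ) * τ = -(m * τ) := by push_cast; ring
    rw [e1, e2, invSqSum_neg, invSqSum_neg]

/-! ### Lambert series -/

section Lambert

variable {N : ℕ} {ι : Type*} {μ : ι → ℕ+} {e : ι → ℕ} {c : ℂ}

lemma norm_qParam_lt_one (hN : 0 < N) (τ : ℍ) : ‖Function.Periodic.qParam N τ‖ < 1 := by
  rw [Function.Periodic.norm_qParam]
  have h1 := Real.pi_pos
  have h2 : (0 : ℝ) < N := by exact_mod_cast hN
  rw [Real.exp_lt_one_iff]
  have := mul_pos h1 τ.im_pos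
  rw [UpperHalfPlane.coe_im]
  refine div_neg_of_neg_of_pos ?_ h2
  nlinarith

/-- The double series is dominated by ∑ d·|q|^(md): the injection μ into the positive integers
satisfies μ i ≤ e i, and |q| < 1. -/
lemma hasSum_lambert (hN : 0 < N) (hμ : Function.Injective μ) (he : ∀ i, (μ i : ℕ) ≤ e i)
    (hc : ‖c‖ = 1) (τ : ℍ) :
    Summable (fun i ↦ koebe (c * Function.Periodic.qParam N τ ^ e i)) ∧
    HasSum (fun x : ι × ℕ+ ↦ ((x.2 : ℂ) * c ^ (x.2 : ℕ)) *
      Function.Periodic.qParam N τ ^ (e x.1 * x.2))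
      (∑' i, koebe (c * Function.Periodic.qParam N τ ^ e i)) := by
  set q := Function.Periodic.qParam N τ with hq
  have hq1 : ‖q‖ < 1 := norm_qParam_lt_one hN τ
  have hs : Summable fun x : ι × ℕ+ ↦ ((x.2 : ℂ) * c ^ (x.2 : ℕ)) * q ^ (e x.1 * x.2) := by
    have h0 := summable_prod_mul_pow (𝕜 := ℂ) 1 (r := q) hq1
    have h1 := h0.norm.comp_injective
      (i := fun x : ι × ℕ+ ↦ (μ x.1, x.2)) (hμ.prodMap Function.injective_id)
    refine Summable.of_norm_bounded h1 fun x ↦ ?_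
    simp only [Function.comp, pow_one, norm_mul, norm_pow, hc, one_pow, mul_one]
    gcongr ?_ * ?_
    exact pow_le_pow_of_le_one (norm_nonneg _) hq1.le (Nat.mul_le_mul_right _ (he x.1))
  have hf (i : ι) : HasSum (fun d : ℕ+ ↦ ((d : ℂ) * c ^ (d : ℕ)) * q ^ (e i * d))
      (koebe (c * q ^ e i)) := by
    have hx : ‖c * q ^ e i‖ < 1 := by
      rw [norm_mul, hc, one_mul, norm_pow]
      exact pow_lt_one₀ (norm_nonneg _) hq1 ((μ i).pos.trans_le (he i)).ne'
    convert hasSum_koebe hx using 2 with d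
    rw [mul_pow, pow_mul, mul_assoc]
  have h2 := hs.hasSum.prod_fiberwise hf
  refine ⟨h2.summable, ?_⟩
  rw [h2.tsum_eq]
  exact hs.hasSum

lemma exists_hasQExp_lambert (hN : 0 < N) (hμ : Function.Injective μ)
    (he : ∀ i, (μ i : ℕ) ≤ e i) (hc : ‖c‖ = 1) (hcQ : c ∈ Qbar) :
    ∃ p ∈ algLaurent, HasQExp N
      (fun τ ↦ ∑' i, koebe (c * Function.Periodic.qParam N τ ^ e i)) p ∧
      ∀ n ≤ 0, p.coeff n = 0 := by
  have hfin (n : ℕ) : {x : ι × ℕ+ | e x.1 * x.2 = n}.Finite := by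
    have h1 : ({m : ℕ+ | m ≤ n.succPNat} ×ˢ {m : ℕ+ | m ≤ n.succPNat}).Finite :=
      (Set.finite_Iic _).prod (Set.finite_Iic _)
    refine (h1.preimage (f := fun x : ι × ℕ+ ↦ (μ x.1, x.2))
      (hμ.prodMap Function.injective_id).injOn).subset fun x hx ↦ ?_
    rw [Set.mem_ofPred_eq] at hx
    have h2 := he x.1
    have h3 := x.2.pos
    have h4 := (μ x.1).pos
    constructor <;> rw [Set.mem_ofPred_eq, ← PNat.coe_le_coe, Nat.succPNat_coe]
    · change (μ x.1 : ℕ) ≤ _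
      nlinarith
    · change (x.2 : ℕ) ≤ _
      nlinarith
  obtain ⟨p, hp, hneg, hpos⟩ := exists_hasQExp_of_hasSum (N := N) hfin
    (Eventually.of_forall fun τ ↦ (hasSum_lambert hN hμ he hc τ).2)
  refine ⟨p, mem_algLaurent.2 fun n ↦ ?_, hp, fun n hn ↦ ?_⟩
  · obtain ⟨n, rfl⟩ | hn := (lt_or_ge n 0).symm.imp_left Int.eq_ofNat_of_zero_le
    · rw [hpos]
      exact sum_mem fun i _ ↦ mul_mem (natCast_mem _ _) (pow_mem hcQ _)
    · rw [hneg n hn]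
      exact zero_mem _
  · rcases hn.lt_or_eq with h | rfl
    · exact hneg n h
    · have := hpos 0
      rw [Nat.cast_zero] at this
      rw [this]
      refine Finset.sum_eq_zero fun x hx ↦ ?_
      have h1 : e x.1 * x.2 = 0 := ((hfin 0).mem_toFinset).1 hx
      have h2 := he x.1
      have h3 := x.2.pos
      have h4 := (μ x.1).pos
      nlinarith

end Lambert

/-! ### The expansion of the Weierstrass function at a torsion point -/

lemma invSqSum_torsion {N : ℕ} (hN : 0 < N) (τ : ℍ) (r : ℕ) (s : ℤ) (h : 0 < r) :
    invSqSum ((r / N : ℂ) * τ + s / N) = (2 * Real.pi * Complex.I) ^ 2 *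
      koebe (Function.Periodic.qParam N s * Function.Periodic.qParam N τ ^ r) := by
  have h1 : (N : ℂ) ≠ 0 := by exact_mod_cast hN.ne'
  have h2 : ((r / N : ℂ) * τ + s / N) = (((r / N : ℝ)) : ℂ) * τ + ((s / N : ℝ) : ℂ) := by
    push_cast; rfl
  rw [invSqSum_of_im_pos]
  · congr 2
    simp only [Function.Periodic.qParam]
    rw [← Complex.exp_nat_mul, ← Complex.exp_add]
    congr 1
    push_cast
    field_simp
    ring
  · rw [h2, Complex.add_im, Complex.im_ofReal_mul, Complex.ofReal_im, add_zero]
    have : (0 : ℝ) < N := by exact_mod_cast hN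
    have : (0 : ℝ) < r := by exact_mod_cast h
    have := τ.im_pos
    rw [UpperHalfPlane.coe_im]
    positivity

lemma norm_qParam_intCast (N : ℕ) (s : ℤ) : ‖Function.Periodic.qParam N s‖ = 1 := by
  rw [Function.Periodic.norm_qParam]
  simp

lemma qParam_intCast_mem (N : ℕ) (hN : 0 < N) (s : ℤ) : Function.Periodic.qParam N s ∈ Qbar := by
  have h1 : (N : ℂ) ≠ 0 := by exact_mod_cast hN.ne'
  have h : Function.Periodic.qParam N s ^ N = 1 := by
    rw [Function.Periodic.qParam, ← Complex.exp_nat_mul, Complex.exp_eq_one_iff]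
    refine ⟨s, ?_⟩
    push_cast
    field_simp
  rw [mem_algebraicClosure_iff]
  refine IsAlgebraic.of_pow hN ?_
  rw [h]
  exact isAlgebraic_one

/-- The torsion point `(r τ + s) / N`. -/
def torsionPoint (N : ℕ) (r s : ℤ) (τ : ℍ) : ℂ := (r / N : ℂ) * τ + s / N

/-- The rows m > 0 give Lambert series with exponents Nm + r, Nm − r and Nm, none of which has a
constant term. The constant term thus comes from the row m = 0 alone, which contributes a root of
unity term exactly when r = 0. -/
lemma exists_hasQExp_weierstrassP {N : ℕ} (hN : 0 < N) {r : ℕ} {s : ℤ} (hr : r < N)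
    (h0 : r = 0 → ¬ (N : ℤ) ∣ s) :
    ∃ p ∈ algLaurent, HasQExp N (fun τ ↦ (latticePair τ).weierstrassP (torsionPoint N r s τ) /
      (2 * Real.pi * Complex.I) ^ 2) p ∧ (∀ n < 0, p.coeff n = 0) ∧
      p.coeff 0 = 1 / 12 + if r = 0 then koebe (Function.Periodic.qParam N s) else 0 := by
  have hN0 : (N : ℂ) ≠ 0 := by exact_mod_cast hN.ne'
  have hid : Function.Injective (id : ℕ+ → ℕ+) := Function.injective_id
  have he1 (m : ℕ+) : ((id m : ℕ+) : ℕ) ≤ N * m + r := by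
    simp only [id]
    nlinarith [m.pos]
  -- Since r < N, the exponent Nm − r is at least m, so the truncated subtraction loses nothing.
  have he2 (m : ℕ+) : ((id m : ℕ+) : ℕ) ≤ N * m - r := by
    simp only [id]
    have := m.pos
    have : (m : ℕ) + r ≤ N * m := by nlinarith
    omega
  have he3 (m : ℕ+) : ((id m : ℕ+) : ℕ) ≤ N * m := by
    simp only [id]
    nlinarith [m.pos]
  set c := Function.Periodic.qParam N s with hc
  have hc1 := norm_qParam_intCast N s
  have hcQ := qParam_intCast_mem N hN s
  have hd1 := norm_qParam_intCast N (-s)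
  have hdQ := qParam_intCast_mem N hN (-s)
  set d := Function.Periodic.qParam N ((-s : ℤ) : ℂ) with hd
  obtain ⟨p1, hp1, hq1, hz1⟩ := exists_hasQExp_lambert hN hid he1 hc1 hcQ
  obtain ⟨p2, hp2, hq2, hz2⟩ := exists_hasQExp_lambert hN hid he2 hd1 hdQ
  obtain ⟨p3, hp3, hq3, hz3⟩ := exists_hasQExp_lambert hN hid he3 norm_one (one_mem Qbar)
  obtain ⟨p0, hp0, hq0, hn0, hz0⟩ : ∃ p ∈ algLaurent, HasQExp N
      (fun τ ↦ invSqSum (torsionPoint N r s τ) / (2 * Real.pi * Complex.I) ^ 2) p ∧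
      (∀ n < 0, p.coeff n = 0) ∧ p.coeff 0 = if r = 0 then koebe c else 0 := by
    rcases r.eq_zero_or_pos with rfl | hr0
    · refine ⟨HahnSeries.C (koebe c), C_mem_algLaurent ⟨_, ?_⟩, (HasQExp.const N (koebe c)).congr ?_,
        ?_, ?_⟩
      · exact div_mem hcQ (pow_mem (sub_mem (one_mem _) hcQ) 2)
      · refine Eventually.of_forall fun τ ↦ ?_
        have e : torsionPoint N (0 : ℕ) s τ = (s / N : ℂ) := by simp [torsionPoint]
        rw [e, invSqSum_of_ne_int, mul_div_cancel_left₀]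
        · congr 1
          rw [hc, Function.Periodic.qParam, Function.Periodic.qParam]
          congr 1
          push_cast
          field_simp
        · exact pow_ne_zero _ Complex.two_pi_I_ne_zero
        · intro n hn
          rw [div_eq_iff hN0] at hn
          have : s = n * N := by exact_mod_cast hn
          exact h0 rfl ⟨n, by rw [this, mul_comm]⟩
      · intro n hn
        rw [HahnSeries.C_apply, HahnSeries.coeff_single_of_ne hn.ne]
      · rw [HahnSeries.C_apply, HahnSeries.coeff_single_same, if_pos rfl]
    · obtain ⟨p, hp, hq, hz⟩ := exists_hasQExp_lambert (ι := Unit) (μ := fun _ ↦ 1)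
        (e := fun _ ↦ r) hN (fun _ _ _ ↦ rfl) (fun _ ↦ hr0) hc1 hcQ
      refine ⟨p, hp, hq.congr (Eventually.of_forall fun τ ↦ ?_), fun n hn ↦ hz n hn.le, ?_⟩
      · rw [torsionPoint, Int.cast_natCast, invSqSum_torsion hN τ r s hr0,
          mul_div_cancel_left₀ _ (pow_ne_zero _ Complex.two_pi_I_ne_zero)]
        simp
      · rw [hz 0 le_rfl, if_neg hr0.ne']
  -- 1/12 is −π²/3 divided by (2πi)².
  have hC : (1 / 12 : ℂ) ∈ Qbar := div_mem (one_mem _) (ofNat_mem Qbar 12)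
  refine ⟨p0 + HahnSeries.C (1 / 12 : ℂ) + (p1 + -p3) + (p2 + -p3),
    add_mem (add_mem (add_mem hp0 (C_mem_algLaurent ⟨_, hC⟩)) (add_mem hp1 (neg_mem hp3)))
      (add_mem hp2 (neg_mem hp3)), ?_, ?_, ?_⟩
  · refine (((hq0.add (HasQExp.const N _)).add (hq1.add hq3.neg)).add (hq2.add hq3.neg)).congr
      (Eventually.of_forall fun τ ↦ ?_)
    have s1 := (hasSum_lambert hN hid he1 hc1 τ).1
    have s2 := (hasSum_lambert hN hid he2 hd1 τ).1
    have s3 := (hasSum_lambert hN hid he3 norm_one τ).1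
    have e3 (m : ℕ+) : invSqSum (m * τ) = (2 * Real.pi * Complex.I) ^ 2 *
        koebe (1 * Function.Periodic.qParam N τ ^ (N * m : ℕ)) := by
      have := invSqSum_torsion hN τ (N * m) 0 (by positivity)
      convert this using 2
      · push_cast
        field_simp
        ring
      · simp [Function.Periodic.qParam]
    have e1 (m : ℕ+) : invSqSum (torsionPoint N r s τ + m * τ) = (2 * Real.pi * Complex.I) ^ 2 *
        koebe (c * Function.Periodic.qParam N τ ^ (N * m + r : ℕ)) := by
      rw [hc, ← invSqSum_torsion hN τ (N * m + r) s (by positivity), torsionPoint]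
      congr 1
      push_cast
      field_simp
      ring
    have e2 (m : ℕ+) : invSqSum (-torsionPoint N r s τ + m * τ) =
        (2 * Real.pi * Complex.I) ^ 2 *
        koebe (d * Function.Periodic.qParam N τ ^ (N * m - r : ℕ)) := by
      have hm := he2 m
      have hm0 : r ≤ N * m := by nlinarith [m.pos]
      rw [hd, ← invSqSum_torsion hN τ (N * m - r) (-s) (m.pos.trans_le hm), torsionPoint]
      congr 1
      push_cast [Nat.cast_sub hm0]
      field_simp
      ring
    rw [weierstrassP_eq_invSqSum]
    simp only [e1, e2, e3, ← mul_sub, tsum_mul_left]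
    rw [s1.tsum_sub s3, s2.tsum_sub s3]
    have hpi : (2 * Real.pi * Complex.I) ^ 2 ≠ 0 := pow_ne_zero _ Complex.two_pi_I_ne_zero
    have h12 : (Real.pi : ℂ) ^ 2 / 3 = -(2 * Real.pi * Complex.I) ^ 2 / 12 := by
      rw [mul_pow, mul_pow, Complex.I_sq]
      ring
    rw [h12]
    field_simp
    ring
  · intro n hn
    simp only [HahnSeries.coeff_add, HahnSeries.coeff_neg, hn0 n hn, hz1 n hn.le, hz2 n hn.le,
      hz3 n hn.le, HahnSeries.C_apply, HahnSeries.coeff_single_of_ne hn.ne]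
    simp
  · simp only [HahnSeries.coeff_add, HahnSeries.coeff_neg, hz0, hz1 0 le_rfl, hz2 0 le_rfl,
      hz3 0 le_rfl, HahnSeries.C_apply, HahnSeries.coeff_single_same]
    ring

/-! ### The lattice invariants in terms of Eisenstein series -/

lemma latticeG_eq {k : ℕ} (hk : 3 ≤ k) (τ : ℍ) :
    (latticePair τ).G k = 2 * riemannZeta k * ModularForm.E hk τ := by
  have h1 : (latticePair τ).G k = ∑' v : Fin 2 → ℤ, EisensteinSeries.eisSummand k v τ := by
    rw [PeriodPair.G, tsum_lattice τ fun l ↦ (l ^ k)⁻¹]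
    refine tsum_congr fun v ↦ ?_
    simp [EisensteinSeries.eisSummand]
  rw [h1, tsum_eisSummand_eq_riemannZeta_mul_eisensteinSeries hk τ,
    show ModularForm.E hk τ = (1 / 2 : ℂ) • EisensteinSeries.eisensteinSeriesSIF (N := 1) 0 k τ
      from rfl, EisensteinSeries.eisensteinSeriesSIF_apply 0 k τ, smul_eq_mul]
  ring

lemma riemannZeta_six : riemannZeta 6 = Real.pi ^ 6 / 945 := by
  have h := riemannZeta_two_mul_nat (k := 3) (by norm_num)
  have hb : bernoulli 6 = 1 / 42 := by
    rw [bernoulli_eq_bernoulli'_of_ne_one (by norm_num), bernoulli'_def]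
    have h5 : bernoulli' 5 = 0 := bernoulli'_eq_zero_of_odd (by decide) (by norm_num)
    norm_num [Finset.sum_range_succ, Nat.choose, h5]
  have h6 : Nat.factorial 6 = 720 := rfl
  norm_num [hb, h6] at h
  rw [h]
  ring

lemma g₂_eq (τ : ℍ) : (latticePair τ).g₂ = 4 / 3 * Real.pi ^ 4 * ModularForm.E₄ τ := by
  rw [PeriodPair.g₂, latticeG_eq (by norm_num : 3 ≤ 4), Nat.cast_ofNat, riemannZeta_four]
  ring

lemma g₃_eq (τ : ℍ) : (latticePair τ).g₃ = 8 / 27 * Real.pi ^ 6 * ModularForm.E₆ τ := by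
  rw [PeriodPair.g₃, latticeG_eq (by norm_num : 3 ≤ 6), Nat.cast_ofNat, riemannZeta_six]
  ring

lemma latticeDisc_eq (τ : ℍ) :
    latticeDisc τ = (2 * Real.pi) ^ 12 * ModularForm.discriminant τ := by
  rw [latticeDisc, g₂_eq, g₃_eq, discriminant_eq]
  ring

/-- All powers of π cancel: (4/3)(8/27)π¹⁰·(2πi)²/(2π)¹² = −1/2592. This is what makes algebraic
coefficients possible. -/
lemma frickeFun_eq (a : ℚ × ℚ) (τ : ℍ) : frickeFun a τ =
    -(1 / 2592) * ModularForm.E₄ τ * ModularForm.E₆ τ * (ModularForm.discriminant τ)⁻¹ *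
      ((latticePair τ).weierstrassP (a.1 * τ + a.2) / (2 * Real.pi * Complex.I) ^ 2) := by
  rw [frickeFun, g₂_eq, g₃_eq, latticeDisc_eq, mul_pow _ Complex.I, Complex.I_sq]
  have h1 : (Real.pi : ℂ) ≠ 0 := by exact_mod_cast Real.pi_ne_zero
  by_cases h2 : ModularForm.discriminant τ = 0
  · simp [h2]
  field_simp
  ring

/-! ### Modular transformations -/

/-- The action of a matrix on row vectors of integers. -/
def rowEquiv (γ : SL(2, ℤ)) : (Fin 2 → ℤ) ≃ (Fin 2 → ℤ) where
  toFun x := Matrix.vecMul x γ.1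
  invFun x := Matrix.vecMul x (γ⁻¹ : SL(2, ℤ)).1
  left_inv x := by
    change Matrix.vecMul (Matrix.vecMul x γ.1) (γ⁻¹ : SL(2, ℤ)).1 = x
    rw [Matrix.vecMul_vecMul, ← Matrix.SpecialLinearGroup.coe_mul]
    simp
  right_inv x := by
    change Matrix.vecMul (Matrix.vecMul x (γ⁻¹ : SL(2, ℤ)).1) γ.1 = x
    rw [Matrix.vecMul_vecMul, ← Matrix.SpecialLinearGroup.coe_mul]
    simp

lemma denom_ne_zero' (γ : SL(2, ℤ)) (τ : ℍ) : (γ 1 0 : ℂ) * τ + γ 1 1 ≠ 0 := by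
  have := denom_ne_zero γ τ
  rwa [ModularGroup.denom_apply] at this

lemma coe_smul_mul_denom (γ : SL(2, ℤ)) (τ : ℍ) :
    ((γ • τ : ℍ) : ℂ) * ((γ 1 0 : ℂ) * τ + γ 1 1) = (γ 0 0 : ℂ) * τ + γ 0 1 := by
  rw [UpperHalfPlane.coe_specialLinearGroup_apply]
  simp only [algebraMap_int_eq, eq_intCast, Complex.ofReal_intCast]
  exact div_mul_cancel₀ _ (denom_ne_zero' γ τ)

/-- L_{γτ} = (cτ + d)⁻¹ L_τ; on coordinates the bijection is x ↦ xγ. -/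
lemma tsum_lattice_smul (γ : SL(2, ℤ)) (τ : ℍ) (F : ℂ → ℂ) :
    ∑' l : (latticePair (γ • τ)).lattice, F l =
      ∑' l : (latticePair τ).lattice, F (l / ((γ 1 0 : ℂ) * τ + γ 1 1)) := by
  rw [tsum_lattice, tsum_lattice τ fun l ↦ F (l / ((γ 1 0 : ℂ) * τ + γ 1 1)),
    ← (rowEquiv γ).tsum_eq fun x ↦ F ((x 0 * τ + x 1) / ((γ 1 0 : ℂ) * τ + γ 1 1))]
  refine tsum_congr fun x ↦ congrArg F ?_
  rw [eq_div_iff (denom_ne_zero' γ τ)]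
  simp only [rowEquiv, Equiv.coe_fn_mk, Matrix.vecMul, dotProduct, Fin.sum_univ_two]
  push_cast
  linear_combination (x 0 : ℂ) * coe_smul_mul_denom γ τ

lemma latticeG_smul (γ : SL(2, ℤ)) (τ : ℍ) (k : ℕ) : (latticePair (γ • τ)).G k =
    ((γ 1 0 : ℂ) * τ + γ 1 1) ^ k * (latticePair τ).G k := by
  rw [PeriodPair.G, tsum_lattice_smul γ τ fun l ↦ (l ^ k)⁻¹, PeriodPair.G, ← tsum_mul_left]
  refine tsum_congr fun l ↦ ?_
  rw [div_pow, inv_div, div_eq_mul_inv]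

lemma weierstrassP_smul (γ : SL(2, ℤ)) (τ : ℍ) (z : ℂ) : (latticePair (γ • τ)).weierstrassP z =
    ((γ 1 0 : ℂ) * τ + γ 1 1) ^ 2 *
      (latticePair τ).weierstrassP (z * ((γ 1 0 : ℂ) * τ + γ 1 1)) := by
  have hD := denom_ne_zero' γ τ
  rw [PeriodPair.weierstrassP, tsum_lattice_smul γ τ fun l ↦ 1 / (z - l) ^ 2 - 1 / l ^ 2,
    PeriodPair.weierstrassP, ← tsum_mul_left]
  refine tsum_congr fun l ↦ ?_
  set D := (γ 1 0 : ℂ) * τ + γ 1 1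
  have e : z - l / D = (z * D - l) / D := by field_simp
  rw [e, div_pow, div_pow, one_div_div, one_div_div, mul_sub, mul_one_div, mul_one_div]

/-- The prefactor has weight 4 + 6 − 12 = −2 and ℘ contributes weight 2, so only the index moves, to
the row vector aγ. -/
lemma frickeFun_smul (γ : SL(2, ℤ)) (a : ℚ × ℚ) (τ : ℍ) : frickeFun a (γ • τ) =
    frickeFun (a.1 * γ 0 0 + a.2 * γ 1 0, a.1 * γ 0 1 + a.2 * γ 1 1) τ := by
  have hD := denom_ne_zero' γ τ
  simp only [frickeFun, latticeDisc, PeriodPair.g₂, PeriodPair.g₃, latticeG_smul,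
    weierstrassP_smul]
  have e : ((a.1 : ℂ) * (γ • τ : ℍ) + a.2) * ((γ 1 0 : ℂ) * τ + γ 1 1) =
      ((a.1 * γ 0 0 + a.2 * γ 1 0 : ℚ) : ℂ) * τ + ((a.1 * γ 0 1 + a.2 * γ 1 1 : ℚ) : ℂ) := by
    push_cast
    linear_combination (a.1 : ℂ) * coe_smul_mul_denom γ τ
  rw [e]
  set D := (γ 1 0 : ℂ) * τ + γ 1 1
  set A := (latticePair τ).G 4
  set B := (latticePair τ).G 6
  have e2 : (60 * (D ^ 4 * A)) ^ 3 - 27 * (140 * (D ^ 6 * B)) ^ 2 =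
    D ^ 12 * ((60 * A) ^ 3 - 27 * (140 * B) ^ 2) := by ring
  rw [e2]
  by_cases h : (60 * A) ^ 3 - 27 * (140 * B) ^ 2 = 0
  · simp [h]
  field_simp

lemma frickeFun_add_int (a : ℚ × ℚ) (m n : ℤ) : frickeFun (a.1 + m, a.2 + n) = frickeFun a := by
  funext τ
  have hl : (m : ℂ) * τ + n ∈ (latticePair τ).lattice := by
    have := ((latticePair τ).latticeEquivProd.symm (m, n)).2
    rw [(latticePair τ).latticeEquiv_symm_apply] at this
    simpa [latticePair] using this
  have := (latticePair τ).weierstrassP_add_coe (a.1 * τ + a.2) ⟨_, hl⟩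
  simp only [frickeFun]
  rw [← this]
  push_cast
  ring_nf

/-- The value assigned to ℘ at its pole 0 is 0, so indices (r, s) divisible by N are harmless. -/
lemma frickeFun_zero : frickeFun (0, 0) = 0 := by
  funext τ
  simp [frickeFun]

/-! ### The functions attached to torsion points -/

section Torsion

variable {N : ℕ}

/-- The function `f_a` for `a = (r/N, s/N)`. -/
def torsionFun (N : ℕ) (r s : ℤ) : ℍ → ℂ := frickeFun ((r : ℚ) / N, (s : ℚ) / N)

lemma torsionFun_congr (hN : 0 < N) {r s r' s' : ℤ} (hr : (N : ℤ) ∣ r - r') (hs : (N : ℤ) ∣ s - s') :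
    torsionFun N r s = torsionFun N r' s' := by
  have hN0 : (N : ℚ) ≠ 0 := by exact_mod_cast hN.ne'
  obtain ⟨m, hm⟩ := hr
  obtain ⟨n, hn⟩ := hs
  rw [torsionFun, torsionFun, ← frickeFun_add_int ((r' : ℚ) / N, (s' : ℚ) / N) m n]
  congr 2
  · rw [sub_eq_iff_eq_add.1 hm]
    push_cast
    field_simp
    ring
  · rw [sub_eq_iff_eq_add.1 hn]
    push_cast
    field_simp
    ring

lemma torsionFun_emod (hN : 0 < N) (r s : ℤ) :
    torsionFun N r s = torsionFun N ((r % N).toNat : ℕ) ((s % N).toNat : ℕ) := by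
  have hN0 : (N : ℤ) ≠ 0 := by exact_mod_cast hN.ne'
  rw [Int.toNat_of_nonneg (Int.emod_nonneg _ hN0), Int.toNat_of_nonneg (Int.emod_nonneg _ hN0)]
  exact torsionFun_congr hN (Int.dvd_self_sub_emod) (Int.dvd_self_sub_emod)

lemma torsionFun_eq_zero_or (hN : 0 < N) (r s : ℤ) : torsionFun N r s = 0 ∨
    ∃ a ∈ torsionIndex N, torsionFun N r s = frickeFun a := by
  have hN0 : (0 : ℤ) < N := by exact_mod_cast hN
  have h1 (t : ℤ) : (t % N).toNat < N := by
    have := Int.emod_lt_of_pos t hN0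
    have := Int.emod_nonneg t hN0.ne'
    omega
  rw [torsionFun_emod hN]
  by_cases h : ((r % N).toNat, (s % N).toNat) = (0, 0)
  · left
    rw [Prod.mk.injEq] at h
    rw [h.1, h.2]
    simpa [torsionFun] using frickeFun_zero
  · exact Or.inr ⟨_, ⟨_, _, h1 r, h1 s, h, rfl⟩, by simp only [torsionFun, Int.cast_natCast]⟩

lemma torsionFun_mem (hN : 0 < N) (r s : ℤ) : torsionFun N r s ∈ meromorphicAlgebra := by
  rcases torsionFun_eq_zero_or hN r s with h | ⟨a, ha, h⟩
  · rw [h]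
    exact zero_mem _
  · rw [h]
    exact frickeFun_mem ha

/-- The function `f_a` for `a = (r/N, s/N)` in the field of meromorphic functions. -/
def torsionElt (hN : 0 < N) (r s : ℤ) : MeromorphicField := toMeromorphicField ⟨_, torsionFun_mem hN r s⟩

lemma torsionElt_mem (hN : 0 < N) (r s : ℤ) : torsionElt hN r s ∈ insert 0 (Set.range (frickeElt N)) := by
  rcases torsionFun_eq_zero_or hN r s with h | ⟨a, ha, h⟩
  · exact Or.inl ((congrArg toMeromorphicField (Subtype.ext h)).trans (map_zero _))
  · exact Or.inr ⟨⟨a, ha⟩, congrArg toMeromorphicField (Subtype.ext h.symm)⟩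

lemma frickeElt_eq_torsionElt (hN : 0 < N) (a : torsionIndex N) : ∃ r s : ℤ, frickeElt N a = torsionElt hN r s := by
  obtain ⟨_, r, s, -, -, -, rfl⟩ := a
  exact ⟨r, s, congrArg toMeromorphicField (Subtype.ext (by
    simp only [torsionFun, Int.cast_natCast]))⟩

lemma torsionElt_zero (hN : 0 < N) : torsionElt hN 0 0 = 0 := by
  have h : (⟨_, torsionFun_mem hN 0 0⟩ : meromorphicAlgebra) = 0 :=
    Subtype.ext (by simpa [torsionFun] using frickeFun_zero)
  rw [torsionElt, h, map_zero]

lemma torsionFun_smul (hN : 0 < N) (γ : SL(2, ℤ)) (r s : ℤ) (τ : ℍ) : torsionFun N r s (γ • τ) =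
    torsionFun N (r * γ 0 0 + s * γ 1 0) (r * γ 0 1 + s * γ 1 1) τ := by
  have hN0 : (N : ℚ) ≠ 0 := by exact_mod_cast hN.ne'
  rw [torsionFun, frickeFun_smul, torsionFun]
  congr 2
  · push_cast
    field_simp
  · push_cast
    field_simp

lemma inv_smul_torsionElt (hN : 0 < N) (γ : SL(2, ℤ)) (r s : ℤ) : γ⁻¹ • torsionElt hN r s =
    torsionElt hN (r * γ 0 0 + s * γ 1 0) (r * γ 0 1 + s * γ 1 1) :=
  congrArg toMeromorphicField (Subtype.ext (funext fun τ ↦ by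
    change torsionFun N r s (γ⁻¹⁻¹ • τ) = _
    rw [inv_inv, torsionFun_smul hN]))

/-- −1 acts trivially on ℍ; hence knowing a matrix up to sign modulo N suffices. -/
lemma SL_neg_one_smul (φ : MeromorphicField) : (-1 : SL(2, ℤ)) • φ = φ := by
  obtain ⟨f, rfl⟩ := toMeromorphicField_surjective φ
  refine congrArg toMeromorphicField (Subtype.ext (funext fun τ ↦ congrArg f.1 ?_))
  have : ((-1 : SL(2, ℤ))⁻¹) = -1 := by simp
  rw [this, ModularGroup.SL_neg_smul, one_smul]

/-! ### Expansions of the functions f_a -/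

lemma E_ne_zero {k : ℕ} (hk : 3 ≤ k) (hk2 : Even k) :
    toMeromorphicField ⟨ModularForm.E hk, modularForm_mem _⟩ ≠ 0 := by
  intro h
  have h1 : FieldQExp 1 0 (HahnSeries.ofPowerSeries ℤ ℂ (qExpansion 1 (ModularForm.E hk))) :=
    ⟨_, h, hasQExp_levelOne _⟩
  have h2 := congrArg (fun p ↦ HahnSeries.coeff p ((0 : ℕ) : ℤ)) (h1.eq_zero one_pos)
  rw [LaurentSeries.coeff_coe_powerSeries, EisensteinSeries.E_qExpansion_coeff_zero hk hk2] at h2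
  simp at h2

/-- The factor in front of `℘` has a non-zero expansion with algebraic coefficients. -/
lemma exists_hasQExp_prefactor (hN : 0 < N) : ∃ u ∈ algLaurent, u ≠ 0 ∧ HasQExp N (fun τ ↦
    -(1 / 2592) * ModularForm.E₄ τ * ModularForm.E₆ τ * (ModularForm.discriminant τ)⁻¹) u := by
  obtain ⟨p, hp, h4⟩ := exists_hasQExp_E hN (k := 4) (by norm_num) ⟨2, rfl⟩
  obtain ⟨r, hr, h6⟩ := exists_hasQExp_E hN (k := 6) (by norm_num) ⟨3, rfl⟩
  obtain ⟨d, hd, hΔ⟩ := exists_hasQExp_discriminant hN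
  have hC : (-(1 / 2592) : ℂ) ∈ Qbar := neg_mem (div_mem (one_mem _) (ofNat_mem Qbar 2592))
  have hne {k : ℕ} (hk : 3 ≤ k) (hk2 : Even k) {p : LaurentSeries ℂ}
      (h : HasQExp N (ModularForm.E hk) p) : p ≠ 0 := by
    rintro rfl
    exact E_ne_zero hk hk2 (FieldQExp.eq_zero_of_zero ⟨_, rfl, h⟩)
  refine ⟨HahnSeries.C (-(1 / 2592)) * p * r * d⁻¹,
    mul_mem (mul_mem (mul_mem (C_mem_algLaurent ⟨_, hC⟩) hp) hr) (inv_mem hd),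
    mul_ne_zero (mul_ne_zero (mul_ne_zero ?_ (hne _ ⟨2, rfl⟩ h4)) (hne _ ⟨3, rfl⟩ h6))
      (inv_ne_zero ?_), (((HasQExp.const N _).mul h4).mul h6).mul (hΔ.inv hN)⟩
  · rw [map_ne_zero]
    norm_num
  · rintro rfl
    obtain ⟨τ, hτ⟩ := hΔ.eventually_eq_zero.exists
    exact ModularForm.discriminant_ne_zero τ hτ

/-- The constant term of the normalised Weierstrass function. -/
def constTerm (N : ℕ) (r s : ℤ) : ℂ :=
  1 / 12 + if (N : ℤ) ∣ r then koebe (Function.Periodic.qParam N s) else 0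

/-- The factor `u` is the same for all (r, s). Cancelling it reduces the comparison of two f_a to
that of the constant terms of ℘/(2πi)². -/
lemma exists_hasQExp_torsionFun (hN : 0 < N) : ∃ u ≠ 0, ∀ r s : ℤ, ¬ ((N : ℤ) ∣ r ∧ (N : ℤ) ∣ s) →
    ∃ w : LaurentSeries ℂ, w.coeff 0 = constTerm N r s ∧ u * w ∈ algLaurent ∧
      HasQExp N (torsionFun N r s) (u * w) := by
  obtain ⟨u, hu, hu0, hup⟩ := exists_hasQExp_prefactor hN
  have hN0 : (0 : ℤ) < N := by exact_mod_cast hN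
  refine ⟨u, hu0, fun r s hrs ↦ ?_⟩
  have h1 : (r % N).toNat < N := by
    have := Int.emod_lt_of_pos r hN0
    have := Int.emod_nonneg r hN0.ne'
    omega
  have h2 : (r % N).toNat = 0 ↔ (N : ℤ) ∣ r := by
    rw [Int.dvd_iff_emod_eq_zero]
    have := Int.emod_nonneg r hN0.ne'
    omega
  obtain ⟨w, hw, hwq, -, hw0⟩ := exists_hasQExp_weierstrassP hN (s := s) h1
    fun h h' ↦ hrs ⟨h2.1 h, h'⟩
  refine ⟨w, ?_, mul_mem hu hw, ?_⟩
  · simp only [hw0, constTerm, h2]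
  · have e : torsionFun N r s = torsionFun N ((r % N).toNat : ℕ) s := by
      refine torsionFun_congr hN ?_ (by simp)
      rw [Int.toNat_of_nonneg (Int.emod_nonneg _ hN0.ne')]
      exact Int.dvd_self_sub_emod
    rw [e]
    refine (hup.mul hwq).congr (Eventually.of_forall fun τ ↦ ?_)
    rw [torsionFun, frickeFun_eq]
    simp only [torsionPoint, Int.cast_natCast, Rat.cast_div, Rat.cast_natCast, Rat.cast_intCast]

lemma exists_hasQExp_torsionFun' (hN : 0 < N) (r s : ℤ) :
    ∃ p ∈ algLaurent, HasQExp N (torsionFun N r s) p := by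
  by_cases h : (N : ℤ) ∣ r ∧ (N : ℤ) ∣ s
  · refine ⟨0, zero_mem _, ?_⟩
    have e : torsionFun N r s = fun _ ↦ 0 := by
      rw [torsionFun_congr hN (r' := 0) (s' := 0) (by simpa using h.1) (by simpa using h.2)]
      simpa [torsionFun] using! frickeFun_zero
    rw [e]
    simpa using HasQExp.const N 0
  · obtain ⟨u, -, hu⟩ := exists_hasQExp_torsionFun hN
    obtain ⟨w, -, hp, h⟩ := hu r s h
    exact ⟨_, hp, h⟩

lemma constTerm_eq_of_torsionElt_eq (hN : 0 < N) {r s r' s' : ℤ} (h : ¬ ((N : ℤ) ∣ r ∧ (N : ℤ) ∣ s))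
    (h' : ¬ ((N : ℤ) ∣ r' ∧ (N : ℤ) ∣ s')) (he : torsionElt hN r s = torsionElt hN r' s') :
    constTerm N r s = constTerm N r' s' := by
  obtain ⟨u, hu0, hu⟩ := exists_hasQExp_torsionFun hN
  obtain ⟨w, hw, -, hwq⟩ := hu r s h
  obtain ⟨w', hw', -, hwq'⟩ := hu r' s' h'
  have h1 : FieldQExp N (torsionElt hN r s) (u * w) := ⟨_, rfl, hwq⟩
  have h2 : FieldQExp N (torsionElt hN r s) (u * w') := ⟨_, he.symm, hwq'⟩
  rw [← hw, ← hw', mul_left_cancel₀ hu0 (h1.unique hN h2)]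

/-- At any cusp the function is again some f_{aγ}, so one expansion theorem at i∞ covers all cusps;
γ ≡ 1 mod N changes a only by integers. -/
lemma torsionElt_mem_algModularField (hN : 0 < N) (r s : ℤ) : torsionElt hN r s ∈ algModularField hN := by
  obtain ⟨p, hp, h⟩ := exists_hasQExp_torsionFun' hN r s
  refine mem_algModularFunctions.2 ⟨_, rfl, isModularFunction_of_hasQExp (torsionFun_mem hN r s)
    (fun γ hγ τ ↦ ?_) (fun γ ↦ ?_), p, hp, h⟩
  · have hγ' := (CongruenceSubgroup.Gamma_mem).1 hγ
    obtain ⟨h1, h2, h3, h4⟩ := hγ'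
    change torsionFun N r s (γ • τ) = torsionFun N r s τ
    rw [torsionFun_smul hN]
    refine congrFun (torsionFun_congr hN ?_ ?_) τ
    · rw [← ZMod.intCast_zmod_eq_zero_iff_dvd]
      push_cast
      rw [h1, h3]
      ring
    · rw [← ZMod.intCast_zmod_eq_zero_iff_dvd]
      push_cast
      rw [h2, h4]
      ring
  · obtain ⟨p, -, h⟩ := exists_hasQExp_torsionFun' hN
      (r * γ 0 0 + s * γ 1 0) (r * γ 0 1 + s * γ 1 1)
    exact ⟨p, h.congr (Eventually.of_forall fun τ ↦ (torsionFun_smul hN γ r s τ).symm)⟩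

/-! ### Matrices that fix all these functions -/

/-- Clearing denominators leaves (x − y)(1 − xy) = 0. -/
lemma koebe_injective {x y : ℂ} (hx : x ≠ 1) (hy : y ≠ 1) (h : koebe x = koebe y) :
    x = y ∨ x * y = 1 := by
  have hx' : 1 - x ≠ 0 := sub_ne_zero.2 hx.symm
  have hy' : 1 - y ≠ 0 := sub_ne_zero.2 hy.symm
  rw [koebe, koebe, div_eq_div_iff (pow_ne_zero _ hx') (pow_ne_zero _ hy')] at h
  have : (x - y) * (1 - x * y) = 0 := by linear_combination h
  rcases mul_eq_zero.1 this with h | h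
  · exact Or.inl (sub_eq_zero.1 h)
  · exact Or.inr (sub_eq_zero.1 h).symm

lemma qParam_intCast_eq_one_iff (hN : 0 < N) (s : ℤ) : Function.Periodic.qParam N s = 1 ↔ (N : ℤ) ∣ s := by
  have hN0 : (N : ℂ) ≠ 0 := by exact_mod_cast hN.ne'
  rw [Function.Periodic.qParam, Complex.exp_eq_one_iff]
  refine exists_congr fun n ↦ ?_
  have : 2 * (Real.pi : ℂ) * Complex.I * s / (N : ℝ) = n * (2 * Real.pi * Complex.I) ↔
      (s : ℂ) = N * n := by
    rw [Complex.ofReal_natCast, div_eq_iff hN0]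
    constructor
    · intro h
      apply mul_left_cancel₀ Complex.two_pi_I_ne_zero
      linear_combination h
    · intro h
      rw [h]
      ring
  rw [this]
  norm_cast

lemma qParam_add (h : ℝ) (z w : ℂ) : Function.Periodic.qParam h (z + w) =
    Function.Periodic.qParam h z * Function.Periodic.qParam h w := by
  simp only [Function.Periodic.qParam]
  rw [← Complex.exp_add]
  congr 1
  ring

/-- The index (0, 1/N) is sent to (c/N, d/N), with (c, d) the bottom row. If N ∤ c, equal constant
terms would force ζ/(1 − ζ)² = 0. So N ∣ c, and then ζᵈ equals ζ or ζ⁻¹. -/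
lemma bottom_row_of_fixes (hN : 0 < N) (hN1 : 1 < N) {γ : SL(2, ℤ)}
    (h : γ⁻¹ • torsionElt hN 0 1 = torsionElt hN 0 1) :
    (N : ℤ) ∣ γ 1 0 ∧ ((N : ℤ) ∣ γ 1 1 - 1 ∨ (N : ℤ) ∣ γ 1 1 + 1) := by
  have h1 : ¬ (N : ℤ) ∣ 1 := by
    intro h
    have := Int.le_of_dvd one_pos h
    omega
  rw [inv_smul_torsionElt] at h
  simp only [zero_mul, one_mul, zero_add] at h
  have hdet := γ.det_coe
  rw [Matrix.det_fin_two] at hdet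
  have h2 : ¬ ((N : ℤ) ∣ γ 1 0 ∧ (N : ℤ) ∣ γ 1 1) := by
    rintro ⟨h2, h3⟩
    refine h1 ?_
    rw [← hdet]
    exact dvd_sub (h3.mul_left _) (h2.mul_left _)
  have h3 := constTerm_eq_of_torsionElt_eq hN h2 (by simpa using h1) h
  rw [constTerm, constTerm, if_pos (dvd_zero _), add_right_inj] at h3
  have hq1 : Function.Periodic.qParam N ((1 : ℤ) : ℂ) ≠ 1 := fun h ↦
    h1 ((qParam_intCast_eq_one_iff hN 1).1 h)
  have h4 : (N : ℤ) ∣ γ 1 0 := by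
    by_contra h5
    rw [if_neg h5, koebe, eq_comm, div_eq_zero_iff] at h3
    rcases h3 with h3 | h3
    · exact Function.Periodic.qParam_ne_zero _ h3
    · exact pow_ne_zero 2 (sub_ne_zero.2 hq1.symm) h3
  refine ⟨h4, ?_⟩
  rw [if_pos h4] at h3
  have hq2 : Function.Periodic.qParam N ((γ 1 1 : ℤ) : ℂ) ≠ 1 := fun h ↦
    h2 ⟨h4, (qParam_intCast_eq_one_iff hN _).1 h⟩
  refine (koebe_injective hq2 hq1 h3).imp (fun h5 ↦ ?_) (fun h5 ↦ ?_)
  · rw [← qParam_intCast_eq_one_iff hN]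
    push_cast
    rw [sub_eq_add_neg, qParam_add, h5, qParam_neg, Int.cast_one, mul_inv_cancel₀]
    exact Function.Periodic.qParam_ne_zero _
  · rw [← qParam_intCast_eq_one_iff hN]
    push_cast
    rw [qParam_add]
    simpa only [Int.cast_one] using h5

/-- The bottom row of γ is known up to sign modulo N. The conjugate by S also fixes every f_a, and
its lower left entry −b gives N ∣ b; the determinant then fixes the remaining entry. -/
lemma mem_Gamma_or_neg_mem (hN : 0 < N) {γ : SL(2, ℤ)}
    (h : ∀ r s : ℤ, γ • torsionElt hN r s = torsionElt hN r s) :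
    γ ∈ CongruenceSubgroup.Gamma N ∨ -γ ∈ CongruenceSubgroup.Gamma N := by
  rcases (Nat.succ_le_of_lt hN).eq_or_lt with rfl | hN1
  · left
    simp [CongruenceSubgroup.Gamma_one_top]
  have hinv (δ : SL(2, ℤ)) (h : ∀ r s : ℤ, δ • torsionElt hN r s = torsionElt hN r s) (r s : ℤ) :
      δ⁻¹ • torsionElt hN r s = torsionElt hN r s := by
    rw [inv_smul_eq_iff, h]
  have hS (r s : ℤ) : (ModularGroup.S * γ * ModularGroup.S⁻¹) • torsionElt hN r s =
      torsionElt hN r s := by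
    rw [mul_smul, mul_smul, inv_smul_torsionElt, h, ← inv_smul_torsionElt, smul_inv_smul]
  obtain ⟨h1, h2⟩ := bottom_row_of_fixes hN hN1 (hinv _ h 0 1)
  obtain ⟨h3, -⟩ := bottom_row_of_fixes hN hN1 (hinv _ hS 0 1)
  have e3 : (ModularGroup.S * γ * ModularGroup.S⁻¹) 1 0 = -γ 0 1 := by
    rw [Matrix.SpecialLinearGroup.coe_mul, Matrix.SpecialLinearGroup.coe_mul,
      Matrix.SpecialLinearGroup.coe_inv, ModularGroup.coe_S, Matrix.adjugate_fin_two]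
    simp [Matrix.mul_apply, Matrix.vecMul, dotProduct, Fin.sum_univ_two]
  rw [e3, dvd_neg] at h3
  have hdet := γ.det_coe
  rw [Matrix.det_fin_two] at hdet
  have hdet' := congrArg (Int.cast : ℤ → ZMod N) hdet
  have h1' := (ZMod.intCast_zmod_eq_zero_iff_dvd _ N).2 h1
  have h3' := (ZMod.intCast_zmod_eq_zero_iff_dvd _ N).2 h3
  push_cast at hdet'
  rw [h1', h3', mul_zero, sub_zero] at hdet'
  rcases h2 with h2 | h2 <;> have h2' := (ZMod.intCast_zmod_eq_zero_iff_dvd _ N).2 h2 <;>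
    push_cast at h2'
  · left
    have h4 := sub_eq_zero.1 h2'
    rw [h4, mul_one] at hdet'
    exact CongruenceSubgroup.Gamma_mem.2 ⟨hdet', h3', h1', h4⟩
  · right
    have h4 := eq_neg_of_add_eq_zero_left h2'
    rw [h4, mul_neg, mul_one] at hdet'
    refine CongruenceSubgroup.Gamma_mem.2 ⟨?_, ?_, ?_, ?_⟩ <;>
      simp [h1', h3', h4, hdet']

end Torsion

/-! ### The Galois correspondence -/

/-- Artin's theorem makes K Galois over the fixed field of the finite image of S. L contains that
field, and its fixing group is trivial, so L = K. -/
theorem Subfield.eq_top_of_fixing {S K : Type*} [Group S] [Field K] [MulSemiringAction S K]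
    (H : Subgroup S) [H.FiniteIndex] (hH : ∀ γ ∈ H, ∀ x : K, γ • x = x) (L : Subfield K)
    (hfix : ∀ x : K, (∀ γ : S, γ • x = x) → x ∈ L)
    (hfaith : ∀ γ : S, (∀ x ∈ L, γ • x = x) → ∀ x : K, γ • x = x) : L = ⊤ := by
  let f : S →* RingAut K := MulSemiringAction.toRingAut S K
  have hker : H ≤ f.ker := fun γ hγ ↦ by
    rw [MonoidHom.mem_ker]
    exact RingEquiv.ext (hH γ hγ)
  have : f.ker.FiniteIndex := Subgroup.finiteIndex_of_le hker
  let G : Subgroup (RingAut K) := f.range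
  have : Finite G := Finite.of_equiv _ (QuotientGroup.quotientKerEquivRange f).toEquiv
  -- The hypothesis on invariants is what makes L an extension of the fixed field.
  let L' : IntermediateField (FixedPoints.subfield G K) K := L.toIntermediateField fun x ↦
    hfix x fun γ ↦ x.2 ⟨f γ, γ, rfl⟩
  have hbot : L'.fixingSubgroup = ⊥ := by
    rw [eq_bot_iff]
    intro σ hσ
    obtain ⟨⟨_, γ, rfl⟩, rfl⟩ := FixedPoints.toAlgAut_surjective G K σ
    rw [Subgroup.mem_bot]
    ext x
    refine hfaith γ (fun y hy ↦ ?_) x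
    exact (IntermediateField.mem_fixingSubgroup_iff _ _).1 hσ y hy
  have htop : L' = ⊤ := by
    rw [← IsGalois.fixedField_fixingSubgroup L', hbot, IntermediateField.fixedField_bot]
  rw [eq_top_iff]
  intro x _
  have : x ∈ L' := by
    rw [htop]
    exact IntermediateField.mem_top
  exact this

/-! ### Generators over ℂ and descent to algebraic coefficients -/

/-- The field of modular functions of level `N` over `ℂ`. -/
def modularSubfield {N : ℕ} (hN : 0 < N) : Subfield MeromorphicField where
  carrier := {φ | (∀ γ ∈ CongruenceSubgroup.Gamma N, γ • φ = φ) ∧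
    ∀ γ : SL(2, ℤ), ∃ p, FieldQExp N (γ • φ) p}
  mul_mem' := fun ⟨h1, h2⟩ ⟨h3, h4⟩ ↦ ⟨fun γ hγ ↦ by rw [smul_mul', h1 γ hγ, h3 γ hγ], fun γ ↦ by
    obtain ⟨p, hp⟩ := h2 γ
    obtain ⟨r, hr⟩ := h4 γ
    rw [smul_mul']
    exact ⟨_, hp.mul hr⟩⟩
  add_mem' := fun ⟨h1, h2⟩ ⟨h3, h4⟩ ↦ ⟨fun γ hγ ↦ by rw [smul_add, h1 γ hγ, h3 γ hγ], fun γ ↦ by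
    obtain ⟨p, hp⟩ := h2 γ
    obtain ⟨r, hr⟩ := h4 γ
    rw [smul_add]
    exact ⟨_, hp.add hr⟩⟩
  neg_mem' := fun ⟨h1, h2⟩ ↦ ⟨fun γ hγ ↦ by rw [smul_neg, h1 γ hγ], fun γ ↦ by
    obtain ⟨p, hp⟩ := h2 γ
    rw [smul_neg]
    exact ⟨_, hp.neg⟩⟩
  one_mem' := ⟨fun γ _ ↦ smul_one γ, fun γ ↦ ⟨1, by
    rw [smul_one]
    simpa using FieldQExp.const N 1⟩⟩
  zero_mem' := ⟨fun γ _ ↦ smul_zero γ, fun γ ↦ ⟨0, by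
    rw [smul_zero]
    simpa using FieldQExp.const N 0⟩⟩
  inv_mem' := fun _ ⟨h1, h2⟩ ↦ ⟨fun γ hγ ↦ by rw [smul_inv'', h1 γ hγ], fun γ ↦ by
    obtain ⟨p, hp⟩ := h2 γ
    rw [smul_inv'']
    exact ⟨_, hp.inv hN⟩⟩

section

variable {N : ℕ}

instance modularSubfield_isInvariantSubfield (hN : 0 < N) :
    IsInvariantSubfield SL(2, ℤ) (modularSubfield hN) where
  smul_mem γ φ hφ := by
    refine ⟨fun δ hδ ↦ ?_, fun δ ↦ ?_⟩
    · have h := hφ.1 (γ⁻¹ * δ * γ) (by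
        simpa using (CongruenceSubgroup.Gamma_normal N).conj_mem δ hδ γ⁻¹)
      rw [mul_smul, mul_smul, inv_smul_eq_iff] at h
      exact h
    · rw [← mul_smul]
      exact hφ.2 _

lemma algModularField_subset_modularSubfield (hN : 0 < N) :
    (algModularField hN : Set MeromorphicField) ⊆ modularSubfield hN := by
  intro φ hφ
  obtain ⟨f, rfl, hf, -⟩ := mem_algModularFunctions.1 hφ
  refine ⟨fun γ hγ ↦ ?_, fun γ ↦ ?_⟩
  · exact congrArg toMeromorphicField
      (Subtype.ext (funext fun τ ↦ hf.invariant _ (inv_mem hγ) τ))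
  · obtain ⟨p, hp⟩ := hf.exists_hasQExp γ⁻¹
    exact ⟨p, _, rfl, hp⟩

/-- Artin's argument on the field of level N functions: the invariants lie in ℂ(j), and whatever
fixes all f_a lies in ±Γ(N), hence acts trivially. -/
theorem modularSubfield_subset_adjoin (hN : 0 < N) {φ : MeromorphicField}
    (hφ : φ ∈ modularSubfield hN) :
    φ ∈ IntermediateField.adjoin ℂ ({jElt} ∪ Set.range (frickeElt N)) := by
  have : NeZero N := ⟨hN.ne'⟩
  set M := IntermediateField.adjoin ℂ ({jElt} ∪ Set.range (frickeElt N)) with hM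
  have htop : M.toSubfield.comap (modularSubfield hN).subtype = ⊤ := by
    refine Subfield.eq_top_of_fixing (CongruenceSubgroup.Gamma N)
      (fun γ hγ x ↦ Subtype.ext (x.2.1 γ hγ)) _ (fun x hx ↦ ?_) (fun γ hγ x ↦ ?_)
    · have hinv (γ : SL(2, ℤ)) : γ • x.1 = x.1 := congrArg Subtype.val (hx γ)
      obtain ⟨p, hp⟩ := x.2.2 1
      rw [one_smul] at hp
      exact IntermediateField.adjoin.mono ℂ _ _ Set.subset_union_left
        (mem_adjoin_jElt hN hinv hp)
    · have hT (r s : ℤ) : γ • torsionElt hN r s = torsionElt hN r s := by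
        have h1 : torsionElt hN r s ∈ M := by
          rcases torsionElt_mem hN r s with h | h
          · rw [h]
            exact zero_mem _
          · exact IntermediateField.subset_adjoin _ _ (Or.inr h)
        exact congrArg Subtype.val (hγ ⟨torsionElt hN r s,
          algModularField_subset_modularSubfield hN (torsionElt_mem_algModularField hN r s)⟩ h1)
      refine Subtype.ext ?_
      rcases mem_Gamma_or_neg_mem hN hT with h | h
      · exact x.2.1 γ h
      · have h2 := x.2.1 _ h
        rw [← neg_one_mul, mul_smul, SL_neg_one_smul] at h2
        exact h2
  have : (⟨φ, hφ⟩ : modularSubfield hN) ∈ M.toSubfield.comap (modularSubfield hN).subtype := by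
    rw [htop]
    trivial
  exact this

theorem algModularField_eq_adjoin (hN : 0 < N) : algModularField hN =
    IntermediateField.adjoin Qbar ({jElt} ∪ Set.range (frickeElt N)) := by
  have hle : IntermediateField.adjoin Qbar ({jElt} ∪ Set.range (frickeElt N)) ≤
      algModularField hN := by
    rw [IntermediateField.adjoin_le_iff]
    rintro _ (rfl | ⟨a, rfl⟩)
    · exact jElt_mem hN
    · obtain ⟨r, s, h⟩ := frickeElt_eq_torsionElt hN a
      rw [h]
      exact torsionElt_mem_algModularField hN r s
  refine le_antisymm (fun φ hφ ↦ ?_) hle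
  have hsub := algModularField_subset_qExpField hN
  refine mem_of_mem_adjoin_complex hN (subset_trans hle hsub) ?_ (hsub hφ)
  exact IntermediateField.adjoin.mono ℂ _ _ (IntermediateField.subset_adjoin Qbar _)
    (modularSubfield_subset_adjoin hN (algModularField_subset_modularSubfield hN hφ))

/-- Invariance places φ in ℂ(j); its algebraic coefficients bring it down to `QbarJ`. -/
lemma mem_QbarJ_of_smul_eq (hN : 0 < N) {φ : MeromorphicField} (hφ : φ ∈ algModularField hN)
    (hinv : ∀ γ : SL(2, ℤ), γ • φ = φ) : φ ∈ QbarJ := by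
  have hsub := algModularField_subset_qExpField hN
  have hle : QbarJ ≤ algModularField hN :=
    IntermediateField.adjoin_le_iff.2 (Set.singleton_subset_iff.2 (jElt_mem hN))
  obtain ⟨p, hp, h⟩ := hsub hφ
  exact mem_of_mem_adjoin_complex hN (subset_trans hle hsub)
    (IntermediateField.adjoin.mono ℂ _ _ (IntermediateField.subset_adjoin Qbar _)
      (mem_adjoin_jElt hN hinv h)) (hsub hφ)

/-! ### The extension is Galois -/

lemma finite_torsionIndex (N : ℕ) : (torsionIndex N).Finite := by
  refine ((Set.finite_Iio N).prod (Set.finite_Iio N) |>.image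
    fun x : ℕ × ℕ ↦ ((x.1 : ℚ) / N, (x.2 : ℚ) / N)).subset ?_
  rintro _ ⟨r, s, hr, hs, -, rfl⟩
  exact ⟨(r, s), ⟨hr, hs⟩, rfl⟩

lemma finite_frickeElt (N : ℕ) : (insert 0 (Set.range (frickeElt N))).Finite := by
  have := (finite_torsionIndex N).to_subtype
  exact (Set.finite_range _).insert 0

/-- The polynomial whose roots are `0` and the functions `f_a`. -/
def frickePolynomial (N : ℕ) : Polynomial MeromorphicField :=
  ∏ t ∈ (finite_frickeElt N).toFinset, (Polynomial.X - Polynomial.C t)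

/-- Together with 0 the f_a are exactly the functions attached to all integer pairs (r, s), so
stability needs no check that aγ stays away from the zero index. -/
lemma smul_mem_frickeElt (hN : 0 < N) (γ : SL(2, ℤ)) {t : MeromorphicField}
    (ht : t ∈ insert 0 (Set.range (frickeElt N))) :
    γ • t ∈ insert 0 (Set.range (frickeElt N)) := by
  obtain ⟨r, s, rfl⟩ : ∃ r s : ℤ, t = torsionElt hN r s := by
    rcases ht with rfl | ⟨a, rfl⟩
    · exact ⟨0, 0, (torsionElt_zero hN).symm⟩
    · exact frickeElt_eq_torsionElt hN a
  rw [← inv_inv γ, inv_smul_torsionElt]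
  exact torsionElt_mem hN _ _

lemma map_frickePolynomial (hN : 0 < N) (γ : SL(2, ℤ)) :
    (frickePolynomial N).map (MulSemiringAction.toRingHom _ MeromorphicField γ) =
      frickePolynomial N := by
  rw [frickePolynomial, Polynomial.map_prod]
  refine Finset.prod_equiv (MulAction.toPerm γ) (fun t ↦ ?_) (fun t _ ↦ ?_)
  · rw [Set.Finite.mem_toFinset, Set.Finite.mem_toFinset, MulAction.toPerm_apply]
    refine ⟨smul_mem_frickeElt hN γ, fun h ↦ ?_⟩
    simpa using smul_mem_frickeElt hN γ⁻¹ h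
  · simp

/-- SL₂(ℤ) only permutes the roots, so the coefficients are invariant; they also have algebraic
expansions. -/
lemma coeff_frickePolynomial_mem (hN : 0 < N) (n : ℕ) :
    (frickePolynomial N).coeff n ∈ QbarJ := by
  refine mem_QbarJ_of_smul_eq hN ?_ fun γ ↦ ?_
  · have h : frickePolynomial N ∈ Polynomial.lifts (algebraMap (algModularField hN) _) := by
      refine prod_mem fun t ht ↦ ?_
      have ht' : t ∈ algModularField hN := by
        rw [Set.Finite.mem_toFinset] at ht
        rcases ht with rfl | ⟨a, rfl⟩
        · exact zero_mem _
        · obtain ⟨r, s, h⟩ := frickeElt_eq_torsionElt hN a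
          rw [h]
          exact torsionElt_mem_algModularField hN r s
      exact ⟨Polynomial.X - Polynomial.C ⟨t, ht'⟩, by simp⟩
    obtain ⟨y, hy⟩ := (Polynomial.lifts_iff_coeff_lifts _).1 h n
    rw [← hy]
    exact y.2
  · have := congrArg (fun P ↦ Polynomial.coeff P n) (map_frickePolynomial hN γ)
    rwa [Polynomial.coeff_map] at this

/-- The extra root 0 does not enlarge the field generated by the roots. -/
theorem exists_isSplittingField (hN : 0 < N) : ∃ p : Polynomial QbarJ,
    p.IsSplittingField QbarJ (IntermediateField.adjoin QbarJ (Set.range (frickeElt N))) := by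
  have h : frickePolynomial N ∈ Polynomial.lifts (algebraMap QbarJ MeromorphicField) :=
    (Polynomial.lifts_iff_coeff_lifts _).2 fun n ↦ ⟨⟨_, coeff_frickePolynomial_mem hN n⟩, rfl⟩
  obtain ⟨p, hp⟩ := (Polynomial.mem_lifts _).1 h
  have hp0 : p ≠ 0 := by
    rintro rfl
    rw [Polynomial.map_zero, frickePolynomial, eq_comm, Finset.prod_eq_zero_iff] at hp
    obtain ⟨t, -, ht⟩ := hp
    exact Polynomial.X_sub_C_ne_zero t ht
  have hsplit : (p.map (algebraMap QbarJ MeromorphicField)).Splits := by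
    rw [hp, frickePolynomial]
    exact Polynomial.Splits.prod fun t _ ↦ Polynomial.Splits.X_sub_C t
  have hroot : p.rootSet MeromorphicField = insert 0 (Set.range (frickeElt N)) := by
    ext t
    rw [Polynomial.mem_rootSet, Polynomial.aeval_def, ← Polynomial.eval_map, hp, frickePolynomial,
      Polynomial.eval_prod, Finset.prod_eq_zero_iff]
    simp [hp0, sub_eq_zero, eq_comm]
  have hadj : IntermediateField.adjoin QbarJ (p.rootSet MeromorphicField) =
      IntermediateField.adjoin QbarJ (Set.range (frickeElt N)) := by
    rw [hroot]
    refine le_antisymm (IntermediateField.adjoin_le_iff.2 ?_)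
      (IntermediateField.adjoin.mono _ _ _ (Set.subset_insert _ _))
    rintro t (rfl | ht)
    · exact zero_mem _
    · exact IntermediateField.subset_adjoin _ _ ht
  refine ⟨p, ?_⟩
  rw [← hadj]
  exact IntermediateField.adjoin_rootSet_isSplittingField hsplit

end

/-! ### The extension is finite Galois and has the stated generators -/

theorem mainTheorem9 (N : ℕ) (hN : 0 < N) :
    ∃ F : IntermediateField QbarJ MeromorphicField,
      (F : Set MeromorphicField) = algModularFunctions N ∧
      FiniteDimensional QbarJ F ∧
      IsGalois QbarJ F ∧
      F.restrictScalars Qbar =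
        IntermediateField.adjoin Qbar ({jElt} ∪ Set.range (frickeElt N)) := by
  obtain ⟨p, hp⟩ := exists_isSplittingField hN
  have hres : (IntermediateField.adjoin QbarJ (Set.range (frickeElt N))).restrictScalars Qbar =
      IntermediateField.adjoin Qbar ({jElt} ∪ Set.range (frickeElt N)) :=
    IntermediateField.adjoin_adjoin_left Qbar _ _
  -- Characteristic zero supplies separability; normality comes from the splitting field.
  have : CharZero QbarJ := algebraRat.charZero _
  have hnormal := Normal.of_isSplittingField p (hFEp := hp)
  refine ⟨IntermediateField.adjoin QbarJ (Set.range (frickeElt N)), ?_,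
    Polynomial.IsSplittingField.finiteDimensional _ p, ⟨⟩, hres⟩
  rw [← algModularField_eq_adjoin hN] at hres
  exact congrArg (fun E : IntermediateField Qbar MeromorphicField ↦ (E : Set MeromorphicField)) hres

end
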